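/- Let $M$ be a closed oriented smooth $3$-manifold, let $\sigma_0$ be an oriented trivialization of $TM$ (a continuous family of orientation-preserving isomorphisms $\sigma_0(p)\colon\mathbb R^3\to T_pM$), and let $\mathrm{Mod}(M)$ be the group of isotopy classes of orientation-preserving diffeomorphisms of $M$. For an orientation-preserving diffeomorphism $f$ put $$\mathcal D(f)\colon M\to \mathrm{GL}_3^+(\mathbb R),\qquad \mathcal D(f)(p)=\sigma_0(f(p))^{-1}\circ D_pf\circ\sigma_0(p).$$ The homotopy class of $\mathcal D(f)$ depends only on $[f]\in\mathrm{Mod}(M)$. The twisting crossed homomorphism $\mathfrak T\colon\mathrm{Mod}(M)\to H^1(M;\mathbb Z/2)$ sends $[f]$ to the class corresponding, under $H^1(M;\mathbb Z/2)=\mathrm{Hom}(\pi_1(M),\mathbb Z/2)$, to the map induced by $\mathcal D(f)$ on $\pi_1$ followed by $\pi_1(\mathrm{GL}_3^+(\mathbb R))\cong\mathbb Z/2$; that is, $\mathfrak T([f])$ is the unique class whose value on a loop $\gamma$ is $0$ if $\mathcal D(f)\circ\gamma$ is null-homotopic and $1$ otherwise. Let $S\subset M$ be a smoothly embedded $2$-sphere,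 and let $T_S\in\mathrm{Mod}(M)$ be the sphere twist about $S$: the isotopy class of a diffeomorphism that is the identity outside a tubular neighbourhood $U\cong S^2\times[0,1]$ of $S$ and has the form $(s,t)\mapsto(\ell(t)\cdot s,t)$ on $U$, where $\ell\colon[0,1]\to\mathrm{SO}(3)$ is a loop that rotates $\mathbb R^3$ about an axis by one full turn. Then $\mathfrak T(T_S)\in H^1(M;\mathbb Z/2)$ is Poincaré dual to $[S]\in H_2(M;\mathbb Z/2)$, that is, its cap product with the mod-$2$ fundamental class $[M]\in H_3(M;\mathbb Z/2)$ is $[S]$. Moreover, for every smooth loop $\gamma\colon\mathbb R/\mathbb Z\to M$ transverse to $S$, the set $\gamma^{-1}(S)$ is finite and $\mathfrak T(T_S)([\gamma])=\#\gamma^{-1}(S)\bmod 2$. -/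

import Mathlib

open scoped Manifold ContDiff Topology MatrixGroups

noncomputable section

namespace SphereTwist

/-! ### Singular chains, cochains and the cap product with coefficients in `ℤ/2` -/

/-- Singular `n`-simplices of `X`. -/
abbrev SingularSimplex (n : ℕ) (X : Type*) [TopologicalSpace X] : Type _ :=
  C(stdSimplex ℝ (Fin (n + 1)), X)

/-- The face of a singular simplex spanned by the vertices `g 0, …, g m`. -/
def SingularSimplex.face {m n : ℕ} {X : Type*} [TopologicalSpace X] (g : Fin (m + 1) → Fin (n + 1))
    (σ : SingularSimplex n X) : SingularSimplex m X :=
  σ.comp ⟨stdSimplex.map g, stdSimplex.continuous_map g⟩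

/-- Singular `n`-chains with `ℤ/2` coefficients. -/
abbrev Chain (n : ℕ) (X : Type*) [TopologicalSpace X] : Type _ :=
  SingularSimplex n X →₀ ZMod 2

/-- The boundary map; no signs are needed modulo `2`. -/
def boundary (n : ℕ) (X : Type*) [TopologicalSpace X] : Chain (n + 1) X →ₗ[ZMod 2] Chain n X :=
  ∑ i : Fin (n + 2), Finsupp.lmapDomain (ZMod 2) (ZMod 2) (SingularSimplex.face (Fin.succAbove i))

/-- The chain map induced by a continuous map. -/
def pushforward (n : ℕ) {X Y : Type*} [TopologicalSpace X] [TopologicalSpace Y] (f : C(X, Y)) :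
    Chain n X →ₗ[ZMod 2] Chain n Y :=
  Finsupp.lmapDomain (ZMod 2) (ZMod 2) (fun σ : SingularSimplex n X => f.comp σ)

/-- The chains of `X` all of whose simplices lie in `A`. -/
def chainsIn (n : ℕ) {X : Type*} [TopologicalSpace X] (A : Set X) :
    Submodule (ZMod 2) (Chain n X) :=
  Finsupp.supported (ZMod 2) (ZMod 2) {σ : SingularSimplex n X | Set.range σ ⊆ A}

/-- Cycles representing the mod-`2` fundamental class of an `(n+1)`-manifold `X`: cycles `z` whose
image in `H_{n+1}(X, X ∖ {x}; ℤ/2)` is nonzero for every point `x`, where the class of `z` in the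
relative group vanishes iff `z` is the sum of a boundary and a chain in `X ∖ {x}`.  (The relative
group is isomorphic to `ℤ/2` for an `(n+1)`-manifold, so its nonzero element is its generator.) -/
def IsFundamentalCycle (n : ℕ) {X : Type*} [TopologicalSpace X] (z : Chain (n + 1) X) : Prop :=
  boundary n X z = 0 ∧
    ∀ x : X, z ∉ LinearMap.range (boundary (n + 1) X) ⊔ chainsIn (n + 1) ({x}ᶜ : Set X)

/-- Singular `n`-cochains with `ℤ/2` coefficients. -/
abbrev Cochain (n : ℕ) (X : Type*) [TopologicalSpace X] : Type _ :=
  SingularSimplex n X → ZMod 2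

/-- The coboundary map. -/
def coboundary (n : ℕ) (X : Type*) [TopologicalSpace X] :
    Cochain n X →ₗ[ZMod 2] Cochain (n + 1) X :=
  ∑ i : Fin (n + 2), LinearMap.funLeft (ZMod 2) (ZMod 2) (SingularSimplex.face (Fin.succAbove i))

/-- Singular `1`-cocycles. -/
abbrev OneCocycle (X : Type*) [TopologicalSpace X] : Submodule (ZMod 2) (Cochain 1 X) :=
  LinearMap.ker (coboundary 1 X)

/-- The singular cohomology group `H¹(X; ℤ/2)`. -/
abbrev H1 (X : Type*) [TopologicalSpace X] : Type _ :=
  OneCocycle X ⧸ (LinearMap.range (coboundary 0 X)).submoduleOf (OneCocycle X)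

/-- The cap product of a `3`-chain with a `1`-cochain:
`[v₀, v₁, v₂, v₃] ∩ c = c([v₀, v₁]) [v₁, v₂, v₃]`. -/
def cap {X : Type*} [TopologicalSpace X] (c : Cochain 1 X) : Chain 3 X →ₗ[ZMod 2] Chain 2 X :=
  Finsupp.linearCombination (ZMod 2) fun σ : SingularSimplex 3 X =>
    c (σ.face ![0, 1]) • Finsupp.single (σ.face ![1, 2, 3]) (1 : ZMod 2)

/-- `a ∈ H¹(X; ℤ/2)` is Poincaré dual to the class in `H₂(X; ℤ/2)` of the `2`-cycle `y`:
the cap product of `a` with the fundamental class of the `3`-manifold `X` is `[y]`. -/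
def IsPoincareDual {X : Type*} [TopologicalSpace X] (a : H1 X) (y : Chain 2 X) : Prop :=
  ∀ (c : OneCocycle X) (z : Chain 3 X), Submodule.Quotient.mk c = a → IsFundamentalCycle 2 z →
    cap c.1 z - y ∈ LinearMap.range (boundary 2 X)

/-- A path, seen as a singular `1`-simplex. -/
def pathSimplex {X : Type*} [TopologicalSpace X] {p q : X} (γ : Path p q) : SingularSimplex 1 X :=
  γ.toContinuousMap.comp ⟨stdSimplexHomeomorphUnitInterval, stdSimplexHomeomorphUnitInterval.continuous⟩

theorem coboundary_loop {X : Type*} [TopologicalSpace X] {p : X} (γ : Path p p) (b : Cochain 0 X) :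
    coboundary 0 X b (pathSimplex γ) = 0 := by
  have key : ∀ g : Fin 1 → Fin 2, (pathSimplex γ).face g = ContinuousMap.const _ p := by
    intro g
    ext x
    have hx : (stdSimplex.map g x).1 1 = 0 ∨ (stdSimplex.map g x).1 1 = 1 := by
      have h1 : x = stdSimplex.vertex 0 := Subsingleton.elim _ _
      rw [h1, stdSimplex.map_vertex]
      generalize g 0 = k
      fin_cases k
      · left; rfl
      · right; rfl
    change γ (stdSimplexHomeomorphUnitInterval (stdSimplex.map g x)) = p
    rcases hx with hx | hx
    · have : stdSimplexHomeomorphUnitInterval (stdSimplex.map g x) = 0 := Subtype.ext hx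
      rw [this, γ.source]
    · have : stdSimplexHomeomorphUnitInterval (stdSimplex.map g x) = 1 := Subtype.ext hx
      rw [this, γ.target]
  have h : coboundary 0 X b (pathSimplex γ) =
      ∑ i : Fin 2, b ((pathSimplex γ).face (Fin.succAbove i)) := by
    simp [coboundary]
  rw [h, Fin.sum_univ_two, key, key]
  exact CharTwo.add_self_eq_zero _

/-- The evaluation of a class in `H¹(X; ℤ/2)` on a loop. -/
def H1.eval {X : Type*} [TopologicalSpace X] (a : H1 X) {p : X} (γ : Path p p) : ZMod 2 :=
  Submodule.liftQ ((LinearMap.range (coboundary 0 X)).submoduleOf (OneCocycle X))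
    ((LinearMap.proj (pathSimplex γ)).comp (OneCocycle X).subtype)
    (by
      rintro c ⟨b, hb⟩
      rw [LinearMap.mem_ker, LinearMap.comp_apply, ← hb]
      exact coboundary_loop γ b) a

/-- The inverse of the identification `H¹(X; ℤ/2) = Hom(π₁(X), ℤ/2)`: the cohomology class whose
value on every loop is prescribed by `w` (such a class is unique; it exists iff `w` is induced by
homomorphisms on the fundamental groups). -/
def H1.ofLoops {X : Type*} [TopologicalSpace X] (w : ∀ p : X, Path p p → ZMod 2) : H1 X :=
  Classical.epsilon fun a : H1 X => ∀ (p : X) (γ : Path p p), a.eval γ = w p γ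

/-! ### Oriented `3`-manifolds, trivializations and mapping class groups -/

/-- Euclidean `3`-space. -/
abbrev E3 : Type := EuclideanSpace ℝ (Fin 3)

/-- The unit `2`-sphere. -/
abbrev Sphere2 : Type := Metric.sphere (0 : E3) 1

section Manifold

/-- An orientation of a `3`-manifold: a choice of orientation of every tangent space that is
locally constant in the local trivializations of the tangent bundle. -/
structure TangentOrientation (M : Type*) [TopologicalSpace M] [ChartedSpace E3 M]
    [IsManifold (𝓡 3) ∞ M] where
  /-- The orientation of each tangent space. -/
  orient : ∀ p : M, Orientation ℝ (TangentSpace (𝓡 3) p) (Fin 3)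
  locallyConstant : ∀ p₀ : M, ∃ o₀ : Orientation ℝ E3 (Fin 3), ∀ᶠ p in 𝓝 p₀,
    ∀ h : p ∈ (trivializationAt E3 (TangentSpace (𝓡 3)) p₀).baseSet,
      Orientation.map (Fin 3)
        ((trivializationAt E3 (TangentSpace (𝓡 3)) p₀).continuousLinearEquivAt ℝ p h).toLinearEquiv
        (orient p) = o₀

variable {M : Type*} [TopologicalSpace M] [ChartedSpace E3 M] [IsManifold (𝓡 3) ∞ M]

/-- An oriented trivialization of `TM`: a continuous section of the bundle of oriented frames. -/
structure OrientedTrivialization (o : TangentOrientation M) where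
  /-- The frame at each point. -/
  frame : ∀ p : M, (Fin 3 → ℝ) ≃L[ℝ] TangentSpace (𝓡 3) p
  continuous_frame : ∀ v : Fin 3 → ℝ,
    Continuous fun p : M => (⟨p, frame p v⟩ : TangentBundle (𝓡 3) M)
  oriented : ∀ p : M, Orientation.map (Fin 3) (frame p).toLinearEquiv
    (Pi.basisFun ℝ (Fin 3)).orientation = o.orient p

/-- The derivative of a diffeomorphism at a point, as a linear isomorphism. -/
abbrev derivEquiv (f : M ≃ₘ^∞⟮𝓡 3, 𝓡 3⟯ M) (p : M) :
    TangentSpace (𝓡 3) p ≃L[ℝ] TangentSpace (𝓡 3) (f p) :=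
  f.mfderivToContinuousLinearEquiv (by simp) p

/-- Orientation-preserving diffeomorphisms. -/
def DiffPlus (o : TangentOrientation M) : Type _ :=
  {f : M ≃ₘ^∞⟮𝓡 3, 𝓡 3⟯ M //
    ∀ p : M, Orientation.map (Fin 3) (derivEquiv f p).toLinearEquiv (o.orient p) = o.orient (f p)}

/-- Smooth isotopy through orientation-preserving diffeomorphisms. -/
def Isotopic (o : TangentOrientation M) (f g : DiffPlus o) : Prop :=
  ∃ F : M × ℝ → M, ContMDiff ((𝓡 3).prod 𝓘(ℝ, ℝ)) (𝓡 3) ∞ F ∧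
    (∀ t : ℝ, ∃ h : DiffPlus o, ∀ p, F (p, t) = h.1 p) ∧
    (∀ p, F (p, 0) = f.1 p) ∧ (∀ p, F (p, 1) = g.1 p)

/-- The set of isotopy classes of orientation-preserving diffeomorphisms. -/
def MCG (o : TangentOrientation M) : Type _ := Quot (Isotopic o)

/-- The isotopy class of a diffeomorphism. -/
def MCG.mk {o : TangentOrientation M} (f : DiffPlus o) : MCG o := Quot.mk _ f

/-- The coordinates of a continuous vector field along a map, in a continuous frame, are
continuous. -/
theorem OrientedTrivialization.continuous_coord {o : TangentOrientation M}
    (σ : OrientedTrivialization o) {X : Type*} [TopologicalSpace X] (b : X → M)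
    (w : ∀ x, TangentSpace (𝓡 3) (b x))
    (hw : Continuous fun x => (⟨b x, w x⟩ : TangentBundle (𝓡 3) M)) :
    Continuous fun x => (σ.frame (b x)).symm (w x) := by
  have hb : Continuous b := (FiberBundle.continuous_proj E3 (TangentSpace (𝓡 3))).comp hw
  rw [continuous_iff_continuousAt]
  intro x₀
  set e := trivializationAt E3 (TangentSpace (𝓡 3) : M → Type) (b x₀) with he
  have hmem : ∀ᶠ x in 𝓝 x₀, b x ∈ e.baseSet :=
    hb.continuousAt.eventually
      (e.open_baseSet.mem_nhds (FiberBundle.mem_baseSet_trivializationAt' (b x₀)))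
  have h₀ : b x₀ ∈ e.baseSet := FiberBundle.mem_baseSet_trivializationAt' (b x₀)
  let B : X → ((Fin 3 → ℝ) →L[ℝ] E3) := fun x =>
    (e.continuousLinearMapAt ℝ (b x)).comp (σ.frame (b x) : (Fin 3 → ℝ) →L[ℝ] _)
  have hval : ∀ x, b x ∈ e.baseSet → ∀ v : TangentSpace (𝓡 3) (b x),
      e.continuousLinearMapAt ℝ (b x) v = (e ⟨b x, v⟩).2 := by
    intro x hx v
    exact e.continuousLinearMapAt_apply_of_mem ℝ hx v
  have hu : ∀ u : ∀ x, TangentSpace (𝓡 3) (b x),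
      Continuous (fun x => (⟨b x, u x⟩ : TangentBundle (𝓡 3) M)) →
      ContinuousAt (fun x => e.continuousLinearMapAt ℝ (b x) (u x)) x₀ := by
    intro u hu
    have h1 := ((FiberBundle.continuousAt_totalSpace E3 _).1 (hu.continuousAt (x := x₀))).2
    refine h1.congr ?_
    filter_upwards [hmem] with x hx
    exact (hval x hx (u x)).symm
  have hB : ContinuousAt B x₀ := by
    rw [continuousAt_clm_apply]
    intro v
    exact hu (fun x => σ.frame (b x) v) ((σ.continuous_frame v).comp hb)
  let B' : ∀ x, b x ∈ e.baseSet → ((Fin 3 → ℝ) ≃L[ℝ] E3) := fun x hx =>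
    (σ.frame (b x)).trans (e.continuousLinearEquivAt ℝ (b x) hx)
  have hBB' : ∀ x hx, (B' x hx : (Fin 3 → ℝ) →L[ℝ] E3) = B x := by
    intro x hx
    ext1 v
    exact (hval x hx (σ.frame (b x) v)).symm
  have hinv : ContinuousAt (fun x => ContinuousLinearMap.inverse (B x)) x₀ := by
    have := (contDiffAt_map_inverse (n := 0) (B' x₀ h₀)).continuousAt
    rw [hBB'] at this
    exact ContinuousAt.comp (f := B) this hB
  refine (hinv.clm_apply (hu w hw)).congr ?_
  filter_upwards [hmem] with x hx
  rw [← hBB' x hx, ContinuousLinearMap.inverse_equiv]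
  simp only [B']
  have h2 : e.continuousLinearMapAt ℝ (b x) (w x) = e.continuousLinearEquivAt ℝ (b x) hx (w x) :=
    hval x hx (w x)
  rw [h2]
  change (σ.frame (b x)).symm ((e.continuousLinearEquivAt ℝ (b x) hx).symm
    (e.continuousLinearEquivAt ℝ (b x) hx (w x))) = _
  rw [ContinuousLinearEquiv.symm_apply_apply]

/-- The linear automorphism `σ(f(p))⁻¹ ∘ D_p f ∘ σ(p)` of `ℝ³`. -/
def frameDeriv {o : TangentOrientation M} (σ : OrientedTrivialization o) (f : DiffPlus o) (p : M) :
    (Fin 3 → ℝ) ≃ₗ[ℝ] (Fin 3 → ℝ) :=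
  ((σ.frame p).trans ((derivEquiv f.1 p).trans (σ.frame (f.1 p)).symm)).toLinearEquiv

theorem frameDeriv_det_pos {o : TangentOrientation M} (σ : OrientedTrivialization o)
    (f : DiffPlus o) (p : M) :
    0 < (LinearMap.toMatrix' (frameDeriv σ f p : (Fin 3 → ℝ) →ₗ[ℝ] (Fin 3 → ℝ))).det := by
  rw [LinearMap.det_toMatrix', ← Orientation.map_eq_iff_det_pos
    (Pi.basisFun ℝ (Fin 3)).orientation (frameDeriv σ f p) (by simp)]
  have h : Orientation.map (Fin 3) (frameDeriv σ f p) (Pi.basisFun ℝ (Fin 3)).orientation =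
      Orientation.map (Fin 3) (σ.frame (f.1 p)).toLinearEquiv.symm
        (Orientation.map (Fin 3) (derivEquiv f.1 p).toLinearEquiv
          (Orientation.map (Fin 3) (σ.frame p).toLinearEquiv
            (Pi.basisFun ℝ (Fin 3)).orientation)) := by
    induction (Pi.basisFun ℝ (Fin 3)).orientation using Module.Ray.ind with
    | h v hv =>
      simp only [Orientation.map_apply]
      rfl
  rw [h, σ.oriented, f.2, ← σ.oriented (f.1 p)]
  rw [← Orientation.map_symm, Equiv.symm_apply_apply]

/-- The value of the derivative crossed homomorphism at a point, as a matrix. -/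
def derivMatrix {o : TangentOrientation M} (σ : OrientedTrivialization o) (f : DiffPlus o) (p : M) :
    GL(3, ℝ)⁺ :=
  ⟨Matrix.GeneralLinearGroup.mkOfDetNeZero _ (frameDeriv_det_pos σ f p).ne',
    (Matrix.mem_glpos _).2 (frameDeriv_det_pos σ f p)⟩

theorem continuous_glPos {X : Type*} [TopologicalSpace X] (F : X → GL(3, ℝ)⁺)
    (hF : Continuous fun x => ((F x : GL (Fin 3) ℝ) : Matrix (Fin 3) (Fin 3) ℝ)) :
    Continuous F := by
  refine Continuous.subtype_mk (f := fun x => (F x : GL (Fin 3) ℝ)) ?_ (fun x => (F x).2)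
  rw [Units.continuous_iff]
  refine ⟨hF, ?_⟩
  have : (fun x => (((F x : GL (Fin 3) ℝ)⁻¹ : GL (Fin 3) ℝ) : Matrix (Fin 3) (Fin 3) ℝ)) =
      fun x => (((F x : GL (Fin 3) ℝ) : Matrix (Fin 3) (Fin 3) ℝ).det)⁻¹ •
        ((F x : GL (Fin 3) ℝ) : Matrix (Fin 3) (Fin 3) ℝ).adjugate := by
    funext x
    rw [Matrix.coe_units_inv, Matrix.inv_def, Ring.inverse_eq_inv']
  change Continuous (fun x => (((F x : GL (Fin 3) ℝ)⁻¹ : GL (Fin 3) ℝ) : Matrix (Fin 3) (Fin 3) ℝ))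
  rw [this]
  exact (hF.matrix_det.inv₀ fun x => Matrix.GLPos.det_ne_zero (F x)).smul hF.matrix_adjugate

/-- Continuity of a family of matrices `derivMatrix`. -/
theorem continuous_derivMatrix {o : TangentOrientation M} (σ : OrientedTrivialization o)
    {X : Type*} [TopologicalSpace X] (h : X → DiffPlus o) (q : X → M)
    (hw : ∀ v : Fin 3 → ℝ, Continuous fun x =>
      (⟨(h x).1 (q x), mfderiv (𝓡 3) (𝓡 3) (h x).1 (q x) (σ.frame (q x) v)⟩ :
        TangentBundle (𝓡 3) M)) :
    Continuous fun x => derivMatrix σ (h x) (q x) := by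
  apply continuous_glPos
  refine continuous_matrix fun i j => ?_
  have := σ.continuous_coord _ _ (hw (Pi.single j 1))
  exact (continuous_apply i).comp this

/-- The derivative crossed homomorphism on diffeomorphisms.  The map `φ_f` with
`σ^f = σ · φ_f` is `φ_f(p) = σ(p)⁻¹ ∘ (D_p f)⁻¹ ∘ σ(f(p))`, and this is its pointwise inverse. -/
def derivHom {o : TangentOrientation M} (σ : OrientedTrivialization o) (f : DiffPlus o) :
    C(M, GL(3, ℝ)⁺) where
  toFun := derivMatrix σ f
  continuous_toFun := by
    refine continuous_derivMatrix σ (fun _ => f) (fun p => p) fun v => ?_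
    exact (f.1.contMDiff.continuous_tangentMap (by simp)).comp (σ.continuous_frame v)

/-- The set `[X, Y]` of homotopy classes of maps. -/
abbrev HomotopyClass (X Y : Type*) [TopologicalSpace X] [TopologicalSpace Y] : Type _ :=
  Quot (ContinuousMap.Homotopic (X := X) (Y := Y))

theorem derivHom_homotopic {o : TangentOrientation M} (σ : OrientedTrivialization o)
    {f g : DiffPlus o} (H : Isotopic o f g) :
    ContinuousMap.Homotopic (derivHom σ f) (derivHom σ g) := by
  obtain ⟨F, hF, hd, h0, h1⟩ := H
  choose h hh using hd
  have e0 : h 0 = f := Subtype.ext (Diffeomorph.ext fun p => (hh 0 p).symm.trans (h0 p))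
  have e1 : h 1 = g := Subtype.ext (Diffeomorph.ext fun p => (hh 1 p).symm.trans (h1 p))
  refine ⟨⟨⟨fun x => derivMatrix σ (h x.1) x.2, ?_⟩, ?_, ?_⟩⟩
  · refine continuous_derivMatrix σ (fun x : unitInterval × M => h x.1) (fun x => x.2) fun v => ?_
    have h2 : Continuous fun x : unitInterval × M =>
        (equivTangentBundleProd (𝓡 3) M 𝓘(ℝ, ℝ) ℝ).symm
          (⟨x.2, σ.frame x.2 v⟩, ⟨(x.1 : ℝ), (0 : ℝ)⟩) := by
      refine (contMDiff_equivTangentBundleProd_symm (n := 0)).continuous.comp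
        (((σ.continuous_frame v).comp continuous_snd).prodMk ?_)
      have hz : Continuous (Bundle.zeroSection ℝ (TangentSpace 𝓘(ℝ, ℝ) : ℝ → Type)) :=
        (Bundle.contMDiff_zeroSection (n := 0) (IB := 𝓘(ℝ, ℝ)) ℝ
          (TangentSpace 𝓘(ℝ, ℝ) : ℝ → Type)).continuous
      exact hz.comp (continuous_subtype_val.comp continuous_fst)
    have h3 := (hF.continuous_tangentMap (by simp)).comp h2
    convert h3 using 1
    funext x
    have h4 : ((h x.1).1 : M → M) = F ∘ fun p => (p, (x.1 : ℝ)) := funext fun p => (hh x.1 p).symm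
    have h5 : tangentMap (𝓡 3) (𝓡 3) (h x.1).1 ⟨x.2, σ.frame x.2 v⟩ =
        tangentMap ((𝓡 3).prod 𝓘(ℝ, ℝ)) (𝓡 3) F
          (tangentMap (𝓡 3) ((𝓡 3).prod 𝓘(ℝ, ℝ)) (fun p : M => (p, (x.1 : ℝ)))
            ⟨x.2, σ.frame x.2 v⟩) := by
      rw [h4]
      exact tangentMap_comp_at _ (hF.mdifferentiable (by simp) _)
        ((contMDiff_id.prodMk contMDiff_const : ContMDiff (𝓡 3) ((𝓡 3).prod 𝓘(ℝ, ℝ)) 1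
          fun p : M => (p, (x.1 : ℝ))).mdifferentiable (by simp) _)
    rw [tangentMap_prod_left] at h5
    exact h5
  · intro p
    change derivMatrix σ (h 0) p = _
    rw [e0]; rfl
  · intro p
    change derivMatrix σ (h 1) p = _
    rw [e1]; rfl

/-- The derivative crossed homomorphism on isotopy classes. -/
def derivClass {o : TangentOrientation M} (σ : OrientedTrivialization o) :
    MCG o → HomotopyClass M GL(3, ℝ)⁺ :=
  Quot.map (derivHom σ) fun _ _ h => derivHom_homotopic σ h

/-! ### The twisting crossed homomorphism -/

open Classical in
/-- The isomorphism `π₁(GL₃⁺(ℝ)) ≅ ℤ/2`: trivial loops are sent to `0`, all others to `1`. -/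
def loopParity {A : GL(3, ℝ)⁺} (γ : Path A A) : ZMod 2 :=
  if γ.Homotopic (Path.refl A) then 0 else 1

theorem loopParity_congr {X : Type*} [TopologicalSpace X] {φ ψ : C(X, GL(3, ℝ)⁺)}
    (h : φ.Homotopic ψ) (p : X) (γ : Path p p) :
    loopParity (γ.map φ.continuous) = loopParity (γ.map ψ.continuous) := by
  have key : ∀ {φ ψ : C(X, GL(3, ℝ)⁺)}, φ.Homotopic ψ →
      (γ.map ψ.continuous).Homotopic (Path.refl _) →
      (γ.map φ.continuous).Homotopic (Path.refl _) := by
    rintro φ ψ ⟨H⟩ hψ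
    have h1 := Path.Homotopic.map_trans_evalAt H γ
    rw [← Path.Homotopic.Quotient.eq] at h1 hψ ⊢
    rw [Path.Homotopic.Quotient.mk_trans, Path.Homotopic.Quotient.mk_trans] at h1
    erw [hψ, Path.Homotopic.Quotient.trans_refl] at h1
    have h2 := congrArg (fun c => Path.Homotopic.Quotient.trans c
      (Path.Homotopic.Quotient.symm (Path.Homotopic.Quotient.mk (H.evalAt p)))) h1
    simp only [Path.Homotopic.Quotient.trans_assoc, Path.Homotopic.Quotient.trans_symm,
      Path.Homotopic.Quotient.trans_refl] at h2
    exact h2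
  have hiff := (⟨key h.symm, key h⟩ : _ ↔ (γ.map ψ.continuous).Homotopic (Path.refl _))
  unfold loopParity
  by_cases hc : (γ.map ψ.continuous).Homotopic (Path.refl _)
  · rw [if_pos hc, if_pos (hiff.2 hc)]
  · rw [if_neg hc, if_neg fun h' => hc (hiff.1 h')]

/-- The function on loops given by the `π₁`-functor applied to a homotopy class of maps
to `GL₃⁺(ℝ)`. -/
def HomotopyClass.onLoops {X : Type*} [TopologicalSpace X] (Φ : HomotopyClass X GL(3, ℝ)⁺)
    (p : X) (γ : Path p p) : ZMod 2 :=
  Quot.lift (fun φ : C(X, GL(3, ℝ)⁺) => loopParity (γ.map φ.continuous))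
    (fun _ _ h => loopParity_congr h p γ) Φ

/-- The twisting crossed homomorphism `Mod(M) → H¹(M; ℤ/2) = Hom(π₁(M), ℤ/2)`. -/
def twisting {o : TangentOrientation M} (σ : OrientedTrivialization o) (f : MCG o) : H1 M :=
  H1.ofLoops (derivClass σ f).onLoops

/-! ### Sphere twists and intersection numbers -/

/-- The rotation of the sphere by the angle `θ` about the third coordinate axis. -/
def rotate (θ : ℝ) (s : Sphere2) : Sphere2 :=
  ⟨!₂[Real.cos θ * s.1 0 - Real.sin θ * s.1 1, Real.sin θ * s.1 0 + Real.cos θ * s.1 1, s.1 2], by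
    have h := s.2
    rw [mem_sphere_zero_iff_norm, EuclideanSpace.norm_eq, Real.sqrt_eq_one] at h ⊢
    simp only [Fin.sum_univ_three, Real.norm_eq_abs, sq_abs] at h ⊢
    simp
    linear_combination h + (s.1 0 ^ 2 + s.1 1 ^ 2) * Real.sin_sq_add_cos_sq θ⟩

/-- `f` is a sphere twist diffeomorphism about the sphere embedded by `ι`.  Here `e` is a tubular
neighbourhood of the sphere, the twist takes place in `U = e(S² × [0,1])`, the loop of rotations is
`t ↦ rotate (θ t)`, `0 ≤ t ≤ 1`, and `f` is the identity outside `U` (for `t ≤ 0` and `t ≥ 1` the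
rotation is the identity). -/
def IsTwistDiffeo (ι : Sphere2 → M) (f : M → M) : Prop :=
  ∃ (e : Sphere2 × ℝ → M) (θ : ℝ → ℝ),
    IsLocalDiffeomorph ((𝓡 2).prod 𝓘(ℝ, ℝ)) (𝓡 3) ∞ e ∧ Function.Injective e ∧
    (∀ s, e (s, 1 / 2) = ι s) ∧
    ContDiff ℝ ∞ θ ∧ (∀ t ≤ 0, θ t = 0) ∧ (∀ t ≥ 1, θ t = 2 * Real.pi) ∧
    (∀ s t, f (e (s, t)) = e (rotate (θ t) s, t)) ∧
    (∀ p ∉ Set.range e, f p = p)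

/-- The mapping class `T` is the sphere twist about the sphere embedded by `ι`. -/
def IsSphereTwist {o : TangentOrientation M} (ι : Sphere2 → M) (T : MCG o) : Prop :=
  ∃ f : DiffPlus o, IsTwistDiffeo ι f.1 ∧ T = MCG.mk f

/-- The loop given by a `1`-periodic curve. -/
def periodicLoop (γ : ℝ → M) (hγ : Continuous γ) (hper : Function.Periodic γ 1) :
    Path (γ 0) (γ 0) where
  toFun t := γ t
  continuous_toFun := hγ.comp continuous_subtype_val
  source' := rfl
  target' := by simpa using hper 0

/-- The curve `γ` is transverse to the surface embedded by `ι`: no velocity vector of `γ` is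
tangent to the surface. -/
def TransverseTo (γ : ℝ → M) (ι : Sphere2 → M) : Prop :=
  ∀ (t : ℝ) (w : TangentBundle (𝓡 2) Sphere2),
    tangentMap 𝓘(ℝ, ℝ) (𝓡 3) γ ⟨t, (1 : ℝ)⟩ ≠ tangentMap (𝓡 2) (𝓡 3) ι w

end Manifold

end SphereTwist
end

/-! The derivative of a sphere twist, read in the frame, is the identity off the tube S² × [0,1].
Gram–Schmidt deforms it to a map into SO(3), which is then lifted through the double cover S³ →
SO(3): a loop has parity zero exactly when its lift closes up (`loopParity_eq_zero_iff`). Over the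
segment above a pole of the rotation, the derivative is a full turn conjugated by a path of frames,
and its lift joins a quaternion q to -q (`not_lift_conj_rotMatrix`). Since S² is connected, a lift
over S² × [0,1] that begins as a constant q₀ ends as the constant -q₀. Changing its sign above the
level 1/2 gives a map `l : M → S³` that lifts the derivative at every point, is continuous off S and
jumps by a sign across S (`exists_twist_lift`).

The cochain that compares the continuous lift along a path with `l` at the two ends is a cocycle
representing the twisting class (`liftCochain_mem`, `liftCochain_pathSimplex`). It vanishes on paths
that miss S, and inside the tube it is the coboundary of the indicator of the upper half. The
intersection count and the duality use only these two facts.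

Intersection numbers: the loop is cut into short arcs. An arc crossing S once in its interior
contributes one, an arc missing S contributes zero (`segment_eq_ncard_of_crossesAt`).

Duality (`isPoincareDual_of_tubular`): subdivide a fundamental cycle z into a part a in the tube and
a part b off the core. The part b contributes nothing to the cap product; a contributes, up to a
boundary, the piece y₁ of ∂a above the core. Now H₂(S² × ℝ) has at most one nonzero class. The core
is not a boundary there, because it projects to a fundamental cycle of S²; nor is y₁, since
otherwise z would be trivial relative to the complement of a point of S. Hence y₁ is homologous to
the core. Only upper bounds on homology are needed, and cones, barycentric subdivision and a
Mayer–Vietoris argument in punctured ℝ³ supply them. -/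

noncomputable section
namespace SphereTwist

/-! ### Spheres of dimension at least two are simply connected -/

section SimplyConnectedSphere

variable {E : Type*} [NormedAddCommGroup E] [NormedSpace ℝ E]

/-- The radial projection to the unit sphere. -/
def radialProj (x : {x : E // x ≠ 0}) : Metric.sphere (0 : E) 1 :=
  ⟨‖x.1‖⁻¹ • x.1, by
    have := norm_ne_zero_iff.2 x.2
    simp [norm_smul, this]⟩

theorem continuous_radialProj : Continuous (radialProj (E := E)) := by
  refine Continuous.subtype_mk ?_ _
  exact (continuous_subtype_val.norm.inv₀ fun x => norm_ne_zero_iff.2 x.2).smul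
    continuous_subtype_val

theorem radialProj_sphere (x : Metric.sphere (0 : E) 1) (h : x.1 ≠ 0) :
    radialProj ⟨x.1, h⟩ = x := by
  have := x.2
  rw [mem_sphere_zero_iff_norm] at this
  exact Subtype.ext (by simp [radialProj, this])

/-- The complement of the closed ray through `-v` is star-shaped about `v`. -/
theorem starConvex_compl_ray (v : E) (hv : v ≠ 0) :
    StarConvex ℝ v {x : E | ∀ r : ℝ, r ≤ 0 → x ≠ r • v} := by
  intro x hx a b ha hb hab r hr h
  rcases hb.eq_or_lt with rfl | hb
  · have ha1 : a = 1 := by linarith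
    subst ha1
    have : (1 - r) • v = 0 := by rw [sub_smul, ← h]; simp
    rcases smul_eq_zero.1 this with h | h
    · linarith
    · exact hv h
  -- Solving a v + b x = r v for x gives this multiple of v, again nonpositive.
  · refine hx (b⁻¹ * (r - a)) ?_ ?_
    · exact mul_nonpos_of_nonneg_of_nonpos (inv_nonneg.2 hb.le) (by linarith)
    · rw [mul_smul, sub_smul, ← h]
      simp [smul_smul, hb.ne']

/-- A loop in the sphere that stays near a smooth loop is null-homotopic. -/
theorem loop_homotopic_refl_of_near_smooth [FiniteDimensional ℝ E]
    (hE : 2 < Module.finrank ℝ E) {x : Metric.sphere (0 : E) 1} (p : Path x x) (q : ℝ → E)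
    (hq : ContDiff ℝ 1 q) (h0 : q 0 = x) (h1 : q 1 = x)
    (hpq : ∀ t : unitInterval, ‖q t - p t‖ < 1) : p.Homotopic (Path.refl x) := by
  have hnorm : ∀ t, ‖(p t : E)‖ = 1 := fun t => mem_sphere_zero_iff_norm.1 (p t).2
  -- Points at distance less than one from the unit sphere's point `p t` are nonzero, so the
  -- straight segment from `p t` to `q t` can be projected radially.
  have hne : ∀ s t : unitInterval, (p t : E) + (s : ℝ) • (q t - p t) ≠ 0 := by
    intro s t h
    have h2 : ‖(s : ℝ) • (q t - p t)‖ < 1 := by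
      rw [norm_smul, Real.norm_eq_abs, abs_of_nonneg s.2.1]
      calc (s : ℝ) * ‖q t - p t‖ ≤ 1 * ‖q t - p t‖ :=
            mul_le_mul_of_nonneg_right s.2.2 (norm_nonneg _)
        _ < 1 := by simpa using hpq t
    rw [← neg_eq_of_add_eq_zero_right h, norm_neg, hnorm] at h2
    exact lt_irrefl _ h2
  have hqne : ∀ t : unitInterval, q t ≠ 0 := fun t => by simpa using hne 1 t
  -- the smooth loop misses a line
  have hdense : Dense (Set.range fun y : ℝ × ℝ => y.2 • q y.1)ᶜ := by
    apply ContDiff.dense_compl_range_of_finrank_lt_finrank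
    · exact contDiff_snd.smul (hq.comp contDiff_fst)
    · simpa using hE
  obtain ⟨v, hv⟩ := hdense.nonempty
  have hv0 : v ≠ 0 := by
    rintro rfl
    exact hv ⟨(0, 0), by simp⟩
  set C := {x : E | ∀ r : ℝ, r ≤ 0 → x ≠ r • v} with hC
  -- If `q t = r • v` with r < 0, then v is a multiple of `q t`, which the choice of v excludes.
  have hqC : ∀ t : unitInterval, q t ∈ C := by
    intro t r hr h
    rcases hr.eq_or_lt with rfl | hr
    · exact hqne t (by simpa using h)
    · exact hv ⟨(t, r⁻¹), by simp [h, smul_smul, hr.ne]⟩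
  have hC0 : ∀ y ∈ C, y ≠ 0 := fun y hy => by simpa using hy 0 le_rfl
  have : ContractibleSpace C :=
    (starConvex_compl_ray v hv0).contractibleSpace ⟨_, hqC 0⟩
  have hsc : SimplyConnectedSpace C := inferInstance
  have hqc : Continuous q := hq.continuous
  let x' : C := ⟨x, by rw [← h0]; exact hqC 0⟩
  let q' : Path x' x' :=
    { toFun := fun t => ⟨q t, hqC t⟩
      continuous_toFun := by fun_prop
      source' := Subtype.ext (by simpa using h0)
      target' := Subtype.ext (by simpa using h1) }
  have hx0 : x.1 ≠ 0 := hC0 _ x'.2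
  have hnull : q'.Homotopic (Path.refl x') := SimplyConnectedSpace.paths_homotopic _ _
  let N : C(C, Metric.sphere (0 : E) 1) :=
    ⟨fun y => radialProj ⟨y.1, hC0 _ y.2⟩, continuous_radialProj.comp (by fun_prop)⟩
  have hNx : x = N x' := (radialProj_sphere x hx0).symm
  have hnull' : ((q'.map N.continuous).cast hNx hNx).Homotopic (Path.refl x) := by
    obtain ⟨F⟩ := hnull.map N
    exact ⟨ContinuousMap.HomotopyRel.cast F (g₀ := ((q'.map N.continuous).cast hNx hNx))
      (g₁ := (Path.refl x)) rfl
      (by ext t; exact congrArg Subtype.val hNx.symm)⟩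
  -- It remains to deform p into the projection of q; the radially projected straight segments do
  -- this.
  refine Path.Homotopic.trans ?_ hnull'
  refine ⟨⟨⟨⟨fun y => radialProj ⟨_, hne y.1 y.2⟩, continuous_radialProj.comp ?_⟩, ?_, ?_⟩, ?_⟩⟩
  · fun_prop
  · intro t
    have : (p t : E) + ((0 : unitInterval) : ℝ) • (q t - p t) = p t := by simp
    refine Subtype.ext ?_
    simp only [radialProj, this]
    simp [hnorm]
  · intro t
    have : (p t : E) + ((1 : unitInterval) : ℝ) • (q t - p t) = q t := by simp
    refine Subtype.ext ?_
    simp only [radialProj, this]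
    rfl
  · rintro s t (rfl | rfl)
    · refine Subtype.ext ?_
      have := hnorm 0
      simp only [Path.source] at this
      simp [radialProj, h0, this]
    · refine Subtype.ext ?_
      have := hnorm 0
      simp only [Path.source] at this
      simp [radialProj, h1, this]

/-- A continuous loop may fill the sphere, so it is first replaced by a polynomial one. Bernstein
polynomials approximate it uniformly and keep both end points. The multiples of the points of a
polynomial loop form the image of a smooth map from a plane, which cannot cover a space of dimension
at least three. -/
theorem simplyConnectedSpace_sphere [FiniteDimensional ℝ E] (hE : 2 < Module.finrank ℝ E) :
    SimplyConnectedSpace (Metric.sphere (0 : E) 1) := by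
  rw [simply_connected_iff_loops_nullhomotopic]
  constructor
  · rw [← isPathConnected_iff_pathConnectedSpace]
    refine isPathConnected_sphere ?_ 0 zero_le_one
    rw [← Module.finrank_eq_rank]
    exact_mod_cast lt_trans one_lt_two hE
  · intro x p
    let g : C(unitInterval, E) := ⟨fun t => (p t : E), by fun_prop⟩
    have hlim := bernsteinApproximation_uniform g
    rw [Metric.tendsto_nhds] at hlim
    -- The degree must be nonzero for the Bernstein polynomial to have the right value at 1.
    obtain ⟨n, hn, hn0⟩ := ((hlim 1 one_pos).and (Filter.eventually_ne_atTop 0)).exists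
    let q : ℝ → E := fun t => ∑ k : Fin (n + 1),
      ((n.choose k : ℝ) * t ^ (k : ℕ) * (1 - t) ^ (n - k)) • g (bernstein.z k)
    have hq : ∀ t : unitInterval, q t = bernsteinApproximation n g t := by
      intro t
      rw [bernsteinApproximation.apply]
      simp [q, bernstein_apply]
    refine loop_homotopic_refl_of_near_smooth hE p q ?_ ?_ ?_ ?_
    · refine ContDiff.sum fun k _ => ?_
      fun_prop
    · have := hq 0
      rw [bernsteinApproximation.apply_zero] at this
      simpa [g] using this
    · have := hq 1
      rw [bernsteinApproximation.apply_one hn0] at this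
      simpa [g] using this
    · intro t
      rw [hq, ← dist_eq_norm]
      exact (ContinuousMap.dist_apply_le_dist t).trans_lt hn

end SimplyConnectedSphere

/-! ### The double cover of the rotation group by the three-sphere -/

/-- The unit `3`-sphere, seen as the sphere of unit quaternions. -/
abbrev Sphere3 : Type := Metric.sphere (0 : EuclideanSpace ℝ (Fin 4)) 1

instance : SimplyConnectedSpace Sphere3 := simplyConnectedSpace_sphere (by simp)

/-- Real `3 × 3` matrices. -/
abbrev Mat3 : Type := Matrix (Fin 3) (Fin 3) ℝ

/-- The rotation group. -/
abbrev SO3 : Type := {R : Mat3 // R.transpose * R = 1 ∧ R.det = 1}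

/-- The matrix of `v ↦ q v q̄` for a quaternion `q`. -/
def quatMatrix (q : Fin 4 → ℝ) : Mat3 :=
  !![q 0 ^ 2 + q 1 ^ 2 - q 2 ^ 2 - q 3 ^ 2, 2 * (q 1 * q 2 - q 0 * q 3),
      2 * (q 1 * q 3 + q 0 * q 2);
    2 * (q 1 * q 2 + q 0 * q 3), q 0 ^ 2 - q 1 ^ 2 + q 2 ^ 2 - q 3 ^ 2,
      2 * (q 2 * q 3 - q 0 * q 1);
    2 * (q 1 * q 3 - q 0 * q 2), 2 * (q 2 * q 3 + q 0 * q 1),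
      q 0 ^ 2 - q 1 ^ 2 - q 2 ^ 2 + q 3 ^ 2]

theorem Sphere3.sum_sq (q : Sphere3) : q.1 0 ^ 2 + q.1 1 ^ 2 + q.1 2 ^ 2 + q.1 3 ^ 2 = 1 := by
  have h := q.2
  rw [mem_sphere_zero_iff_norm, EuclideanSpace.norm_eq, Real.sqrt_eq_one] at h
  simpa [Fin.sum_univ_four] using h

/-- For an arbitrary quaternion q with matrix R one has RᵀR = |q|⁴ and det R = |q|⁶ as polynomial
identities. -/
theorem quatMatrix_mem (q : Sphere3) :
    (quatMatrix q.1).transpose * quatMatrix q.1 = 1 ∧ (quatMatrix q.1).det = 1 := by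
  have h := q.sum_sq
  set a := q.1 0
  set b := q.1 1
  set c := q.1 2
  set d := q.1 3
  have h2 : (a ^ 2 + b ^ 2 + c ^ 2 + d ^ 2) ^ 2 = 1 := by rw [h, one_pow]
  have h3 : (a ^ 2 + b ^ 2 + c ^ 2 + d ^ 2) ^ 3 = 1 := by rw [h, one_pow]
  constructor
  · ext i j
    fin_cases i <;> fin_cases j <;>
      simp [quatMatrix, Matrix.mul_apply, Fin.sum_univ_three] <;>
      first | linear_combination h2 | ring
  · simp only [quatMatrix, Matrix.det_fin_three]
    simp
    linear_combination h3

/-- The double cover of the rotation group. -/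
def rho (q : Sphere3) : SO3 := ⟨quatMatrix q.1, quatMatrix_mem q⟩

theorem continuous_rho : Continuous rho := by
  refine Continuous.subtype_mk (continuous_matrix fun i j => ?_) _
  fin_cases i <;> fin_cases j <;> simp [quatMatrix] <;> fun_prop

theorem rho_neg (q : Sphere3) : rho (-q) = rho q := by
  refine Subtype.ext ?_
  ext i j
  fin_cases i <;> fin_cases j <;> simp [rho, quatMatrix]

/-- For unit quaternions the entries of the matrix determine all products `q i * q j`, hence q up to
sign. The sign is the inner product s of q and r. -/
theorem rho_eq_iff {q r : Sphere3} : rho q = rho r ↔ q = r ∨ q = -r := by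
  constructor
  · intro h
    have hq := q.sum_sq
    have hr := r.sum_sq
    have hm : ∀ i j, quatMatrix q.1 i j = quatMatrix r.1 i j := fun i j =>
      congrFun (congrFun (congrArg Subtype.val h) i) j
    have h00 := hm 0 0
    have h01 := hm 0 1
    have h02 := hm 0 2
    have h10 := hm 1 0
    have h11 := hm 1 1
    have h12 := hm 1 2
    have h20 := hm 2 0
    have h21 := hm 2 1
    have h22 := hm 2 2
    simp [quatMatrix] at h00 h01 h02 h10 h11 h12 h20 h21 h22
    have key : ∀ i j, q.1 i * q.1 j = r.1 i * r.1 j := by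
      intro i j
      fin_cases i <;> fin_cases j <;> simp <;> linarith
    set s := r.1 0 * q.1 0 + r.1 1 * q.1 1 + r.1 2 * q.1 2 + r.1 3 * q.1 3 with hs
    have hqs : ∀ i, q.1 i = r.1 i * s := by
      intro i
      linear_combination (-q.1 i) * hq + q.1 0 * key i 0 + q.1 1 * key i 1 + q.1 2 * key i 2 +
        q.1 3 * key i 3
    have hs2 : s ^ 2 = 1 := by
      linear_combination hq - s ^ 2 * hr - (q.1 0 + r.1 0 * s) * hqs 0 -
        (q.1 1 + r.1 1 * s) * hqs 1 - (q.1 2 + r.1 2 * s) * hqs 2 - (q.1 3 + r.1 3 * s) * hqs 3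
    rcases mul_self_eq_one_iff.1 ((sq s).symm.trans hs2) with h1 | h1
    · left
      refine Subtype.ext (by ext i; simp [hqs i, h1])
    · right
      refine Subtype.ext (by ext i; simp [hqs i, h1])
  · rintro (rfl | rfl)
    · rfl
    · exact rho_neg r

/-- The relations between the entries of a rotation matrix. -/
theorem SO3.cofactor (R : SO3) : R.1.adjugate = R.1.transpose := by
  have h := R.1.mul_adjugate
  rw [R.2.2, one_smul] at h
  calc R.1.adjugate = (R.1.transpose * R.1) * R.1.adjugate := by rw [R.2.1, one_mul]
    _ = R.1.transpose := by rw [mul_assoc, h, mul_one]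

/-- Four times the matrix of products of the coordinates of a quaternion representing `R`. -/
def SO3.quatProducts (R : Mat3) : Matrix (Fin 4) (Fin 4) ℝ :=
  !![1 + R 0 0 + R 1 1 + R 2 2, R 2 1 - R 1 2, R 0 2 - R 2 0, R 1 0 - R 0 1;
    R 2 1 - R 1 2, 1 + R 0 0 - R 1 1 - R 2 2, R 0 1 + R 1 0, R 0 2 + R 2 0;
    R 0 2 - R 2 0, R 0 1 + R 1 0, 1 - R 0 0 + R 1 1 - R 2 2, R 1 2 + R 2 1;
    R 1 0 - R 0 1, R 0 2 + R 2 0, R 1 2 + R 2 1, 1 - R 0 0 - R 1 1 + R 2 2]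

/-- If R comes from a quaternion q, the matrix is 4 q qᵀ and so has rank one. For an abstract
rotation the required minors are linear combinations of the relations RᵀR = 1, RRᵀ = 1 and adj R =
Rᵀ. -/
theorem SO3.quatProducts_mul (R : SO3) (a b c : Fin 4) :
    quatProducts R.1 a b * quatProducts R.1 a c = quatProducts R.1 a a * quatProducts R.1 b c := by
  have hc := R.cofactor
  have hm : ∀ i j, (R.1.transpose * R.1) i j = (1 : Mat3) i j := fun i j => by rw [R.2.1]
  have hm' : ∀ i j, (R.1 * R.1.transpose) i j = (1 : Mat3) i j := fun i j => by
    rw [mul_eq_one_comm.1 R.2.1]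
  have h00 := hm 0 0
  have h11 := hm 1 1
  have h22 := hm 2 2
  have h01 := hm 0 1
  have h02 := hm 0 2
  have h12 := hm 1 2
  have g00 := hm' 0 0
  have g11 := hm' 1 1
  have g22 := hm' 2 2
  have g01 := hm' 0 1
  have g02 := hm' 0 2
  have g12 := hm' 1 2
  simp [Matrix.mul_apply, Fin.sum_univ_three] at h00 h11 h22 h01 h02 h12 g00 g11 g22 g01 g02 g12
  rw [Matrix.adjugate_fin_three] at hc
  have hc' := fun i j => congrFun (congrFun hc i) j
  have c00 := hc' 0 0
  have c01 := hc' 0 1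
  have c02 := hc' 0 2
  have c10 := hc' 1 0
  have c11 := hc' 1 1
  have c12 := hc' 1 2
  have c20 := hc' 2 0
  have c21 := hc' 2 1
  have c22 := hc' 2 2
  clear hc hc' hm hm'
  simp at c00 c01 c02 c10 c11 c12 c20 c21 c22
  fin_cases a <;> fin_cases b <;> fin_cases c <;> simp [quatProducts] <;>
    first | ring1 | linarith

/-- The matrix K of `SO3.quatProducts` has trace 4, so some diagonal entry K a a is positive. Row a
divided by 2√(K a a) is then the desired quaternion, by the rank one relations. -/
theorem rho_surjective : Function.Surjective rho := by
  intro R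
  have hsum : SO3.quatProducts R.1 0 0 + SO3.quatProducts R.1 1 1 + SO3.quatProducts R.1 2 2 +
      SO3.quatProducts R.1 3 3 = 4 := by
    simp [SO3.quatProducts]; ring
  have hex : ∃ a, 0 < SO3.quatProducts R.1 a a := by
    by_contra! h
    linarith [h 0, h 1, h 2, h 3]
  obtain ⟨a, ha⟩ := hex
  set K := SO3.quatProducts R.1 with hK
  set s := Real.sqrt (K a a) with hs
  have hs0 : 0 < s := Real.sqrt_pos.2 ha
  have hs2 : s ^ 2 = K a a := Real.sq_sqrt ha.le
  let q : EuclideanSpace ℝ (Fin 4) := WithLp.toLp 2 fun b => K a b / (2 * s)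
  have hq : ∀ b c, q b * q c = K b c / 4 := by
    intro b c
    have := SO3.quatProducts_mul R a b c
    simp only [q]
    field_simp
    rw [hs2]
    linear_combination 4 * this
  have hmem : q ∈ Metric.sphere (0 : EuclideanSpace ℝ (Fin 4)) 1 := by
    rw [mem_sphere_zero_iff_norm, EuclideanSpace.norm_eq, Real.sqrt_eq_one]
    simp only [Fin.sum_univ_four, Real.norm_eq_abs, sq_abs]
    simp only [sq, hq]
    linarith
  refine ⟨⟨q, hmem⟩, Subtype.ext ?_⟩
  ext i j
  fin_cases i <;> fin_cases j <;> simp [rho, quatMatrix, sq, hq] <;>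
    simp [hK, SO3.quatProducts] <;> ring

theorem Sphere3.coe_smul (c : Metric.sphere (0 : ℝ) 1) (r : Sphere3) :
    ((c • r : Sphere3) : EuclideanSpace ℝ (Fin 4)) = (c : ℝ) • r.1 := rfl

/-- The group is {±1}, realized as the unit sphere of ℝ acting by scalars. The unit ball about q is
disjoint from its antipode because r and -r lie at distance 2. -/
theorem isQuotientCoveringMap_rho : IsQuotientCoveringMap rho (Metric.sphere (0 : ℝ) 1) where
  __ := continuous_rho.isClosedMap.isQuotientMap continuous_rho rho_surjective
  continuous_const_smul c := by fun_prop
  apply_eq_iff_mem_orbit {q r} := by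
    rw [rho_eq_iff]
    constructor
    · rintro (rfl | rfl)
      · exact MulAction.mem_orbit_self _
      · exact ⟨-1, Subtype.ext (by rw [Sphere3.coe_smul]; simp)⟩
    · rintro ⟨c, rfl⟩
      have hc : c.1 = 1 ∨ c.1 = -1 := by
        have := c.2
        rw [mem_sphere_zero_iff_norm, Real.norm_eq_abs] at this
        exact eq_or_eq_neg_of_abs_eq this
      rcases hc with hc | hc
      · left; exact Subtype.ext (by simp [Sphere3.coe_smul, hc])
      · right; exact Subtype.ext (by simp [Sphere3.coe_smul, hc])
  disjoint q := by
    refine ⟨Metric.ball q 1, Metric.ball_mem_nhds q one_pos, ?_⟩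
    rintro c ⟨_, ⟨r, hr, rfl⟩, hr'⟩
    have hc : c.1 = 1 ∨ c.1 = -1 := by
      have := c.2
      rw [mem_sphere_zero_iff_norm, Real.norm_eq_abs] at this
      exact eq_or_eq_neg_of_abs_eq this
    rcases hc with hc | hc
    · exact Subtype.ext hc
    · exfalso
      have hcr : c • r = -r := Subtype.ext (by simp [Sphere3.coe_smul, hc])
      have hr1 : dist r q < 1 := hr
      have hr2 : dist (-r) q < 1 := by rw [← hcr]; exact hr'
      have h2 : dist r (-r) = 2 := by
        have hn : ‖r.1‖ = 1 := mem_sphere_zero_iff_norm.1 r.2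
        rw [Subtype.dist_eq, dist_eq_norm]
        simp [← two_smul ℝ, norm_smul, hn]
      linarith [dist_triangle_right r (-r) q]

theorem isCoveringMap_rho : IsCoveringMap rho := isQuotientCoveringMap_rho.isCoveringMap

/-! ### Gram–Schmidt orthonormalization -/

/-- The rotation matrix with first column `p` and third column `r`. -/
def orthoFrame (p r : Fin 3 → ℝ) : Mat3 :=
  !![p 0, r 1 * p 2 - r 2 * p 1, r 0; p 1, r 2 * p 0 - r 0 * p 2, r 1;
    p 2, r 0 * p 1 - r 1 * p 0, r 2]

/-- The middle column is the cross product r × p. Its length and the determinant follow from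
Lagrange's identity |r × p|² = |p|²|r|² - (p·r)². -/
theorem orthoFrame_mem (p r : Fin 3 → ℝ) (hp : p 0 ^ 2 + p 1 ^ 2 + p 2 ^ 2 = 1)
    (hr : r 0 ^ 2 + r 1 ^ 2 + r 2 ^ 2 = 1) (hpr : p 0 * r 0 + p 1 * r 1 + p 2 * r 2 = 0) :
    (orthoFrame p r).transpose * orthoFrame p r = 1 ∧ (orthoFrame p r).det = 1 := by
  constructor
  · ext i j
    fin_cases i <;> fin_cases j <;>
      simp [orthoFrame, Matrix.mul_apply, Fin.sum_univ_three] <;>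
      first
      | ring1
      | linear_combination hp
      | linear_combination hr
      | linear_combination hpr
      | linear_combination (p 0 ^ 2 + p 1 ^ 2 + p 2 ^ 2) * hr + hp -
          (p 0 * r 0 + p 1 * r 1 + p 2 * r 2) * hpr
  · simp only [orthoFrame, Matrix.det_fin_three]
    simp
    linear_combination (p 0 ^ 2 + p 1 ^ 2 + p 2 ^ 2) * hr + hp -
          (p 0 * r 0 + p 1 * r 1 + p 2 * r 2) * hpr

/-- The cross product of the first two columns of a matrix. -/
def colCross (A : Mat3) : Fin 3 → ℝ :=
  ![A 1 0 * A 2 1 - A 2 0 * A 1 1, A 2 0 * A 0 1 - A 0 0 * A 2 1, A 0 0 * A 1 1 - A 1 0 * A 0 1]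

/-- The length of a vector. -/
def vecLen (v : Fin 3 → ℝ) : ℝ := Real.sqrt (v 0 ^ 2 + v 1 ^ 2 + v 2 ^ 2)

theorem vecLen_sq (v : Fin 3 → ℝ) : vecLen v ^ 2 = v 0 ^ 2 + v 1 ^ 2 + v 2 ^ 2 :=
  Real.sq_sqrt (by positivity)

theorem vecLen_pos {v : Fin 3 → ℝ} (h : v ≠ 0) : 0 < vecLen v := by
  refine Real.sqrt_pos.2 ?_
  by_contra! hle
  refine h (funext fun i => ?_)
  have h0 := sq_nonneg (v 0)
  have h1 := sq_nonneg (v 1)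
  have h2 := sq_nonneg (v 2)
  fin_cases i
  · exact pow_eq_zero_iff two_ne_zero |>.1 (show v 0 ^ 2 = 0 by linarith)
  · exact pow_eq_zero_iff two_ne_zero |>.1 (show v 1 ^ 2 = 0 by linarith)
  · exact pow_eq_zero_iff two_ne_zero |>.1 (show v 2 ^ 2 = 0 by linarith)

theorem det_eq_colCross (A : Mat3) :
    A.det = colCross A 0 * A 0 2 + colCross A 1 * A 1 2 + colCross A 2 * A 2 2 := by
  simp [Matrix.det_fin_three, colCross]; ring

theorem colCross_ne_zero {A : Mat3} (h : 0 < A.det) : colCross A ≠ 0 := by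
  intro h0
  rw [det_eq_colCross, h0] at h
  simp at h

theorem col_ne_zero {A : Mat3} (h : 0 < A.det) : (fun i => A i 0) ≠ 0 := by
  intro h0
  have hi : ∀ i, A i 0 = 0 := fun i => congrFun h0 i
  rw [Matrix.det_fin_three] at h
  simp [hi] at h

/-- The Gram–Schmidt orthonormalization of a matrix. -/
def orthoMatrix (A : Mat3) : Mat3 :=
  orthoFrame (fun i => A i 0 / vecLen fun i => A i 0) (fun i => colCross A i / vecLen (colCross A))

theorem orthoMatrix_mem {A : Mat3} (h : 0 < A.det) :
    (orthoMatrix A).transpose * orthoMatrix A = 1 ∧ (orthoMatrix A).det = 1 := by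
  have h1 := vecLen_pos (col_ne_zero h)
  have h2 := vecLen_pos (colCross_ne_zero h)
  have e1 := vecLen_sq fun i => A i 0
  have e2 := vecLen_sq (colCross A)
  apply orthoFrame_mem
  · field_simp
    linear_combination -e1
  · field_simp
    linear_combination -e2
  · field_simp
    simp [colCross]
    ring

/-- The interpolation between a matrix of positive determinant and its orthonormalization has
positive determinant. -/
theorem det_interpolate_pos {A : Mat3} (h : 0 < A.det) {s : ℝ} (h0 : 0 ≤ s) (h1 : s ≤ 1) :
    0 < ((1 - s) • A + s • orthoMatrix A).det := by
  have hR := orthoMatrix_mem h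
  set R := orthoMatrix A
  have hn := vecLen_pos (col_ne_zero h)
  have hm := vecLen_pos (colCross_ne_zero h)
  have e1 := vecLen_sq fun i => A i 0
  have e2 := vecLen_sq (colCross A)
  set n := vecLen fun i => A i 0
  set m := vecLen (colCross A)
  have hRdef : R = orthoFrame (fun i => A i 0 / n) (fun i => colCross A i / m) := rfl
  clear_value R n m
  -- Multiplication by Rᵀ turns the segment into one from RᵀA to 1. The matrix RᵀA is upper
  -- triangular with positive diagonal n, m/n, det A/m, so every matrix of the segment has positive
  -- diagonal.
  have hdet : ((1 - s) • A + s • R).det = ((1 - s) • (R.transpose * A) + s • (1 : Mat3)).det := by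
    have : (1 - s) • (R.transpose * A) + s • (1 : Mat3) =
        R.transpose * ((1 - s) • A + s • R) := by
      rw [mul_add, mul_smul_comm, mul_smul_comm, hR.1]
    rw [this, Matrix.det_mul, Matrix.det_transpose, hR.2, one_mul]
  have hd := det_eq_colCross A
  have t00 : (R.transpose * A) 0 0 = n := by
    simp [hRdef, orthoFrame, Matrix.mul_apply, Fin.sum_univ_three]
    field_simp
    linear_combination -e1
  have t10 : (R.transpose * A) 1 0 = 0 := by
    simp [hRdef, orthoFrame, Matrix.mul_apply, Fin.sum_univ_three]
    field_simp
    ring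
  have t20 : (R.transpose * A) 2 0 = 0 := by
    simp [hRdef, orthoFrame, Matrix.mul_apply, Fin.sum_univ_three]
    field_simp
    simp [colCross]
    ring
  have t21 : (R.transpose * A) 2 1 = 0 := by
    simp [hRdef, orthoFrame, Matrix.mul_apply, Fin.sum_univ_three]
    field_simp
    simp [colCross]
    ring
  have t11 : (R.transpose * A) 1 1 = m / n := by
    have : (R.transpose * A) 1 1 = (colCross A 0 ^ 2 + colCross A 1 ^ 2 + colCross A 2 ^ 2) /
        (m * n) := by
      simp [hRdef, orthoFrame, Matrix.mul_apply, Fin.sum_univ_three]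
      field_simp
      simp [colCross]
      ring
    rw [this, ← e2]
    field_simp
  have t22 : (R.transpose * A) 2 2 = A.det / m := by
    rw [hd]
    simp [hRdef, orthoFrame, Matrix.mul_apply, Fin.sum_univ_three]
    field_simp
  rw [hdet, Matrix.det_fin_three]
  simp only [Matrix.add_apply, Matrix.smul_apply, t00, t10, t20, t21, t11, t22, smul_eq_mul,
    Matrix.one_apply_eq, Matrix.one_apply_ne (show (1 : Fin 3) ≠ 0 by decide),
    Matrix.one_apply_ne (show (2 : Fin 3) ≠ 0 by decide),
    Matrix.one_apply_ne (show (2 : Fin 3) ≠ 1 by decide)]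
  have aux : ∀ x : ℝ, 0 < x → 0 < (1 - s) * x + s * 1 := by
    intro x hx
    rcases h1.eq_or_lt with rfl | h1
    · simp
    · have := mul_pos (sub_pos.2 h1) hx
      linarith
  have := mul_pos (mul_pos (aux n hn) (aux (m / n) (by positivity)))
    (aux (A.det / m) (by positivity))
  simpa using this

/-- A matrix of positive determinant, as an element of `GL₃⁺(ℝ)`. -/
def glMk (A : Mat3) (h : 0 < A.det) : GL(3, ℝ)⁺ :=
  ⟨Matrix.GeneralLinearGroup.mkOfDetNeZero _ h.ne', (Matrix.mem_glpos _).2 h⟩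

/-- The matrix underlying an element of `GL₃⁺(ℝ)`. -/
def glMat (A : GL(3, ℝ)⁺) : Mat3 := ((A : GL (Fin 3) ℝ) : Matrix (Fin 3) (Fin 3) ℝ)

theorem glMat_det_pos (A : GL(3, ℝ)⁺) : 0 < (glMat A).det := (Matrix.mem_glpos _).1 A.2

theorem glMat_injective : Function.Injective glMat := fun _ _ h =>
  Subtype.ext (Units.ext h)

theorem continuous_glMat : Continuous glMat := Units.continuous_val.comp continuous_subtype_val

/-- Gram–Schmidt orthonormalization as a retraction of `GL₃⁺(ℝ)` onto the rotation group. -/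
def orthoMap : C(GL(3, ℝ)⁺, SO3) where
  toFun A := ⟨orthoMatrix (glMat A), orthoMatrix_mem (glMat_det_pos A)⟩
  continuous_toFun := by
    refine Continuous.subtype_mk (continuous_matrix fun i j => ?_) _
    have h := continuous_glMat
    have hij : ∀ i j, Continuous fun A : GL(3, ℝ)⁺ => glMat A i j := fun i j => h.matrix_elem i j
    have h1 : Continuous fun A => vecLen fun i => glMat A i 0 := by
      unfold vecLen
      fun_prop
    have hc : ∀ i, Continuous fun A => colCross (glMat A) i := by
      intro i
      fin_cases i <;> simp [colCross] <;> fun_prop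
    have h2 : Continuous fun A => vecLen (colCross (glMat A)) := by
      unfold vecLen
      fun_prop
    have n1 := fun A => (vecLen_pos (col_ne_zero (glMat_det_pos A))).ne'
    have n2 := fun A => (vecLen_pos (colCross_ne_zero (glMat_det_pos A))).ne'
    have d1 : ∀ i, Continuous fun A => glMat A i 0 / vecLen fun i => glMat A i 0 :=
      fun i => (hij i 0).div h1 n1
    have d2 : ∀ i, Continuous fun A => colCross (glMat A) i / vecLen (colCross (glMat A)) :=
      fun i => (hc i).div h2 n2
    fin_cases i <;> fin_cases j <;> simp [orthoMatrix, orthoFrame] <;> fun_prop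

/-- The inclusion of the rotation group in `GL₃⁺(ℝ)`. -/
def inclSO3 : C(SO3, GL(3, ℝ)⁺) where
  toFun R := glMk R.1 (by rw [R.2.2]; exact one_pos)
  continuous_toFun := continuous_glPos _ continuous_subtype_val

/-- The straight-line homotopy stays in `GL₃⁺(ℝ)` by `det_interpolate_pos`. Hence the fundamental
group loses nothing on passing to rotations. -/
theorem inclSO3_orthoMap_homotopic :
    (inclSO3.comp orthoMap).Homotopic (ContinuousMap.id GL(3, ℝ)⁺) := by
  refine ContinuousMap.Homotopic.symm ⟨⟨⟨fun x => glMk _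
    (det_interpolate_pos (glMat_det_pos x.2) x.1.2.1 x.1.2.2), ?_⟩, ?_, ?_⟩⟩
  · apply continuous_glPos
    have h1 := continuous_glMat
    have h2 : Continuous fun A => orthoMatrix (glMat A) :=
      continuous_subtype_val.comp orthoMap.continuous
    have h3 : Continuous fun x : unitInterval × GL(3, ℝ)⁺ =>
      (1 - (x.1 : ℝ)) • glMat x.2 + (x.1 : ℝ) • orthoMatrix (glMat x.2) := by
      have h4 : Continuous fun x : unitInterval × GL(3, ℝ)⁺ => (x.1 : ℝ) := by fun_prop
      exact ((continuous_const.sub h4).smul (h1.comp continuous_snd)).add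
        (h4.smul (h2.comp continuous_snd))
    exact h3
  · intro A
    refine glMat_injective ?_
    change (1 - ((0 : unitInterval) : ℝ)) • glMat A + ((0 : unitInterval) : ℝ) • _ = glMat A
    simp
  · intro A
    refine glMat_injective ?_
    change (1 - ((1 : unitInterval) : ℝ)) • glMat A + ((1 : unitInterval) : ℝ) •
      orthoMatrix (glMat A) = orthoMatrix (glMat A)
    simp

/-- The parity of a loop in `GL₃⁺(ℝ)` vanishes iff its orthonormalization lifts to a closed loop
in the double cover of the rotation group. -/
theorem loopParity_eq_zero_iff {Y : Type*} [TopologicalSpace Y] (φ : C(Y, GL(3, ℝ)⁺)) {p : Y}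
    (γ : Path p p) : loopParity (γ.map φ.continuous) = 0 ↔
      ∃ Γ : C(unitInterval, Sphere3), (∀ t, rho (Γ t) = orthoMap (φ (γ t))) ∧ Γ 0 = Γ 1 := by
  have hz : ∀ {A : GL(3, ℝ)⁺} (δ : Path A A),
      loopParity δ = 0 ↔ δ.Homotopic (Path.refl A) := by
    intro A δ
    unfold loopParity
    split_ifs with h <;> simp [h]
  constructor
  · intro h
    rw [hz] at h
    obtain ⟨e, he⟩ := rho_surjective (orthoMap (φ p))
    have h' := h.map orthoMap
    set δ := (γ.map φ.continuous).map orthoMap.continuous with hδ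
    have h0 : δ.toContinuousMap 0 = rho e := by simp [hδ, he]
    have h0' : ((Path.refl (φ p)).map orthoMap.continuous).toContinuousMap 0 = rho e := by
      simp [he]
    -- Lifts of homotopic paths with a common start have a common end; here the second path is
    -- constant.
    have key := isCoveringMap_rho.liftPath_apply_one_eq_of_homotopicRel h' e h0 h0'
    have hconst : isCoveringMap_rho.liftPath _ e h0' = .const _ e := by
      symm
      rw [isCoveringMap_rho.eq_liftPath_iff']
      refine ⟨?_, rfl⟩
      funext t
      exact he
    refine ⟨isCoveringMap_rho.liftPath δ.toContinuousMap e h0, fun t => ?_, ?_⟩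
    · exact congrFun (isCoveringMap_rho.liftPath_lifts δ.toContinuousMap e h0) t
    · rw [key, hconst, isCoveringMap_rho.liftPath_zero]
      rfl
  · rintro ⟨Γ, hΓ, h01⟩
    -- A closed lift is a loop in the simply connected S³, so its image in `GL₃⁺(ℝ)` contracts. The
    -- orthonormalized loop is compared with the original one afterwards.
    have hψ : loopParity (γ.map ((inclSO3.comp orthoMap).comp φ).continuous) = 0 := by
      rw [hz]
      let Γ' : Path (Γ 0) (Γ 0) := ⟨Γ, rfl, h01.symm⟩
      let π : C(Sphere3, GL(3, ℝ)⁺) := inclSO3.comp ⟨rho, continuous_rho⟩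
      have hnull : Γ'.Homotopic (Path.refl _) := SimplyConnectedSpace.paths_homotopic _ _
      obtain ⟨F⟩ := hnull.map π
      refine ⟨ContinuousMap.HomotopyRel.cast F ?_ ?_⟩
      · ext1 t
        exact congrArg inclSO3 (hΓ t)
      · ext1 t
        have := congrArg inclSO3 (hΓ 0)
        rw [γ.source] at this
        exact this
    rw [← hψ]
    refine loopParity_congr ?_ p γ
    have := inclSO3_orthoMap_homotopic.comp (ContinuousMap.Homotopic.refl φ)
    exact this.symm

/-! ### Singular chains modulo two -/

section Chains

variable {X Y : Type*} [TopologicalSpace X] [TopologicalSpace Y]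

theorem SingularSimplex.face_face {l m n : ℕ} (σ : SingularSimplex n X)
    (g : Fin (m + 1) → Fin (n + 1)) (h : Fin (l + 1) → Fin (m + 1)) :
    (σ.face g).face h = σ.face (g ∘ h) := by
  ext x
  exact congrArg σ (stdSimplex.map_comp_apply h g x)

/-- The chain consisting of one simplex. -/
abbrev Chain.of {n : ℕ} (σ : SingularSimplex n X) : Chain n X := Finsupp.single σ 1

theorem Chain.hom_ext {n : ℕ} {N : Type*} [AddCommMonoid N] [Module (ZMod 2) N]
    {f g : Chain n X →ₗ[ZMod 2] N} (h : ∀ σ, f (Chain.of σ) = g (Chain.of σ)) : f = g :=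
  Finsupp.lhom_ext' fun σ => LinearMap.ext_ring (h σ)

theorem Chain.add_self {n : ℕ} (c : Chain n X) : c + c = 0 := ZModModule.add_self c

theorem boundary_of (n : ℕ) (σ : SingularSimplex (n + 1) X) :
    boundary n X (Chain.of σ) = ∑ i : Fin (n + 2), Chain.of (σ.face i.succAbove) := by
  simp [boundary, Finsupp.lmapDomain_apply, Finsupp.mapDomain_single]

theorem pushforward_of {n : ℕ} (f : C(X, Y)) (σ : SingularSimplex n X) :
    pushforward n f (Chain.of σ) = Chain.of (f.comp σ) := by
  simp [pushforward, Finsupp.lmapDomain_apply, Finsupp.mapDomain_single]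

/-- A sum over pairs of successive faces vanishes modulo two. -/
theorem sum_succAbove_succAbove {V : Type*} [AddCommGroup V] [Module (ZMod 2) V] {n : ℕ}
    (F : (Fin (n + 1) → Fin (n + 3)) → V) :
    ∑ i : Fin (n + 3), ∑ j : Fin (n + 2), F (i.succAbove ∘ j.succAbove) = 0 := by
  rw [← Finset.univ.sum_product' Finset.univ
    (fun (i : Fin (n + 3)) (j : Fin (n + 2)) => F (i.succAbove ∘ j.succAbove))]
  have hcomm : ∀ (i : Fin (n + 3)) (j : Fin (n + 2)),
      (i.succAbove j).succAbove ∘ (j.predAbove i).succAbove = i.succAbove ∘ j.succAbove :=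
    fun i j => funext fun k => Fin.succAbove_succAbove_succAbove_predAbove i j k
  -- The involution exchanges the order in which the two vertices are omitted, so the terms cancel
  -- in pairs.
  refine Finset.sum_involution (fun x _ => (x.1.succAbove x.2, x.2.predAbove x.1)) ?_ ?_ ?_ ?_
  · rintro ⟨i, j⟩ -
    simp only [hcomm]
    exact ZModModule.add_self _
  · rintro ⟨i, j⟩ - - h
    exact Fin.succAbove_ne i j (congrArg Prod.fst h)
  · simp
  · rintro ⟨i, j⟩ -
    have h1 := Fin.succAbove_succAbove_predAbove i j
    refine Prod.ext h1 ?_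
    have := Fin.predAbove_predAbove_succAbove i j
    exact this

theorem boundary_boundary {n : ℕ} (c : Chain (n + 2) X) :
    boundary n X (boundary (n + 1) X c) = 0 := by
  have : (boundary n X).comp (boundary (n + 1) X) = 0 := by
    refine Chain.hom_ext fun σ => ?_
    simp only [LinearMap.comp_apply, boundary_of, map_sum, SingularSimplex.face_face,
      LinearMap.zero_apply]
    exact sum_succAbove_succAbove fun g => Chain.of (σ.face g)
  exact LinearMap.congr_fun this c

theorem boundary_pushforward {n : ℕ} (f : C(X, Y)) (c : Chain (n + 1) X) :
    boundary n Y (pushforward (n + 1) f c) = pushforward n f (boundary n X c) := by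
  have : (boundary n Y).comp (pushforward (n + 1) f) = (pushforward n f).comp (boundary n X) := by
    refine Chain.hom_ext fun σ => ?_
    simp only [LinearMap.comp_apply, boundary_of, map_sum, pushforward_of]
    rfl
  exact LinearMap.congr_fun this c

theorem pushforward_pushforward {Z : Type*} [TopologicalSpace Z] {n : ℕ} (g : C(Y, Z)) (f : C(X, Y))
    (c : Chain n X) : pushforward n g (pushforward n f c) = pushforward n (g.comp f) c := by
  have : (pushforward n g).comp (pushforward n f) = pushforward n (g.comp f) := by
    refine Chain.hom_ext fun σ => ?_
    simp only [LinearMap.comp_apply, pushforward_of]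
    rfl
  exact LinearMap.congr_fun this c

theorem pushforward_id {n : ℕ} (c : Chain n X) : pushforward n (ContinuousMap.id X) c = c := by
  have : pushforward n (ContinuousMap.id X) = LinearMap.id := by
    refine Chain.hom_ext fun σ => ?_
    simp only [pushforward_of]
    rfl
  exact LinearMap.congr_fun this c

theorem chainsIn_eq_span (n : ℕ) (A : Set X) : chainsIn n A =
    Submodule.span (ZMod 2) (Chain.of '' {σ : SingularSimplex n X | Set.range σ ⊆ A}) :=
  Finsupp.supported_eq_span_single _ _

theorem of_mem_chainsIn {n : ℕ} {A : Set X} {σ : SingularSimplex n X} (h : Set.range σ ⊆ A) :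
    Chain.of σ ∈ chainsIn n A :=
  Finsupp.single_mem_supported _ _ h

theorem map_mem_of_chainsIn {n : ℕ} {A : Set X} {N : Type*} [AddCommMonoid N] [Module (ZMod 2) N]
    (f : Chain n X →ₗ[ZMod 2] N) (P : Submodule (ZMod 2) N)
    (h : ∀ σ : SingularSimplex n X, Set.range σ ⊆ A → f (Chain.of σ) ∈ P) {c : Chain n X}
    (hc : c ∈ chainsIn n A) : f c ∈ P := by
  have : chainsIn n A ≤ P.comap f := by
    rw [chainsIn_eq_span, Submodule.span_le]
    rintro _ ⟨σ, hσ, rfl⟩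
    exact h σ hσ
  exact this hc

theorem eq_on_chainsIn {n : ℕ} {A : Set X} {N : Type*} [AddCommMonoid N] [Module (ZMod 2) N]
    (f g : Chain n X →ₗ[ZMod 2] N)
    (h : ∀ σ : SingularSimplex n X, Set.range σ ⊆ A → f (Chain.of σ) = g (Chain.of σ))
    {c : Chain n X} (hc : c ∈ chainsIn n A) : f c = g c := by
  have : chainsIn n A ≤ LinearMap.eqLocus f g := by
    rw [chainsIn_eq_span, Submodule.span_le]
    rintro _ ⟨σ, hσ, rfl⟩
    exact h σ hσ
  exact this hc

theorem SingularSimplex.range_face_subset {m n : ℕ} (g : Fin (m + 1) → Fin (n + 1))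
    (σ : SingularSimplex n X) : Set.range (σ.face g) ⊆ Set.range σ := by
  rintro _ ⟨x, rfl⟩
  exact ⟨_, rfl⟩

theorem boundary_mem_chainsIn {n : ℕ} {A : Set X} {c : Chain (n + 1) X}
    (hc : c ∈ chainsIn (n + 1) A) : boundary n X c ∈ chainsIn n A := by
  refine map_mem_of_chainsIn _ _ (fun σ hσ => ?_) hc
  rw [boundary_of]
  exact Submodule.sum_mem _ fun i _ =>
    of_mem_chainsIn ((SingularSimplex.range_face_subset _ σ).trans hσ)

theorem pushforward_mem_chainsIn {n : ℕ} {A : Set X} {B : Set Y} {f : C(X, Y)}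
    (hf : Set.MapsTo f A B) {c : Chain n X} (hc : c ∈ chainsIn n A) :
    pushforward n f c ∈ chainsIn n B := by
  refine map_mem_of_chainsIn _ _ (fun σ hσ => ?_) hc
  rw [pushforward_of]
  refine of_mem_chainsIn ?_
  rintro _ ⟨x, rfl⟩
  exact hf (hσ ⟨x, rfl⟩)

theorem mem_chainsIn_univ {n : ℕ} (c : Chain n X) : c ∈ chainsIn n (Set.univ : Set X) := by
  intro σ _
  exact Set.subset_univ _

theorem pushforward_mem_chainsIn_range {n : ℕ} {B : Set Y} {f : C(X, Y)} (hf : ∀ x, f x ∈ B)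
    (c : Chain n X) : pushforward n f c ∈ chainsIn n B :=
  pushforward_mem_chainsIn (fun x _ => hf x) (mem_chainsIn_univ c)

theorem pushforward_eq_self {n : ℕ} {A : Set X} {f : C(X, X)} (hf : ∀ x ∈ A, f x = x)
    {c : Chain n X} (hc : c ∈ chainsIn n A) : pushforward n f c = c := by
  refine eq_on_chainsIn (pushforward n f) LinearMap.id (fun σ hσ => ?_) hc
  rw [pushforward_of]
  congr 1
  ext x
  exact hf _ (hσ ⟨x, rfl⟩)

theorem chainsIn_mono {n : ℕ} {A B : Set X} (h : A ⊆ B) : chainsIn n A ≤ chainsIn n B :=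
  Finsupp.supported_mono fun _ hσ => Set.Subset.trans hσ h

theorem mem_chainsIn_inter {n : ℕ} {A B : Set X} {c : Chain n X} (hA : c ∈ chainsIn n A)
    (hB : c ∈ chainsIn n B) : c ∈ chainsIn n (A ∩ B) :=
  fun _ hσ => Set.subset_inter (hA hσ) (hB hσ)

/-- Chains in the image of an embedding are images of chains. -/
theorem exists_pushforward_eq {n : ℕ} {f : C(X, Y)} (hf : Topology.IsEmbedding f) {c : Chain n Y}
    (hc : c ∈ chainsIn n (Set.range f)) : ∃ d : Chain n X, pushforward n f d = c := by
  refine map_mem_of_chainsIn LinearMap.id (LinearMap.range (pushforward n f)) (fun σ hσ => ?_) hc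
  have hmem : ∀ x, σ x ∈ Set.range f := fun x => hσ ⟨x, rfl⟩
  choose s hs using hmem
  have hcont : Continuous s := by
    rw [hf.continuous_iff]
    exact σ.continuous.congr fun x => (hs x).symm
  refine ⟨Chain.of ⟨s, hcont⟩, ?_⟩
  rw [pushforward_of]
  congr 1
  ext x
  exact hs x

theorem pushforward_injective {n : ℕ} {f : C(X, Y)} (hf : Function.Injective f) :
    Function.Injective (pushforward n f) := by
  refine Finsupp.mapDomain_injective ?_
  intro σ τ h
  ext x
  exact hf (ContinuousMap.congr_fun h x)

/-- No cancellation occurs under an injective map: the coefficient of f ∘ σ in the image is that of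
σ. -/
theorem mem_chainsIn_of_pushforward {n : ℕ} {f : C(X, Y)} (hf : Function.Injective f)
    {B : Set Y} {c : Chain n X} (hc : pushforward n f c ∈ chainsIn n B) :
    c ∈ chainsIn n (f ⁻¹' B) := by
  intro σ hσ
  have hinj : Function.Injective fun σ : SingularSimplex n X => f.comp σ := by
    intro σ τ h
    ext x
    exact hf (ContinuousMap.congr_fun h x)
  have h1 : f.comp σ ∈ (pushforward n f c).support := by
    rw [Finsupp.mem_support_iff]
    change Finsupp.mapDomain (fun σ : SingularSimplex n X => f.comp σ) c (f.comp σ) ≠ 0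
    rw [Finsupp.mapDomain_apply hinj]
    exact Finsupp.mem_support_iff.1 hσ
  have h2 : Set.range (f.comp σ) ⊆ B := hc h1
  rintro _ ⟨x, rfl⟩
  exact h2 ⟨x, rfl⟩

/-- The augmentation of singular `0`-chains. -/
def augmentation (X : Type*) [TopologicalSpace X] : Chain 0 X →ₗ[ZMod 2] ZMod 2 :=
  Finsupp.linearCombination (ZMod 2) fun _ => (1 : ZMod 2)

theorem augmentation_of (σ : SingularSimplex 0 X) : augmentation X (Chain.of σ) = 1 := by
  simp [augmentation]

theorem augmentation_boundary (c : Chain 1 X) : augmentation X (boundary 0 X c) = 0 := by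
  have : (augmentation X).comp (boundary 0 X) = 0 := by
    refine Chain.hom_ext fun σ => ?_
    simp only [LinearMap.comp_apply, boundary_of, map_sum, augmentation_of, LinearMap.zero_apply]
    decide
  exact LinearMap.congr_fun this c

end Chains

/-! ### Cones and acyclicity of star-shaped sets -/

section Cone

/-- The standard simplex with vertices `0, …, n`. -/
abbrev Simplex (n : ℕ) : Type := stdSimplex ℝ (Fin (n + 1))

theorem Simplex.map_apply {m n : ℕ} {g : Fin (m + 1) → Fin (n + 1)} (hg : Function.Injective g)
    (x : Simplex m) (i : Fin (m + 1)) : (stdSimplex.map g x).1 (g i) = x.1 i := by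
  change FunOnFinite.linearMap ℝ ℝ g x.1 (g i) = _
  rw [FunOnFinite.linearMap_apply_apply]
  have : (Finset.univ.filter fun j => g j = g i) = {i} := by
    ext j; simp [hg.eq_iff]
  simp [this]

theorem Simplex.map_apply_of_notMem {m n : ℕ} {g : Fin (m + 1) → Fin (n + 1)}
    (x : Simplex m) {j : Fin (n + 1)} (hj : j ∉ Set.range g) : (stdSimplex.map g x).1 j = 0 := by
  change FunOnFinite.linearMap ℝ ℝ g x.1 j = _
  rw [FunOnFinite.linearMap_apply_apply]
  have : (Finset.univ.filter fun i => g i = j) = ∅ := by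
    ext i; simp; exact fun h => hj ⟨i, h⟩
  simp [this]

theorem Simplex.sum_succ {n : ℕ} (x : Simplex (n + 1)) :
    ∑ i : Fin (n + 1), x.1 i.succ = 1 - x.1 0 := by
  have := x.2.2
  rw [Fin.sum_univ_succ] at this
  linarith

theorem Simplex.le_one {n : ℕ} (x : Simplex n) (i : Fin (n + 1)) : x.1 i ≤ 1 := stdSimplex.le_one x i

/-- The projection of a point of a simplex to the face opposite to vertex `0`. -/
def Simplex.tail {n : ℕ} (x : Simplex (n + 1)) : Simplex n :=
  -- The value at the apex is arbitrary, because `cone` multiplies the difference from the apex by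
  -- zero there.
  if h : x.1 0 = 1 then stdSimplex.vertex 0 else
    ⟨fun i => x.1 i.succ / (1 - x.1 0), fun i =>
      div_nonneg (x.2.1 _) (sub_nonneg.2 (Simplex.le_one x 0)), by
      rw [← Finset.sum_div, Simplex.sum_succ x, div_self (sub_ne_zero.2 (Ne.symm h))]⟩

theorem Simplex.tail_apply {n : ℕ} (x : Simplex (n + 1)) (h : x.1 0 ≠ 1) (i : Fin (n + 1)) :
    (Simplex.tail x).1 i = x.1 i.succ / (1 - x.1 0) := by
  rw [Simplex.tail, dif_neg h]

theorem Simplex.continuousAt_tail {n : ℕ} (x : Simplex (n + 1)) (h : x.1 0 ≠ 1) :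
    ContinuousAt (Simplex.tail (n := n)) x := by
  rw [Topology.IsInducing.subtypeVal.continuousAt_iff, continuousAt_pi]
  intro i
  have hc : ∀ i, Continuous fun y : Simplex (n + 1) => y.1 i := fun i =>
    (continuous_apply i).comp continuous_subtype_val
  have h1 : ContinuousAt (fun y : Simplex (n + 1) => y.1 i.succ / (1 - y.1 0)) x :=
    (hc _).continuousAt.div (continuousAt_const.sub (hc 0).continuousAt)
      (sub_ne_zero.2 (Ne.symm h))
  refine h1.congr ?_
  filter_upwards [(hc 0).continuousAt.eventually_ne h] with y hy
  exact (Simplex.tail_apply y hy i).symm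

theorem Simplex.map_succ_zero {n : ℕ} (y : Simplex n) :
    (stdSimplex.map (Fin.succAbove 0) y : Simplex (n + 1)).1 0 = 0 :=
  Simplex.map_apply_of_notMem _ (by simp [Fin.succAbove_zero])

theorem Simplex.tail_map_succ {n : ℕ} (y : Simplex n) :
    (Simplex.tail (stdSimplex.map (Fin.succAbove 0) y : Simplex (n + 1))) = y := by
  have h0 := Simplex.map_succ_zero y
  refine Subtype.ext (funext fun i => ?_)
  rw [Simplex.tail_apply _ (by rw [h0]; norm_num), h0]
  have := Simplex.map_apply (Fin.succAbove_right_injective (p := (0 : Fin (n + 2)))) y i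
  rw [Fin.succAbove_zero] at this
  rw [Fin.succAbove_zero, this]
  simp

theorem Simplex.map_succAbove_succ_zero {n : ℕ} (i : Fin (n + 2)) (x : Simplex (n + 1)) :
    (stdSimplex.map i.succ.succAbove x : Simplex (n + 2)).1 0 = x.1 0 := by
  have := Simplex.map_apply (Fin.succAbove_right_injective (p := i.succ)) x 0
  simpa using this

theorem Simplex.tail_map_succAbove_succ {n : ℕ} (i : Fin (n + 2)) (x : Simplex (n + 1))
    (h : x.1 0 ≠ 1) :
    (Simplex.tail (stdSimplex.map i.succ.succAbove x : Simplex (n + 2))) =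
      stdSimplex.map i.succAbove (Simplex.tail x) := by
  have h0 := Simplex.map_succAbove_succ_zero i x
  refine Subtype.ext (funext fun j => ?_)
  rw [Simplex.tail_apply _ (by rwa [h0]), h0]
  rcases Fin.eq_self_or_eq_succAbove i j with rfl | ⟨k, rfl⟩
  · rw [Simplex.map_apply_of_notMem, Simplex.map_apply_of_notMem, zero_div] <;>
    · rintro ⟨k, hk⟩
      exact Fin.succAbove_ne _ _ hk
  · rw [Simplex.map_apply Fin.succAbove_right_injective, Simplex.tail_apply _ h,
      ← Fin.succ_succAbove_succ, Simplex.map_apply Fin.succAbove_right_injective]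

variable {E : Type*} [NormedAddCommGroup E] [NormedSpace ℝ E]

/-- The cone over a singular simplex with apex `b`. -/
def cone {n : ℕ} (b : E) (σ : SingularSimplex n E) : SingularSimplex (n + 1) E where
  toFun x := b + (1 - x.1 0) • (σ (Simplex.tail x) - b)
  continuous_toFun := by
    have hc : Continuous fun y : Simplex (n + 1) => 1 - y.1 0 :=
      continuous_const.sub ((continuous_apply 0).comp continuous_subtype_val)
    rw [continuous_iff_continuousAt]
    intro x
    refine continuousAt_const.add ?_
    by_cases h : x.1 0 = 1
    -- At the apex `Simplex.tail` need not be continuous, but σ is bounded and the factor 1 - x₀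
    -- tends to zero.
    · obtain ⟨C, hC⟩ := (isCompact_range (σ.continuous.sub (continuous_const (y := b))).norm).bddAbove
      have hC' : ∀ y, ‖σ y - b‖ ≤ C := fun y => hC ⟨y, rfl⟩
      have hx : (1 - x.1 0) • (σ (Simplex.tail x) - b) = 0 := by simp [h]
      rw [ContinuousAt, hx]
      refine squeeze_zero_norm (a := fun y : Simplex (n + 1) => |1 - y.1 0| * C) (fun y => ?_) ?_
      · rw [norm_smul, Real.norm_eq_abs]
        exact mul_le_mul_of_nonneg_left (hC' _) (abs_nonneg _)
      · have := (hc.abs.mul (continuous_const (y := C))).tendsto x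
        have h0 : |1 - x.1 0| * C = 0 := by simp [h]
        rw [← h0]
        exact this
    · exact hc.continuousAt.smul
        ((σ.continuous.continuousAt.comp (Simplex.continuousAt_tail x h)).sub continuousAt_const)

theorem cone_face_zero {n : ℕ} (b : E) (σ : SingularSimplex n E) :
    (cone b σ).face (Fin.succAbove 0) = σ := by
  ext y
  change b + (1 - (stdSimplex.map (Fin.succAbove 0) y : Simplex (n + 1)).1 0) •
    (σ (Simplex.tail (stdSimplex.map (Fin.succAbove 0) y : Simplex (n + 1))) - b) = σ y
  rw [Simplex.map_succ_zero, Simplex.tail_map_succ]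
  simp

theorem cone_face_succ {n : ℕ} (b : E) (σ : SingularSimplex (n + 1) E) (i : Fin (n + 2)) :
    (cone b σ).face i.succ.succAbove = cone b (σ.face i.succAbove) := by
  ext x
  change b + (1 - (stdSimplex.map i.succ.succAbove x : Simplex (n + 2)).1 0) •
    (σ (Simplex.tail (stdSimplex.map i.succ.succAbove x : Simplex (n + 2))) - b) =
      b + (1 - x.1 0) • (σ (stdSimplex.map i.succAbove (Simplex.tail x)) - b)
  rw [Simplex.map_succAbove_succ_zero]
  by_cases h : x.1 0 = 1
  · simp [h]
  · rw [Simplex.tail_map_succAbove_succ i x h]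

theorem cone_face_one (b : E) (σ : SingularSimplex 0 E) :
    (cone b σ).face (Fin.succAbove 1) = ContinuousMap.const _ b := by
  ext x
  have h0 : (stdSimplex.map (Fin.succAbove 1) x : Simplex 1).1 0 = 1 := by
    have := Simplex.map_apply (Fin.succAbove_right_injective (p := (1 : Fin 2))) x 0
    rw [show (1 : Fin 2).succAbove 0 = 0 from rfl] at this
    rw [this]
    have h2 := x.2.2
    simpa using h2
  change b + (1 - (stdSimplex.map (Fin.succAbove 1) x : Simplex 1).1 0) • _ = b
  rw [h0]
  simp

theorem cone_range_subset {n : ℕ} {b : E} {A : Set E} (hA : StarConvex ℝ b A)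
    {σ : SingularSimplex n E} (hσ : Set.range σ ⊆ A) : Set.range (cone b σ) ⊆ A := by
  rintro _ ⟨x, rfl⟩
  have := hA (hσ ⟨(Simplex.tail x), rfl⟩) (x.2.1 0) (sub_nonneg.2 (Simplex.le_one x 0)) (by ring)
  convert this using 1
  change b + (1 - x.1 0) • (σ (Simplex.tail x) - b) = _
  rw [smul_sub, sub_smul 1 _ b, one_smul]
  abel

/-- The cone over a chain. -/
def coneChain (n : ℕ) (b : E) : Chain n E →ₗ[ZMod 2] Chain (n + 1) E :=
  Finsupp.lmapDomain (ZMod 2) (ZMod 2) (cone b)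

theorem coneChain_of {n : ℕ} (b : E) (σ : SingularSimplex n E) :
    coneChain n b (Chain.of σ) = Chain.of (cone b σ) := by
  simp [coneChain, Finsupp.lmapDomain_apply, Finsupp.mapDomain_single]

theorem coneChain_mem {n : ℕ} {b : E} {A : Set E} (hA : StarConvex ℝ b A) {c : Chain n E}
    (hc : c ∈ chainsIn n A) : coneChain n b c ∈ chainsIn (n + 1) A := by
  refine map_mem_of_chainsIn _ _ (fun σ hσ => ?_) hc
  rw [coneChain_of]
  exact of_mem_chainsIn (cone_range_subset hA hσ)

/-- One face of a cone is its base and the others are cones over the faces of the base, so coning is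
a contracting homotopy in positive degrees. -/
theorem boundary_coneChain {n : ℕ} (b : E) (c : Chain (n + 1) E) :
    boundary (n + 1) E (coneChain (n + 1) b c) = c + coneChain n b (boundary n E c) := by
  have : (boundary (n + 1) E).comp (coneChain (n + 1) b) =
      LinearMap.id + (coneChain n b).comp (boundary n E) := by
    refine Chain.hom_ext fun σ => ?_
    simp only [LinearMap.comp_apply, LinearMap.add_apply, LinearMap.id_apply, coneChain_of,
      boundary_of, map_sum]
    rw [Fin.sum_univ_succ, cone_face_zero]
    simp only [cone_face_succ]
  exact LinearMap.congr_fun this c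

/-- In degree zero the face opposite to the base vertex is the apex, which accounts for the
augmentation term. -/
theorem boundary_coneChain_zero (b : E) (c : Chain 0 E) :
    boundary 0 E (coneChain 0 b c) =
      c + augmentation E c • Chain.of (ContinuousMap.const _ b) := by
  have : (boundary 0 E).comp (coneChain 0 b) =
      LinearMap.id + (augmentation E).smulRight (Chain.of (ContinuousMap.const _ b)) := by
    refine Chain.hom_ext fun σ => ?_
    simp only [LinearMap.comp_apply, LinearMap.add_apply, LinearMap.id_apply, coneChain_of,
      boundary_of, LinearMap.smulRight_apply, augmentation_of, one_smul]
    rw [Fin.sum_univ_two, cone_face_zero, cone_face_one]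
  exact LinearMap.congr_fun this c

/-- Cycles of positive degree in a star-shaped set bound in it. -/
theorem exists_boundary_of_starConvex {n : ℕ} {b : E} {A : Set E} (hA : StarConvex ℝ b A)
    {c : Chain (n + 1) E} (hc : c ∈ chainsIn (n + 1) A) (h : boundary n E c = 0) :
    ∃ w ∈ chainsIn (n + 2) A, boundary (n + 1) E w = c :=
  ⟨coneChain _ b c, coneChain_mem hA hc, by rw [boundary_coneChain, h, map_zero, add_zero]⟩

/-- A `0`-chain of augmentation zero in a star-shaped set bounds in it. -/
theorem exists_boundary_of_starConvex_zero {b : E} {A : Set E} (hA : StarConvex ℝ b A)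
    {c : Chain 0 E} (hc : c ∈ chainsIn 0 A) (h : augmentation E c = 0) :
    ∃ w ∈ chainsIn 1 A, boundary 0 E w = c :=
  ⟨coneChain _ b c, coneChain_mem hA hc, by
    rw [boundary_coneChain_zero, h, zero_smul, add_zero]⟩

end Cone

/-! ### Barycentric subdivision of affine simplices -/

section Subdivision

/-- The vertices of an affine `k`-simplex in the standard `n`-simplex. -/
abbrev Tuple (k n : ℕ) : Type := Fin (k + 1) → Simplex n

/-- Affine chains in the standard simplex. -/
abbrev TupleChain (k n : ℕ) : Type := Tuple k n →₀ ZMod 2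

/-- The chain consisting of one affine simplex. -/
abbrev TupleChain.of {k n : ℕ} (v : Tuple k n) : TupleChain k n := Finsupp.single v 1

theorem TupleChain.hom_ext {k n : ℕ} {N : Type*} [AddCommMonoid N] [Module (ZMod 2) N]
    {f g : TupleChain k n →ₗ[ZMod 2] N} (h : ∀ v, f (TupleChain.of v) = g (TupleChain.of v)) :
    f = g :=
  Finsupp.lhom_ext' fun v => LinearMap.ext_ring (h v)

/-- The boundary of an affine chain. -/
def tBoundary (k n : ℕ) : TupleChain (k + 1) n →ₗ[ZMod 2] TupleChain k n :=
  ∑ i : Fin (k + 2), Finsupp.lmapDomain (ZMod 2) (ZMod 2) fun v : Tuple (k + 1) n => v ∘ i.succAbove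

theorem tBoundary_of {k n : ℕ} (v : Tuple (k + 1) n) :
    tBoundary k n (TupleChain.of v) = ∑ i : Fin (k + 2), TupleChain.of (v ∘ i.succAbove) := by
  simp [tBoundary, Finsupp.lmapDomain_apply, Finsupp.mapDomain_single]

theorem tBoundary_tBoundary {k n : ℕ} (c : TupleChain (k + 2) n) :
    tBoundary k n (tBoundary (k + 1) n c) = 0 := by
  have : (tBoundary k n).comp (tBoundary (k + 1) n) = 0 := by
    refine TupleChain.hom_ext fun v => ?_
    simp only [LinearMap.comp_apply, tBoundary_of, map_sum, LinearMap.zero_apply]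
    exact sum_succAbove_succAbove fun g => TupleChain.of (v ∘ g)
  exact LinearMap.congr_fun this c

/-- The cone over an affine chain. -/
def tCone (k : ℕ) {n : ℕ} (b : Simplex n) : TupleChain k n →ₗ[ZMod 2] TupleChain (k + 1) n :=
  Finsupp.lmapDomain (ZMod 2) (ZMod 2) fun v : Tuple k n => (Fin.cons b v : Tuple (k + 1) n)

theorem tCone_of {k n : ℕ} (b : Simplex n) (v : Tuple k n) :
    tCone k b (TupleChain.of v) = TupleChain.of (Fin.cons b v : Tuple (k + 1) n) := by
  simp [tCone, Finsupp.lmapDomain_apply, Finsupp.mapDomain_single]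

theorem tBoundary_tCone {k n : ℕ} (b : Simplex n) (c : TupleChain (k + 1) n) :
    tBoundary (k + 1) n (tCone (k + 1) b c) = c + tCone k b (tBoundary k n c) := by
  have : (tBoundary (k + 1) n).comp (tCone (k + 1) b) =
      LinearMap.id + (tCone k b).comp (tBoundary k n) := by
    refine TupleChain.hom_ext fun v => ?_
    simp only [LinearMap.comp_apply, LinearMap.add_apply, LinearMap.id_apply, tCone_of,
      tBoundary_of, map_sum]
    rw [Fin.sum_univ_succ]
    congr 1
    refine Finset.sum_congr rfl fun i _ => ?_
    congr 1
    funext j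
    refine Fin.cases ?_ (fun j => ?_) j <;> simp
  exact LinearMap.congr_fun this c

/-- The cone over the boundary of an affine `1`-simplex is a filling. -/
theorem tBoundary_tCone_tBoundary {n : ℕ} (b : Simplex n) (c : TupleChain 1 n) :
    tBoundary 0 n (tCone 0 b (tBoundary 0 n c)) = tBoundary 0 n c := by
  have : ((tBoundary 0 n).comp (tCone 0 b)).comp (tBoundary 0 n) = tBoundary 0 n := by
    refine TupleChain.hom_ext fun v => ?_
    have h : ∀ u : Tuple 0 n, tBoundary 0 n (tCone 0 b (TupleChain.of u)) =
        TupleChain.of u + TupleChain.of fun _ => b := by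
      intro u
      rw [tCone_of, tBoundary_of, Fin.sum_univ_two]
      congr 2
      funext j
      have hj : j = 0 := Fin.ext (by omega)
      subst hj
      rfl
    simp only [LinearMap.comp_apply]
    rw [tBoundary_of, Fin.sum_univ_two, map_add, map_add, h, h]
    rw [add_add_add_comm, ZModModule.add_self, add_zero]
  exact LinearMap.congr_fun this c

/-- The affine combination of the vertices of an affine simplex. -/
def affineComb {k n : ℕ} (v : Tuple k n) (x : Simplex k) : Simplex n :=
  ⟨∑ i, x.1 i • (v i).1, (convex_stdSimplex ℝ _).sum_mem (fun i _ => x.2.1 i) x.2.2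
    fun i _ => (v i).2⟩

theorem continuous_affineComb {k n : ℕ} (v : Tuple k n) : Continuous (affineComb v) := by
  refine Continuous.subtype_mk (continuous_finsetSum _ fun i _ => ?_) _
  exact ((continuous_apply i).comp continuous_subtype_val).smul continuous_const

theorem map_affineComb {k m n : ℕ} (g : Fin (m + 1) → Fin (n + 1)) (v : Tuple k m) (x : Simplex k) :
    stdSimplex.map g (affineComb v x) = affineComb (fun i => stdSimplex.map g (v i)) x := by
  refine Subtype.ext ?_
  change FunOnFinite.linearMap ℝ ℝ g (∑ i, x.1 i • (v i).1) =
    ∑ i, x.1 i • FunOnFinite.linearMap ℝ ℝ g (v i).1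
  rw [map_sum]
  simp only [map_smul]

theorem affineComb_map {k l n : ℕ} (v : Tuple k n) (g : Fin (l + 1) → Fin (k + 1)) (x : Simplex l) :
    affineComb v (stdSimplex.map g x) = affineComb (v ∘ g) x := by
  refine Subtype.ext ?_
  change ∑ i, FunOnFinite.linearMap ℝ ℝ g x.1 i • (v i).1 = ∑ i, x.1 i • (v (g i)).1
  simp only [FunOnFinite.linearMap_apply_apply, Finset.sum_smul]
  rw [← Finset.sum_fiberwise Finset.univ g fun i => x.1 i • (v (g i)).1]
  refine Finset.sum_congr rfl fun j _ => Finset.sum_congr rfl fun i hi => ?_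
  rw [(Finset.mem_filter.1 hi).2]

theorem affineComb_vertex {n : ℕ} (x : Simplex n) :
    affineComb (fun i => stdSimplex.vertex i : Tuple n n) x = x := by
  refine Subtype.ext ?_
  funext j
  simp [affineComb, Finset.sum_apply, Pi.single_apply]

/-- The barycenter of an affine simplex. -/
def bary {k n : ℕ} (v : Tuple k n) : Simplex n := affineComb v stdSimplex.barycenter

/-- Barycentric subdivision of affine chains. -/
def tSd (n : ℕ) : (k : ℕ) → TupleChain k n →ₗ[ZMod 2] TupleChain k n
  | 0 => LinearMap.id
  | k + 1 => Finsupp.linearCombination (ZMod 2) fun v =>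
      tCone k (bary v) (tSd n k (tBoundary k n (TupleChain.of v)))

theorem tSd_of {n k : ℕ} (v : Tuple (k + 1) n) : tSd n (k + 1) (TupleChain.of v) =
    tCone k (bary v) (tSd n k (tBoundary k n (TupleChain.of v))) := by
  rw [tSd, Finsupp.linearCombination_single, one_smul]

/-- With b the barycenter, ∂(b·Sd ∂v) = Sd ∂v + b·∂Sd ∂v, and by induction the last term is b·Sd ∂∂v
= 0. Degree one is separate, since the cone formula changes in degree zero. -/
theorem tBoundary_tSd {n : ℕ} (k : ℕ) (c : TupleChain (k + 1) n) :
    tBoundary k n (tSd n (k + 1) c) = tSd n k (tBoundary k n c) := by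
  induction k with
  | zero =>
    have : (tBoundary 0 n).comp (tSd n 1) = (tSd n 0).comp (tBoundary 0 n) := by
      refine TupleChain.hom_ext fun v => ?_
      rw [LinearMap.comp_apply, tSd_of, LinearMap.comp_apply]
      exact tBoundary_tCone_tBoundary _ _
    exact LinearMap.congr_fun this c
  | succ k ih =>
    have : (tBoundary (k + 1) n).comp (tSd n (k + 2)) =
        (tSd n (k + 1)).comp (tBoundary (k + 1) n) := by
      refine TupleChain.hom_ext fun v => ?_
      rw [LinearMap.comp_apply, tSd_of, LinearMap.comp_apply, tBoundary_tCone, ih,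
        tBoundary_tBoundary, map_zero, map_zero, add_zero]
    exact LinearMap.congr_fun this c

/-- The chain homotopy between barycentric subdivision and the identity. -/
def tHom (n : ℕ) : (k : ℕ) → TupleChain k n →ₗ[ZMod 2] TupleChain (k + 1) n
  | 0 => 0
  | k + 1 => Finsupp.linearCombination (ZMod 2) fun v =>
      tCone (k + 1) (bary v)
        (TupleChain.of v + tHom n k (tBoundary k n (TupleChain.of v)))

theorem tHom_of {n k : ℕ} (v : Tuple (k + 1) n) : tHom n (k + 1) (TupleChain.of v) =
    tCone (k + 1) (bary v) (TupleChain.of v + tHom n k (tBoundary k n (TupleChain.of v))) := by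
  rw [tHom, Finsupp.linearCombination_single, one_smul]

/-- From T v = b·(v + T∂v) one gets ∂T v = v + T∂v + b·(∂v + ∂T∂v). By induction the bracket is Sd
∂v, and b·Sd ∂v = Sd v. -/
theorem tBoundary_tHom {n : ℕ} (k : ℕ) (c : TupleChain (k + 1) n) :
    tBoundary (k + 1) n (tHom n (k + 1) c) + tHom n k (tBoundary k n c) =
      c + tSd n (k + 1) c := by
  induction k with
  | zero =>
    have : (tBoundary 1 n).comp (tHom n 1) + (tHom n 0).comp (tBoundary 0 n) =
        LinearMap.id + tSd n 1 := by
      refine TupleChain.hom_ext fun v => ?_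
      simp only [LinearMap.add_apply, LinearMap.comp_apply, LinearMap.id_apply]
      rw [tHom_of, tSd_of]
      simp only [tHom, tSd, LinearMap.zero_apply, add_zero, LinearMap.id_apply]
      rw [tBoundary_tCone]
    exact LinearMap.congr_fun this c
  | succ k ih =>
    have : (tBoundary (k + 2) n).comp (tHom n (k + 2)) + (tHom n (k + 1)).comp (tBoundary (k + 1) n)
        = LinearMap.id + tSd n (k + 2) := by
      refine TupleChain.hom_ext fun v => ?_
      simp only [LinearMap.add_apply, LinearMap.comp_apply, LinearMap.id_apply]
      rw [tHom_of, tSd_of, tBoundary_tCone, map_add]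
      have h := ih (tBoundary (k + 1) n (TupleChain.of v))
      rw [tBoundary_tBoundary, map_zero, add_zero] at h
      rw [h, ← add_assoc, ZModModule.add_self, zero_add, add_right_comm, add_assoc (TupleChain.of v),
        ZModModule.add_self, add_zero]
    exact LinearMap.congr_fun this c

/-- The effect of a map of vertices on affine chains. -/
def tMap (k : ℕ) {m n : ℕ} (g : Fin (m + 1) → Fin (n + 1)) :
    TupleChain k m →ₗ[ZMod 2] TupleChain k n :=
  Finsupp.lmapDomain (ZMod 2) (ZMod 2) fun (v : Tuple k m) i => stdSimplex.map g (v i)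

theorem tMap_of {k m n : ℕ} (g : Fin (m + 1) → Fin (n + 1)) (v : Tuple k m) :
    tMap k g (TupleChain.of v) = TupleChain.of fun i => stdSimplex.map g (v i) := by
  simp [tMap, Finsupp.lmapDomain_apply, Finsupp.mapDomain_single]

theorem tMap_tBoundary {k m n : ℕ} (g : Fin (m + 1) → Fin (n + 1)) (c : TupleChain (k + 1) m) :
    tMap k g (tBoundary k m c) = tBoundary k n (tMap (k + 1) g c) := by
  have : (tMap k g).comp (tBoundary k m) = (tBoundary k n).comp (tMap (k + 1) g) := by
    refine TupleChain.hom_ext fun v => ?_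
    simp only [LinearMap.comp_apply, tBoundary_of, map_sum, tMap_of]
    rfl
  exact LinearMap.congr_fun this c

theorem tMap_tCone {k m n : ℕ} (g : Fin (m + 1) → Fin (n + 1)) (b : Simplex m)
    (c : TupleChain k m) :
    tMap (k + 1) g (tCone k b c) = tCone k (stdSimplex.map g b) (tMap k g c) := by
  have : (tMap (k + 1) g).comp (tCone k b) = (tCone k (stdSimplex.map g b)).comp (tMap k g) := by
    refine TupleChain.hom_ext fun v => ?_
    simp only [LinearMap.comp_apply, tCone_of, tMap_of]
    congr 1
    funext i
    refine Fin.cases ?_ (fun j => ?_) i <;> simp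
  exact LinearMap.congr_fun this c

theorem map_bary {k m n : ℕ} (g : Fin (m + 1) → Fin (n + 1)) (v : Tuple k m) :
    stdSimplex.map g (bary v) = bary fun i => stdSimplex.map g (v i) := map_affineComb _ _ _

/-- Affine maps carry barycenters to barycenters. This compatibility with faces is what makes the
subdivision of the standard simplex induce a chain map on singular chains. -/
theorem tMap_tSd {m n : ℕ} (g : Fin (m + 1) → Fin (n + 1)) (k : ℕ) (c : TupleChain k m) :
    tMap k g (tSd m k c) = tSd n k (tMap k g c) := by
  induction k with
  | zero => rfl
  | succ k ih =>
    have : (tMap (k + 1) g).comp (tSd m (k + 1)) = (tSd n (k + 1)).comp (tMap (k + 1) g) := by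
      refine TupleChain.hom_ext fun v => ?_
      rw [LinearMap.comp_apply, LinearMap.comp_apply, tSd_of, tMap_tCone, ih, tMap_tBoundary,
        tMap_of, tSd_of, map_bary]
    exact LinearMap.congr_fun this c

theorem tMap_tHom {m n : ℕ} (g : Fin (m + 1) → Fin (n + 1)) (k : ℕ) (c : TupleChain k m) :
    tMap (k + 1) g (tHom m k c) = tHom n k (tMap k g c) := by
  induction k with
  | zero => simp [tHom]
  | succ k ih =>
    have : (tMap (k + 2) g).comp (tHom m (k + 1)) = (tHom n (k + 1)).comp (tMap (k + 1) g) := by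
      refine TupleChain.hom_ext fun v => ?_
      rw [LinearMap.comp_apply, LinearMap.comp_apply, tHom_of, tMap_tCone, map_add, ih,
        tMap_tBoundary, tMap_of, tHom_of, map_bary]
    exact LinearMap.congr_fun this c

/-- Iterated barycentric subdivision. -/
def tSdIter (n k : ℕ) : (m : ℕ) → TupleChain k n →ₗ[ZMod 2] TupleChain k n
  | 0 => LinearMap.id
  | m + 1 => (tSd n k).comp (tSdIter n k m)

/-- The chain homotopy between iterated barycentric subdivision and the identity. -/
def tHomIter (n k : ℕ) : (m : ℕ) → TupleChain k n →ₗ[ZMod 2] TupleChain (k + 1) n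
  | 0 => 0
  | m + 1 => tHomIter n k m + (tHom n k).comp (tSdIter n k m)

theorem tBoundary_tSdIter {n k : ℕ} (m : ℕ) (c : TupleChain (k + 1) n) :
    tBoundary k n (tSdIter n (k + 1) m c) = tSdIter n k m (tBoundary k n c) := by
  induction m with
  | zero => rfl
  | succ m ih =>
    simp only [tSdIter, LinearMap.comp_apply]
    rw [tBoundary_tSd, ih]

/-- The sum telescopes: the stage from m to m + 1 contributes T ∘ Sdᵐ. -/
theorem tBoundary_tHomIter {n k : ℕ} (m : ℕ) (c : TupleChain (k + 1) n) :
    tBoundary (k + 1) n (tHomIter n (k + 1) m c) + tHomIter n k m (tBoundary k n c) =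
      c + tSdIter n (k + 1) m c := by
  induction m with
  | zero => simp [tHomIter, tSdIter, ZModModule.add_self]
  | succ m ih =>
    simp only [tHomIter, tSdIter, LinearMap.comp_apply, LinearMap.add_apply, map_add]
    rw [add_add_add_comm, ih, ← tBoundary_tSdIter, tBoundary_tHom, add_assoc, ← add_assoc _ _
      (tSd n (k + 1) _), ZModModule.add_self, zero_add]

theorem tMap_tSdIter {p n : ℕ} (g : Fin (p + 1) → Fin (n + 1)) (k m : ℕ) (c : TupleChain k p) :
    tMap k g (tSdIter p k m c) = tSdIter n k m (tMap k g c) := by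
  induction m with
  | zero => rfl
  | succ m ih =>
    simp only [tSdIter, LinearMap.comp_apply]
    rw [tMap_tSd, ih]

theorem tMap_tHomIter {p n : ℕ} (g : Fin (p + 1) → Fin (n + 1)) (k m : ℕ) (c : TupleChain k p) :
    tMap (k + 1) g (tHomIter p k m c) = tHomIter n k m (tMap k g c) := by
  induction m with
  | zero => simp [tHomIter]
  | succ m ih =>
    simp only [tHomIter, LinearMap.comp_apply, LinearMap.add_apply, map_add]
    rw [tMap_tHom, ih, tMap_tSdIter]

/-! ### The mesh of iterated subdivisions -/

theorem dist_affineComb_le {k n : ℕ} (v : Tuple k n) (x : Simplex k) (y : Simplex n) {r : ℝ}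
    (h : ∀ j, dist y (v j) ≤ r) : dist y (affineComb v x) ≤ r := by
  have : (affineComb v x).1 ∈ Metric.closedBall y.1 r :=
    (convex_closedBall y.1 r).sum_mem (fun i _ => x.2.1 i) x.2.2 fun i _ => by
      rw [Metric.mem_closedBall, dist_comm]
      exact h i
  rw [Metric.mem_closedBall, dist_comm] at this
  exact this

/-- The vector from v j to the barycenter is the mean of the k + 1 vectors v i - v j, one of which
is zero. -/
theorem dist_bary_le {k n : ℕ} (v : Tuple k n) {D : ℝ}
    (h : ∀ i j, dist (v i) (v j) ≤ D) (j : Fin (k + 1)) :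
    dist (bary v) (v j) ≤ k / (k + 1) * D := by
  have hk : (0 : ℝ) < k + 1 := by positivity
  have e : (bary v).1 - (v j).1 = ∑ i, ((k : ℝ) + 1)⁻¹ • ((v i).1 - (v j).1) := by
    rw [← Finset.smul_sum, Finset.sum_sub_distrib, smul_sub]
    simp only [bary, affineComb, stdSimplex.barycenter_apply, Fintype.card_fin, Nat.cast_add,
      Nat.cast_one, Finset.sum_const, Finset.card_univ]
    rw [← Finset.smul_sum, ← Nat.cast_smul_eq_nsmul ℝ, smul_smul]
    congr 1
    push_cast
    rw [inv_mul_cancel₀ hk.ne', one_smul]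
  rw [Subtype.dist_eq, dist_eq_norm, e]
  refine (norm_sum_le _ _).trans ?_
  rw [← Finset.add_sum_erase _ _ (Finset.mem_univ j)]
  simp only [sub_self, smul_zero, norm_zero, zero_add]
  refine (Finset.sum_le_card_nsmul _ _ (((k : ℝ) + 1)⁻¹ * D) fun i _ => ?_).trans ?_
  · rw [norm_smul, Real.norm_of_nonneg (by positivity)]
    refine mul_le_mul_of_nonneg_left ?_ (by positivity)
    rw [← dist_eq_norm]
    exact h i j
  · rw [Finset.card_erase_of_mem (Finset.mem_univ _), Finset.card_univ, Fintype.card_fin,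
      Nat.add_sub_cancel, nsmul_eq_mul]
    exact le_of_eq (by ring)

/-- The simplices of the subdivision of `v` whose vertices satisfy the bounds in terms of those
of `v`. -/
def fineTuples {k n : ℕ} (v : Tuple k n) (D : ℝ) : Set (Tuple k n) :=
  {w | (∀ y r, (∀ j, dist y (v j) ≤ r) → ∀ i, dist y (w i) ≤ r) ∧
    ∀ i j, dist (w i) (w j) ≤ k / (k + 1) * D}

theorem tSd_mem_fineTuples {n : ℕ} (k : ℕ) (v : Tuple k n) {D : ℝ}
    (h : ∀ i j, dist (v i) (v j) ≤ D) :
    tSd n k (TupleChain.of v) ∈ Finsupp.supported (ZMod 2) (ZMod 2) (fineTuples v D) := by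
  have hD : 0 ≤ D := dist_nonneg.trans (h 0 0)
  induction k with
  | zero =>
    refine Finsupp.single_mem_supported _ _ ⟨fun y r hy i => hy i, fun i j => ?_⟩
    have hij : i = j := Fin.ext (by omega)
    subst hij
    simp
  | succ k ih =>
    rw [tSd_of, tBoundary_of, map_sum, map_sum]
    refine Submodule.sum_mem _ fun l _ => ?_
    have hl := ih (v ∘ l.succAbove) fun i j => h _ _
    suffices hsub : Finsupp.supported (ZMod 2) (ZMod 2) (fineTuples (v ∘ l.succAbove) D) ≤
        (Finsupp.supported (ZMod 2) (ZMod 2) (fineTuples v D)).comap (tCone k (bary v)) from hsub hl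
    rw [Finsupp.supported_eq_span_single, Submodule.span_le]
    rintro _ ⟨w, ⟨hw1, hw2⟩, rfl⟩
    change tCone k (bary v) (TupleChain.of w) ∈
      Finsupp.supported (ZMod 2) (ZMod 2) (fineTuples v D)
    rw [tCone_of]
    refine Finsupp.single_mem_supported _ _ ⟨fun y r hy i => ?_, fun i j => ?_⟩
    · refine Fin.cases ?_ (fun i => ?_) i
      · exact dist_affineComb_le v _ y hy
      · exact hw1 y r (fun j => hy _) i
    · have hb : ∀ i, dist (bary v) (w i) ≤ (k + 1 : ℕ) / ((k + 1 : ℕ) + 1) * D :=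
        hw1 _ _ fun j => dist_bary_le v h _
      have hpos : (0 : ℝ) ≤ (k + 1 : ℕ) / ((k + 1 : ℕ) + 1) * D := by positivity
      refine Fin.cases ?_ (fun i => ?_) i <;> refine Fin.cases ?_ (fun j => ?_) j
      · simpa using hpos
      · exact hb j
      · rw [dist_comm]; exact hb i
      -- Faces shrink by k/(k+1), which is at most (k+1)/(k+2).
      · refine (hw2 i j).trans (mul_le_mul_of_nonneg_right ?_ hD)
        push_cast
        rw [div_le_div_iff₀ (by positivity) (by positivity)]
        ring_nf
        linarith

/-- Affine simplices whose vertices have mutual distance at most `D`. -/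
def smallTuples (k n : ℕ) (D : ℝ) : Set (Tuple k n) := {v | ∀ i j, dist (v i) (v j) ≤ D}

theorem tSd_mem_smallTuples {n k : ℕ} {D : ℝ} {c : TupleChain k n}
    (hc : c ∈ Finsupp.supported (ZMod 2) (ZMod 2) (smallTuples k n D)) :
    tSd n k c ∈ Finsupp.supported (ZMod 2) (ZMod 2) (smallTuples k n (k / (k + 1) * D)) := by
  suffices hsub : Finsupp.supported (ZMod 2) (ZMod 2) (smallTuples k n D) ≤
      (Finsupp.supported (ZMod 2) (ZMod 2) (smallTuples k n (k / (k + 1) * D))).comap (tSd n k) from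
    hsub hc
  rw [Finsupp.supported_eq_span_single, Submodule.span_le]
  rintro _ ⟨v, hv, rfl⟩
  exact Finsupp.supported_mono (fun w hw => hw.2) (tSd_mem_fineTuples k v hv)

theorem tSdIter_mem_smallTuples {n k : ℕ} {D : ℝ} (m : ℕ) {c : TupleChain k n}
    (hc : c ∈ Finsupp.supported (ZMod 2) (ZMod 2) (smallTuples k n D)) :
    tSdIter n k m c ∈
      Finsupp.supported (ZMod 2) (ZMod 2) (smallTuples k n ((k / (k + 1)) ^ m * D)) := by
  induction m with
  | zero => simpa [tSdIter] using hc
  | succ m ih =>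
    have := tSd_mem_smallTuples ih
    rw [pow_succ', mul_assoc]
    exact this

end Subdivision

/-! ### Subdivision of singular chains -/

section SingularSubdivision

variable {X : Type*} [TopologicalSpace X]

/-- The restriction of a singular simplex to an affine simplex in its domain. -/
def SingularSimplex.onTuple {k n : ℕ} (σ : SingularSimplex n X) (v : Tuple k n) :
    SingularSimplex k X :=
  σ.comp ⟨affineComb v, continuous_affineComb v⟩

/-- The restriction of a singular simplex to an affine chain in its domain. -/
def onTuples (k : ℕ) {n : ℕ} (σ : SingularSimplex n X) : TupleChain k n →ₗ[ZMod 2] Chain k X :=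
  Finsupp.lmapDomain (ZMod 2) (ZMod 2) σ.onTuple

theorem onTuples_of {k n : ℕ} (σ : SingularSimplex n X) (v : Tuple k n) :
    onTuples k σ (TupleChain.of v) = Chain.of (σ.onTuple v) := by
  simp [onTuples, Finsupp.lmapDomain_apply, Finsupp.mapDomain_single]

theorem boundary_onTuples {k n : ℕ} (σ : SingularSimplex n X) (c : TupleChain (k + 1) n) :
    boundary k X (onTuples (k + 1) σ c) = onTuples k σ (tBoundary k n c) := by
  have : (boundary k X).comp (onTuples (k + 1) σ) = (onTuples k σ).comp (tBoundary k n) := by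
    refine TupleChain.hom_ext fun v => ?_
    simp only [LinearMap.comp_apply, onTuples_of, boundary_of, tBoundary_of, map_sum]
    refine Finset.sum_congr rfl fun i _ => ?_
    congr 1
    ext x
    exact congrArg σ (affineComb_map v i.succAbove x)
  exact LinearMap.congr_fun this c

theorem onTuples_face {k m n : ℕ} (σ : SingularSimplex n X) (g : Fin (m + 1) → Fin (n + 1))
    (c : TupleChain k m) : onTuples k (σ.face g) c = onTuples k σ (tMap k g c) := by
  have : onTuples k (σ.face g) = (onTuples k σ).comp (tMap k g) := by
    refine TupleChain.hom_ext fun v => ?_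
    simp only [LinearMap.comp_apply, onTuples_of, tMap_of]
    congr 1
    ext x
    exact congrArg σ (map_affineComb g v x)
  exact LinearMap.congr_fun this c

theorem onTuples_mem {k n : ℕ} {σ : SingularSimplex n X} {A : Set X} (hσ : Set.range σ ⊆ A)
    (c : TupleChain k n) : onTuples k σ c ∈ chainsIn k A := by
  induction c using Finsupp.induction_linear with
  | zero => simp
  | add f g hf hg => rw [map_add]; exact Submodule.add_mem _ hf hg
  | single v a =>
    rw [← mul_one a, ← smul_eq_mul, ← Finsupp.smul_single, map_smul, onTuples_of]
    refine Submodule.smul_mem _ _ (of_mem_chainsIn ?_)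
    rintro _ ⟨x, rfl⟩
    exact hσ ⟨_, rfl⟩

/-- The tautological affine simplex. -/
def vertices (n : ℕ) : Tuple n n := fun i => stdSimplex.vertex i

theorem onTuples_vertices {n : ℕ} (σ : SingularSimplex n X) :
    onTuples n σ (TupleChain.of (vertices n)) = Chain.of σ := by
  rw [onTuples_of]
  congr 1
  ext x
  exact congrArg σ (affineComb_vertex x)

theorem tBoundary_vertices (n : ℕ) : tBoundary n (n + 1) (TupleChain.of (vertices (n + 1))) =
    ∑ i : Fin (n + 2), tMap n i.succAbove (TupleChain.of (vertices n)) := by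
  rw [tBoundary_of]
  refine Finset.sum_congr rfl fun i _ => ?_
  rw [tMap_of]
  congr 1
  funext j
  exact (stdSimplex.map_vertex i.succAbove j).symm

/-- The `m`-fold subdivision of singular chains. -/
def sdOp (n m : ℕ) (X : Type*) [TopologicalSpace X] : Chain n X →ₗ[ZMod 2] Chain n X :=
  Finsupp.linearCombination (ZMod 2) fun σ =>
    onTuples n σ (tSdIter n n m (TupleChain.of (vertices n)))

/-- The chain homotopy between the `m`-fold subdivision and the identity. -/
def sdHom (n m : ℕ) (X : Type*) [TopologicalSpace X] : Chain n X →ₗ[ZMod 2] Chain (n + 1) X :=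
  Finsupp.linearCombination (ZMod 2) fun σ =>
    onTuples (n + 1) σ (tHomIter n n m (TupleChain.of (vertices n)))

theorem sdOp_of {n m : ℕ} (σ : SingularSimplex n X) : sdOp n m X (Chain.of σ) =
    onTuples n σ (tSdIter n n m (TupleChain.of (vertices n))) := by
  rw [sdOp, Finsupp.linearCombination_single, one_smul]

theorem sdHom_of {n m : ℕ} (σ : SingularSimplex n X) : sdHom n m X (Chain.of σ) =
    onTuples (n + 1) σ (tHomIter n n m (TupleChain.of (vertices n))) := by
  rw [sdHom, Finsupp.linearCombination_single, one_smul]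

theorem boundary_sdOp {n m : ℕ} (c : Chain (n + 1) X) :
    boundary n X (sdOp (n + 1) m X c) = sdOp n m X (boundary n X c) := by
  have : (boundary n X).comp (sdOp (n + 1) m X) = (sdOp n m X).comp (boundary n X) := by
    refine Chain.hom_ext fun σ => ?_
    simp only [LinearMap.comp_apply, sdOp_of, boundary_of, map_sum]
    rw [boundary_onTuples, tBoundary_tSdIter, tBoundary_vertices, map_sum, map_sum]
    refine Finset.sum_congr rfl fun i _ => ?_
    rw [onTuples_face, tMap_tSdIter]
  exact LinearMap.congr_fun this c

theorem boundary_sdHom {n m : ℕ} (c : Chain (n + 1) X) :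
    boundary (n + 1) X (sdHom (n + 1) m X c) + sdHom n m X (boundary n X c) =
      c + sdOp (n + 1) m X c := by
  have : (boundary (n + 1) X).comp (sdHom (n + 1) m X) + (sdHom n m X).comp (boundary n X) =
      LinearMap.id + sdOp (n + 1) m X := by
    refine Chain.hom_ext fun σ => ?_
    simp only [LinearMap.comp_apply, LinearMap.add_apply, LinearMap.id_apply, sdHom_of, sdOp_of,
      boundary_of, map_sum]
    have h : ∑ i : Fin (n + 2), onTuples (n + 1) (σ.face i.succAbove)
        (tHomIter n n m (TupleChain.of (vertices n))) =
        onTuples (n + 1) σ (tHomIter (n + 1) n m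
          (tBoundary n (n + 1) (TupleChain.of (vertices (n + 1))))) := by
      rw [tBoundary_vertices, map_sum, map_sum]
      refine Finset.sum_congr rfl fun i _ => ?_
      rw [onTuples_face, tMap_tHomIter]
    rw [h, boundary_onTuples, ← map_add, tBoundary_tHomIter, map_add, onTuples_vertices]
  exact LinearMap.congr_fun this c

theorem sdOp_mem {n m : ℕ} {A : Set X} {c : Chain n X} (hc : c ∈ chainsIn n A) :
    sdOp n m X c ∈ chainsIn n A := by
  refine map_mem_of_chainsIn _ _ (fun σ hσ => ?_) hc
  rw [sdOp_of]
  exact onTuples_mem hσ _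

theorem sdHom_mem {n m : ℕ} {A : Set X} {c : Chain n X} (hc : c ∈ chainsIn n A) :
    sdHom n m X c ∈ chainsIn (n + 1) A := by
  refine map_mem_of_chainsIn _ _ (fun σ hσ => ?_) hc
  rw [sdHom_of]
  exact onTuples_mem hσ _

/-- The preimages of A and B cover the compact simplex and have a Lebesgue number δ, while the mesh
(n/(n+1))ᵐ D tends to zero. Having this for all large m allows one m to serve all simplices of a
chain. -/
theorem eventually_sdOp_of_mem {n : ℕ} {A B : Set X} (hA : IsOpen A) (hB : IsOpen B)
    {σ : SingularSimplex n X} (hσ : Set.range σ ⊆ A ∪ B) :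
    ∀ᶠ m in Filter.atTop, sdOp n m X (Chain.of σ) ∈ chainsIn n A ⊔ chainsIn n B := by
  obtain ⟨δ, hδ, hleb⟩ := lebesgue_number_lemma_of_metric (s := (Set.univ : Set (Simplex n)))
    (c := fun b : Bool => σ ⁻¹' (if b then A else B)) isCompact_univ
    (fun b => by cases b <;> simp [hA.preimage σ.continuous, hB.preimage σ.continuous])
    (fun x _ => by
      rcases hσ ⟨x, rfl⟩ with h | h
      · exact Set.mem_iUnion.2 ⟨true, by simpa using h⟩
      · exact Set.mem_iUnion.2 ⟨false, by simpa using h⟩)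
  obtain ⟨D, hD⟩ : ∃ D, ∀ i j, dist (vertices n i) (vertices n j) ≤ D := by
    obtain ⟨D, hD⟩ := (Set.finite_range fun p : Fin (n + 1) × Fin (n + 1) =>
      dist (vertices n p.1) (vertices n p.2)).bddAbove
    exact ⟨D, fun i j => hD ⟨(i, j), rfl⟩⟩
  have hlim : Filter.Tendsto (fun m : ℕ => ((n : ℝ) / (n + 1)) ^ m * D) Filter.atTop (𝓝 (0 * D)) :=
    (tendsto_pow_atTop_nhds_zero_of_lt_one (by positivity)
      ((div_lt_one (by positivity)).2 (by linarith))).mul_const D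
  rw [zero_mul] at hlim
  filter_upwards [hlim.eventually (gt_mem_nhds hδ)] with m hm
  have hsmall := tSdIter_mem_smallTuples (k := n) (n := n) (D := D) m
    (Finsupp.single_mem_supported (ZMod 2) (1 : ZMod 2) (a := vertices n) hD)
  rw [sdOp_of]
  suffices hsub : Finsupp.supported (ZMod 2) (ZMod 2) (smallTuples n n ((n / (n + 1)) ^ m * D)) ≤
      (chainsIn n A ⊔ chainsIn n B).comap (onTuples n σ) from hsub hsmall
  rw [Finsupp.supported_eq_span_single, Submodule.span_le]
  rintro _ ⟨w, hw, rfl⟩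
  change onTuples n σ (TupleChain.of w) ∈ chainsIn n A ⊔ chainsIn n B
  rw [onTuples_of]
  have hball : ∀ x, affineComb w x ∈ Metric.ball (w 0) δ := fun x => by
    rw [Metric.mem_ball, dist_comm]
    exact (dist_affineComb_le w x (w 0) fun j => hw 0 j).trans_lt hm
  obtain ⟨b, hb⟩ := hleb (w 0) (Set.mem_univ _)
  cases b
  · refine Submodule.mem_sup_right (of_mem_chainsIn ?_)
    rintro _ ⟨x, rfl⟩
    have h := hb (hball x)
    simp only [Set.mem_preimage, Bool.false_eq_true, if_false] at h
    exact h
  · refine Submodule.mem_sup_left (of_mem_chainsIn ?_)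
    rintro _ ⟨x, rfl⟩
    have h := hb (hball x)
    simp only [Set.mem_preimage, if_true] at h
    exact h

/-- Sufficiently fine subdivisions of a chain in `A ∪ B` are sums of a chain in `A` and one
in `B`. -/
theorem exists_sdOp_eq_add {n : ℕ} {A B : Set X} (hA : IsOpen A) (hB : IsOpen B)
    {c : Chain n X} (hc : c ∈ chainsIn n (A ∪ B)) :
    ∃ m, ∃ a ∈ chainsIn n A, ∃ b ∈ chainsIn n B, sdOp n m X c = a + b := by
  have key : ∀ᶠ m in Filter.atTop, sdOp n m X c ∈ chainsIn n A ⊔ chainsIn n B := by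
    rw [chainsIn_eq_span] at hc
    induction hc using Submodule.span_induction with
    | mem x hx =>
      obtain ⟨σ, hσ, rfl⟩ := hx
      exact eventually_sdOp_of_mem hA hB hσ
    | zero => simp
    | add x y _ _ hx hy =>
      filter_upwards [hx, hy] with m h1 h2
      rw [map_add]
      exact Submodule.add_mem _ h1 h2
    | smul a x _ hx =>
      filter_upwards [hx] with m h1
      rw [map_smul]
      exact Submodule.smul_mem _ _ h1
  obtain ⟨m, hm⟩ := key.exists
  obtain ⟨a, ha, b, hb, hab⟩ := Submodule.mem_sup.1 hm
  exact ⟨m, a, ha, b, hb, hab.symm⟩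

end SingularSubdivision

/-! ### A Mayer–Vietoris argument -/

section MayerVietoris

theorem eq_of_add_eq_zero {V : Type*} [AddCommGroup V] [Module (ZMod 2) V] {a b : V}
    (h : a + b = 0) : a = b := by
  rw [eq_neg_of_add_eq_zero_left h, ZModModule.neg_eq_self]

theorem add_add_cancel_two {V : Type*} [AddCommGroup V] [Module (ZMod 2) V] (a b c : V) :
    a + (b + c) + b + c = a := by
  rw [add_assoc, add_assoc, ZModModule.add_self, add_zero]

variable {X : Type*} [TopologicalSpace X]

/-- The chain `c` is the boundary of a chain in `A`. -/
def BoundsIn (n : ℕ) (A : Set X) (c : Chain n X) : Prop :=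
  ∃ w ∈ chainsIn (n + 1) A, boundary n X w = c

theorem BoundsIn.add {n : ℕ} {A : Set X} {c d : Chain n X} (hc : BoundsIn n A c)
    (hd : BoundsIn n A d) : BoundsIn n A (c + d) := by
  obtain ⟨v, hv, rfl⟩ := hc
  obtain ⟨w, hw, rfl⟩ := hd
  exact ⟨v + w, Submodule.add_mem _ hv hw, map_add _ _ _⟩

theorem BoundsIn.of_add {n : ℕ} {A : Set X} {c d : Chain n X} (hcd : BoundsIn n A (c + d))
    (hd : BoundsIn n A d) : BoundsIn n A c := by
  have := hcd.add hd
  rwa [add_assoc, Chain.add_self, add_zero] at this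

theorem BoundsIn.mono {n : ℕ} {A B : Set X} (h : A ⊆ B) {c : Chain n X} (hc : BoundsIn n A c) :
    BoundsIn n B c := by
  obtain ⟨v, hv, rfl⟩ := hc
  exact ⟨v, chainsIn_mono h hv, rfl⟩

/-- A fine subdivision of a cycle splits, and `sdHom` exhibits it as homologous to the cycle inside
A ∪ B. Modulo two the pieces have equal boundaries because their sum is a cycle. -/
theorem exists_split_cycle {n : ℕ} {A B : Set X} (hA : IsOpen A) (hB : IsOpen B)
    {c : Chain (n + 1) X} (hc : c ∈ chainsIn (n + 1) (A ∪ B)) (h : boundary n X c = 0) :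
    ∃ a ∈ chainsIn (n + 1) A, ∃ b ∈ chainsIn (n + 1) B, BoundsIn (n + 1) (A ∪ B) (c + (a + b)) ∧
      boundary n X a = boundary n X b := by
  obtain ⟨m, a, ha, b, hb, hab⟩ := exists_sdOp_eq_add hA hB hc
  refine ⟨a, ha, b, hb, ⟨sdHom (n + 1) m X c, sdHom_mem hc, ?_⟩, ?_⟩
  · have := boundary_sdHom (m := m) c
    rw [h, map_zero, add_zero] at this
    rw [this, hab]
  · have : boundary n X (a + b) = 0 := by rw [← hab, boundary_sdOp, h, map_zero]
    rw [map_add] at this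
    exact eq_of_add_eq_zero this

/-- Closing a and b by the same filling w of their common boundary gives cycles in A and in B, and w
cancels in the sum. -/
theorem boundsIn_add_of_boundary {n : ℕ} {A B : Set X}
    (hA : ∀ c ∈ chainsIn (n + 1) A, boundary n X c = 0 → BoundsIn (n + 1) A c)
    (hB : ∀ c ∈ chainsIn (n + 1) B, boundary n X c = 0 → BoundsIn (n + 1) B c)
    {a b : Chain (n + 1) X} (ha : a ∈ chainsIn (n + 1) A) (hb : b ∈ chainsIn (n + 1) B)
    (hab : boundary n X a = boundary n X b) (h : BoundsIn n (A ∩ B) (boundary n X a)) :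
    BoundsIn (n + 1) (A ∪ B) (a + b) := by
  obtain ⟨w, hw, hwa⟩ := h
  have h1 := hA (a + w) (Submodule.add_mem _ ha (chainsIn_mono Set.inter_subset_left hw))
    (by rw [map_add, hwa, ZModModule.add_self])
  have h2 := hB (b + w) (Submodule.add_mem _ hb (chainsIn_mono Set.inter_subset_right hw))
    (by rw [map_add, hwa, hab, ZModModule.add_self])
  have := (h1.mono Set.subset_union_left).add (h2.mono (Set.subset_union_right (s := A)))
  rwa [add_add_add_comm, ZModModule.add_self w, add_zero] at this

/-- If cycles in `A` and in `B` bound, and there is at most one nontrivial class in `A ∩ B`, then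
there is at most one nontrivial class in `A ∪ B`. -/
theorem mayerVietoris {n : ℕ} {A B : Set X} (hAo : IsOpen A) (hBo : IsOpen B)
    (hA : ∀ c ∈ chainsIn (n + 1) A, boundary n X c = 0 → BoundsIn (n + 1) A c)
    (hB : ∀ c ∈ chainsIn (n + 1) B, boundary n X c = 0 → BoundsIn (n + 1) B c)
    (hAB : ∀ a₁ a₂ : Chain (n + 1) X, boundary n X a₁ ∈ chainsIn n (A ∩ B) →
      boundary n X a₂ ∈ chainsIn n (A ∩ B) → BoundsIn n (A ∩ B) (boundary n X a₁) ∨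
      BoundsIn n (A ∩ B) (boundary n X a₂) ∨
      BoundsIn n (A ∩ B) (boundary n X a₁ + boundary n X a₂))
    {c₁ c₂ : Chain (n + 1) X} (hc₁ : c₁ ∈ chainsIn (n + 1) (A ∪ B))
    (hc₂ : c₂ ∈ chainsIn (n + 1) (A ∪ B)) (h₁ : boundary n X c₁ = 0) (h₂ : boundary n X c₂ = 0) :
    BoundsIn (n + 1) (A ∪ B) c₁ ∨ BoundsIn (n + 1) (A ∪ B) c₂ ∨
      BoundsIn (n + 1) (A ∪ B) (c₁ + c₂) := by
  obtain ⟨a₁, ha₁, b₁, hb₁, hs₁, hab₁⟩ := exists_split_cycle hAo hBo hc₁ h₁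
  obtain ⟨a₂, ha₂, b₂, hb₂, hs₂, hab₂⟩ := exists_split_cycle hAo hBo hc₂ h₂
  have m₁ : boundary n X a₁ ∈ chainsIn n (A ∩ B) :=
    mem_chainsIn_inter (boundary_mem_chainsIn ha₁) (hab₁ ▸ boundary_mem_chainsIn hb₁)
  have m₂ : boundary n X a₂ ∈ chainsIn n (A ∩ B) :=
    mem_chainsIn_inter (boundary_mem_chainsIn ha₂) (hab₂ ▸ boundary_mem_chainsIn hb₂)
  -- A cycle in A ∪ B bounds as soon as the boundary of its piece in A bounds in A ∩ B, so the
  -- alternative passes from A ∩ B to A ∪ B.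
  rcases hAB a₁ a₂ m₁ m₂ with h | h | h
  · left
    exact hs₁.of_add (boundsIn_add_of_boundary hA hB ha₁ hb₁ hab₁ h)
  · right; left
    exact hs₂.of_add (boundsIn_add_of_boundary hA hB ha₂ hb₂ hab₂ h)
  · right; right
    have h3 := boundsIn_add_of_boundary hA hB (Submodule.add_mem _ ha₁ ha₂)
      (Submodule.add_mem _ hb₁ hb₂) (by rw [map_add, map_add, hab₁, hab₂]) (by rwa [map_add])
    have h4 := hs₁.add hs₂
    have e : c₁ + (a₁ + b₁) + (c₂ + (a₂ + b₂)) = (c₁ + c₂) + (a₁ + a₂ + (b₁ + b₂)) := by abel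
    rw [e] at h4
    exact h4.of_add h3

/-- Chains in a disjoint union of open sets split. -/
theorem exists_add_of_mem_chainsIn_union {n : ℕ} {P Q : Set X} (hP : IsOpen P) (hQ : IsOpen Q)
    (hPQ : Disjoint P Q) {c : Chain n X} (hc : c ∈ chainsIn n (P ∪ Q)) :
    ∃ p ∈ chainsIn n P, ∃ q ∈ chainsIn n Q, c = p + q := by
  have : c ∈ chainsIn n P ⊔ chainsIn n Q := by
    refine map_mem_of_chainsIn LinearMap.id _ (fun σ hσ => ?_) hc
    have hconn : IsPreconnected (Set.range σ) := isPreconnected_range σ.continuous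
    rcases hconn.subset_or_subset hP hQ hPQ hσ with h | h
    · exact Submodule.mem_sup_left (of_mem_chainsIn h)
    · exact Submodule.mem_sup_right (of_mem_chainsIn h)
  obtain ⟨a, ha, b, hb, hab⟩ := Submodule.mem_sup.1 this
  exact ⟨a, ha, b, hb, hab.symm⟩

end MayerVietoris

/-! ### The homology of punctured Euclidean space -/

section PuncturedSpace

/-- A 0-chain of augmentation zero on P ⊔ Q bounds once its part in P has even augmentation. If both
parts in P are odd, their sum is even. -/
theorem boundsIn_two_components {E : Type*} [NormedAddCommGroup E] [NormedSpace ℝ E] {P Q : Set E}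
    (hP : IsOpen P) (hQ : IsOpen Q) (hPQ : Disjoint P Q) {x y : E} (hx : StarConvex ℝ x P)
    (hy : StarConvex ℝ y Q) {u₁ u₂ : Chain 0 E} (h₁ : u₁ ∈ chainsIn 0 (P ∪ Q))
    (h₂ : u₂ ∈ chainsIn 0 (P ∪ Q)) (e₁ : augmentation E u₁ = 0) (e₂ : augmentation E u₂ = 0) :
    BoundsIn 0 (P ∪ Q) u₁ ∨ BoundsIn 0 (P ∪ Q) u₂ ∨ BoundsIn 0 (P ∪ Q) (u₁ + u₂) := by
  obtain ⟨p₁, hp₁, q₁, hq₁, rfl⟩ := exists_add_of_mem_chainsIn_union hP hQ hPQ h₁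
  obtain ⟨p₂, hp₂, q₂, hq₂, rfl⟩ := exists_add_of_mem_chainsIn_union hP hQ hPQ h₂
  have key : ∀ p ∈ chainsIn 0 P, ∀ q ∈ chainsIn 0 Q, augmentation E (p + q) = 0 →
      augmentation E p = 0 → BoundsIn 0 (P ∪ Q) (p + q) := by
    intro p hp q hq hpq hp0
    have hq0 : augmentation E q = 0 := by rwa [map_add, hp0, zero_add] at hpq
    have h1 : BoundsIn 0 P p := exists_boundary_of_starConvex_zero hx hp hp0
    have h2 : BoundsIn 0 Q q := exists_boundary_of_starConvex_zero hy hq hq0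
    exact (h1.mono Set.subset_union_left).add (h2.mono Set.subset_union_right)
  have h2 : ∀ a : ZMod 2, a = 0 ∨ a = 1 := by decide
  rcases h2 (augmentation E p₁) with h | h
  · exact Or.inl (key _ hp₁ _ hq₁ e₁ h)
  rcases h2 (augmentation E p₂) with h' | h'
  · exact Or.inr (Or.inl (key _ hp₂ _ hq₂ e₂ h'))
  · refine Or.inr (Or.inr ?_)
    have e : p₁ + q₁ + (p₂ + q₂) = (p₁ + p₂) + (q₁ + q₂) := by abel
    rw [e]
    refine key _ (Submodule.add_mem _ hp₁ hp₂) _ (Submodule.add_mem _ hq₁ hq₂) ?_ ?_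
    · rw [← e, map_add, e₁, e₂, add_zero]
    · rw [map_add, h, h']; decide

theorem continuous_coordE3 (i : Fin 3) : Continuous fun x : E3 => x i := by fun_prop

/-- The union of the complement of the hyperplane `x₀ = 0` and a half-space is star-shaped. -/
theorem starConvex_plane (s : ℝ) (hs : s ≠ 0) :
    StarConvex ℝ (!₂[0, s, 0] : E3) {x : E3 | x 0 ≠ 0 ∨ 0 < s * x 1} := by
  intro x hx a b ha hb hab
  have hs2 : 0 < s * s := mul_self_pos.2 hs
  rcases hb.eq_or_lt with rfl | hb
  · right
    have : a = 1 := by linarith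
    simpa [this] using hs2
  · rcases hx with hx | hx
    · left
      simpa [hx] using hb.ne'
    · right
      have h1 := mul_pos hb hx
      have h2 := mul_nonneg ha hs2.le
      simp
      nlinarith

/-- The set is the complement of a closed ray of the third axis, viewed from a point of the opposite
ray. -/
theorem starConvex_ray (s : ℝ) (hs : s ≠ 0) :
    StarConvex ℝ (!₂[0, 0, s] : E3) {x : E3 | (x 0 ≠ 0 ∨ x 1 ≠ 0) ∨ 0 < s * x 2} := by
  intro x hx a b ha hb hab
  have hs2 : 0 < s * s := mul_self_pos.2 hs
  rcases hb.eq_or_lt with rfl | hb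
  · right
    have : a = 1 := by linarith
    simpa [this] using hs2
  · rcases hx with hx | hx
    · left
      simpa [hb.ne'] using hx
    · right
      have h1 := mul_pos hb hx
      have h2 := mul_nonneg ha hs2.le
      simp
      nlinarith

theorem isOpen_coord_ne (i : Fin 3) : IsOpen {x : E3 | x i ≠ 0} :=
  isOpen_ne_fun (continuous_coordE3 i) continuous_const

theorem isOpen_coord_mul_pos (s : ℝ) (i : Fin 3) : IsOpen {x : E3 | 0 < s * x i} :=
  isOpen_lt continuous_const (continuous_const.mul (continuous_coordE3 i))

/-- There is at most one nontrivial `1`-dimensional class in the complement of a line. -/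
theorem boundsIn_compl_line {c₁ c₂ : Chain 1 E3}
    (hc₁ : c₁ ∈ chainsIn 1 {x : E3 | x 0 ≠ 0 ∨ x 1 ≠ 0})
    (hc₂ : c₂ ∈ chainsIn 1 {x : E3 | x 0 ≠ 0 ∨ x 1 ≠ 0}) (h₁ : boundary 0 E3 c₁ = 0)
    (h₂ : boundary 0 E3 c₂ = 0) :
    BoundsIn 1 {x : E3 | x 0 ≠ 0 ∨ x 1 ≠ 0} c₁ ∨ BoundsIn 1 {x : E3 | x 0 ≠ 0 ∨ x 1 ≠ 0} c₂ ∨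
      BoundsIn 1 {x : E3 | x 0 ≠ 0 ∨ x 1 ≠ 0} (c₁ + c₂) := by
  -- A and B are the complements of the two closed halves of the plane x₀ = 0 bounded by the line;
  -- they meet in two open half-spaces.
  set A : Set E3 := {x | x 0 ≠ 0 ∨ 0 < (1 : ℝ) * x 1}
  set B : Set E3 := {x | x 0 ≠ 0 ∨ 0 < (-1 : ℝ) * x 1}
  have hU : {x : E3 | x 0 ≠ 0 ∨ x 1 ≠ 0} = A ∪ B := by
    ext x
    simp only [Set.mem_ofPred_eq, Set.mem_union, A, B, one_mul, neg_mul, ne_iff_lt_or_gt (a := x 1)]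
    constructor
    · rintro (h | h | h)
      · exact Or.inl (Or.inl h)
      · exact Or.inr (Or.inr (by linarith))
      · exact Or.inl (Or.inr h)
    · rintro ((h | h) | (h | h))
      · exact Or.inl h
      · exact Or.inr (Or.inr h)
      · exact Or.inl h
      · exact Or.inr (Or.inl (by linarith))
  set P : Set E3 := {x | 0 < (1 : ℝ) * x 0}
  set Q : Set E3 := {x | 0 < (-1 : ℝ) * x 0}
  have hI : A ∩ B = P ∪ Q := by
    ext x
    simp only [Set.mem_ofPred_eq, Set.mem_union, Set.mem_inter_iff, A, B, P, Q, one_mul, neg_mul,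
      ne_iff_lt_or_gt (a := x 0)]
    constructor
    · rintro ⟨(h | h) | h, (h' | h') | h'⟩ <;>
        first | (left; linarith) | (right; linarith)
    · rintro (h | h)
      · exact ⟨Or.inl (Or.inr h), Or.inl (Or.inr h)⟩
      · exact ⟨Or.inl (Or.inl (by linarith)), Or.inl (Or.inl (by linarith))⟩
  have hPc : ∀ s : ℝ, s ≠ 0 → StarConvex ℝ (!₂[s, 0, 0] : E3) {x : E3 | 0 < s * x 0} := by
    intro s hs x hx a b ha hb hab
    have hs2 : 0 < s * s := mul_self_pos.2 hs
    have hx' : 0 < s * x 0 := hx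
    simp only [Set.mem_ofPred_eq]
    simp
    rcases hb.eq_or_lt with rfl | hb
    · have : a = 1 := by linarith
      subst this
      linarith
    · nlinarith [mul_pos hb hx', mul_nonneg ha hs2.le]
  rw [hU] at hc₁ hc₂ ⊢
  refine mayerVietoris (A := A) (B := B) ((isOpen_coord_ne 0).union (isOpen_coord_mul_pos 1 1))
    ((isOpen_coord_ne 0).union (isOpen_coord_mul_pos (-1) 1))
    (fun c hc h => exists_boundary_of_starConvex (starConvex_plane 1 one_ne_zero) hc h)
    (fun c hc h => exists_boundary_of_starConvex
      (starConvex_plane (-1) (neg_ne_zero.2 one_ne_zero)) hc h) ?_ hc₁ hc₂ h₁ h₂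
  intro a₁ a₂ m₁ m₂
  rw [hI] at m₁ m₂ ⊢
  -- `mayerVietoris` tests only boundaries on the intersection, which in degree zero makes the
  -- augmentation vanish.
  refine boundsIn_two_components (isOpen_coord_mul_pos 1 0) (isOpen_coord_mul_pos (-1) 0) ?_
    (hPc 1 one_ne_zero) (hPc (-1) (neg_ne_zero.2 one_ne_zero)) m₁ m₂ (augmentation_boundary _)
    (augmentation_boundary _)
  rw [Set.disjoint_left]
  intro x h h'
  simp only [Set.mem_ofPred_eq] at h h'
  linarith

/-- There is at most one nontrivial `2`-dimensional class in punctured space. -/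
theorem boundsIn_punctured {c₁ c₂ : Chain 2 E3}
    (hc₁ : c₁ ∈ chainsIn 2 ({0}ᶜ : Set E3)) (hc₂ : c₂ ∈ chainsIn 2 ({0}ᶜ : Set E3))
    (h₁ : boundary 1 E3 c₁ = 0) (h₂ : boundary 1 E3 c₂ = 0) :
    BoundsIn 2 ({0}ᶜ : Set E3) c₁ ∨ BoundsIn 2 ({0}ᶜ : Set E3) c₂ ∨
      BoundsIn 2 ({0}ᶜ : Set E3) (c₁ + c₂) := by
  -- A and B are the complements of two opposite closed rays of the third axis; they meet in the
  -- complement of the axis.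
  set A : Set E3 := {x | (x 0 ≠ 0 ∨ x 1 ≠ 0) ∨ 0 < (1 : ℝ) * x 2}
  set B : Set E3 := {x | (x 0 ≠ 0 ∨ x 1 ≠ 0) ∨ 0 < (-1 : ℝ) * x 2}
  have hU : ({0}ᶜ : Set E3) = A ∪ B := by
    ext x
    have hx : x = 0 ↔ x 0 = 0 ∧ x 1 = 0 ∧ x 2 = 0 := by
      constructor
      · rintro rfl; simp
      · rintro ⟨h0, h1, h2⟩
        ext i
        fin_cases i <;> simp [h0, h1, h2]
    simp only [Set.mem_compl_iff, Set.mem_singleton_iff, Set.mem_ofPred_eq, Set.mem_union, A, B,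
      one_mul, neg_mul, hx]
    constructor
    · intro h
      by_cases h0 : x 0 = 0
      · by_cases h1 : x 1 = 0
        · rcases lt_or_gt_of_ne (fun h2 => h ⟨h0, h1, h2⟩) with h2 | h2
          · exact Or.inr (Or.inr (by linarith))
          · exact Or.inl (Or.inr h2)
        · exact Or.inl (Or.inl (Or.inr h1))
      · exact Or.inl (Or.inl (Or.inl h0))
    · rintro (((h | h) | h) | ((h | h) | h)) ⟨h0, h1, h2⟩
      · exact h h0
      · exact h h1
      · linarith
      · exact h h0
      · exact h h1
      · linarith
  have hI : A ∩ B = {x : E3 | x 0 ≠ 0 ∨ x 1 ≠ 0} := by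
    ext x
    simp only [Set.mem_ofPred_eq, Set.mem_inter_iff, A, B, one_mul, neg_mul]
    constructor
    · rintro ⟨h | h, h' | h'⟩
      · exact h
      · exact h
      · exact h'
      · linarith
    · intro h
      exact ⟨Or.inl h, Or.inl h⟩
  have hopen : ∀ s : ℝ, IsOpen {x : E3 | (x 0 ≠ 0 ∨ x 1 ≠ 0) ∨ 0 < s * x 2} := fun s =>
    ((isOpen_coord_ne 0).union (isOpen_coord_ne 1)).union (isOpen_coord_mul_pos s 2)
  rw [hU] at hc₁ hc₂ ⊢
  refine mayerVietoris (A := A) (B := B) (hopen 1) (hopen (-1))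
    (fun c hc h => exists_boundary_of_starConvex (starConvex_ray 1 one_ne_zero) hc h)
    (fun c hc h => exists_boundary_of_starConvex
      (starConvex_ray (-1) (neg_ne_zero.2 one_ne_zero)) hc h) ?_ hc₁ hc₂ h₁ h₂
  intro a₁ a₂ m₁ m₂
  rw [hI] at m₁ m₂ ⊢
  exact boundsIn_compl_line m₁ m₂ (boundary_boundary _) (boundary_boundary _)

/-- A `3`-cycle in punctured space is trivial relative to the complement of any point. -/
theorem exists_eq_boundary_add_punctured {z : Chain 3 E3} (hz : z ∈ chainsIn 3 ({0}ᶜ : Set E3))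
    (h : boundary 2 E3 z = 0) {x : E3} (hx : x ≠ 0) :
    ∃ w ∈ chainsIn 4 ({0}ᶜ : Set E3), ∃ d ∈ chainsIn 3 ({0}ᶜ ∩ {x}ᶜ : Set E3),
      z = boundary 3 E3 w + d := by
  -- Fill z by v in all of ℝ³ and subdivide v into v₁ off 0 and v₂ off x. Then ∂v₂ avoids x because
  -- v₂ does, and avoids 0 because it equals Sd z + ∂v₁.
  obtain ⟨v, -, rfl⟩ := exists_boundary_of_starConvex (starConvex_univ (0 : E3))
    (mem_chainsIn_univ z) h
  have hU : ({0}ᶜ ∪ {x}ᶜ : Set E3) = Set.univ := by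
    ext y
    simp only [Set.mem_union, Set.mem_compl_iff, Set.mem_singleton_iff, Set.mem_univ, iff_true]
    by_cases hy : y = 0
    · right; rintro rfl; exact hx hy
    · exact Or.inl hy
  obtain ⟨m, v₁, hv₁, v₂, hv₂, hv⟩ := exists_sdOp_eq_add (A := ({0}ᶜ : Set E3))
    (B := ({x}ᶜ : Set E3)) isOpen_compl_singleton isOpen_compl_singleton (c := v)
    (by rw [hU]; exact mem_chainsIn_univ v)
  have hs : sdOp 3 m E3 (boundary 3 E3 v) = boundary 3 E3 v₁ + boundary 3 E3 v₂ := by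
    rw [← boundary_sdOp, hv, map_add]
  have hd := boundary_sdHom (m := m) (boundary 3 E3 v)
  rw [h, map_zero, add_zero, hs] at hd
  have hv2 : boundary 3 E3 v₂ = sdOp 3 m E3 (boundary 3 E3 v) + boundary 3 E3 v₁ := by
    rw [hs, add_right_comm, ZModModule.add_self, zero_add]
  refine ⟨sdHom 3 m E3 (boundary 3 E3 v) + v₁, Submodule.add_mem _ (sdHom_mem hz) hv₁,
    boundary 3 E3 v₂, mem_chainsIn_inter ?_ (boundary_mem_chainsIn hv₂), ?_⟩
  · rw [hv2]
    exact Submodule.add_mem _ (sdOp_mem hz) (boundary_mem_chainsIn hv₁)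
  · rw [map_add, hd]
    exact (add_add_cancel_two _ _ _).symm

end PuncturedSpace

/-! ### One-dimensional cohomology and loops -/

section Cohomology

variable {X : Type*} [TopologicalSpace X]

theorem coboundary_apply {n : ℕ} (c : Cochain n X) (σ : SingularSimplex (n + 1) X) :
    coboundary n X c σ = ∑ i : Fin (n + 2), c (σ.face i.succAbove) := by
  simp [coboundary]

theorem OneCocycle.sum_face (c : OneCocycle X) (σ : SingularSimplex 2 X) :
    c.1 (σ.face ![1, 2]) + c.1 (σ.face ![0, 2]) + c.1 (σ.face ![0, 1]) = 0 := by
  have h := congrFun (LinearMap.mem_ker.1 c.2) σ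
  rw [coboundary_apply, Fin.sum_univ_three] at h
  have h0 : (Fin.succAbove 0 : Fin 2 → Fin 3) = ![1, 2] := by decide
  have h1 : (Fin.succAbove 1 : Fin 2 → Fin 3) = ![0, 2] := by decide
  have h2 : (Fin.succAbove 2 : Fin 2 → Fin 3) = ![0, 1] := by decide
  rw [h0, h1, h2] at h
  exact h

/-- The `0`-cochain given by a function on points. -/
def pointCochain (β : X → ZMod 2) : Cochain 0 X := fun σ => β (σ (stdSimplex.vertex 0))

theorem coboundary_pointCochain (β : X → ZMod 2) (σ : SingularSimplex 1 X) :
    coboundary 0 X (pointCochain β) σ =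
      β (σ (stdSimplex.vertex 1)) + β (σ (stdSimplex.vertex 0)) := by
  rw [coboundary_apply, Fin.sum_univ_two]
  have h : ∀ i : Fin 2, pointCochain β (σ.face i.succAbove) =
      β (σ (stdSimplex.vertex (i.succAbove 0))) := by
    intro i
    change β (σ (stdSimplex.map i.succAbove (stdSimplex.vertex 0))) = _
    rw [stdSimplex.map_vertex]
  rw [h, h]
  rfl

theorem pathSimplex_apply {p q : X} (γ : Path p q) (x : Simplex 1) (t : unitInterval)
    (ht : (t : ℝ) = x.1 1) : pathSimplex γ x = γ t := by
  change γ (stdSimplexHomeomorphUnitInterval x) = γ t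
  congr 1
  exact Subtype.ext ht.symm

theorem pathSimplex_vertex_zero {p q : X} (γ : Path p q) :
    pathSimplex γ (stdSimplex.vertex 0) = p := by
  rw [pathSimplex_apply γ _ 0 (by simp), γ.source]

theorem pathSimplex_vertex_one {p q : X} (γ : Path p q) :
    pathSimplex γ (stdSimplex.vertex 1) = q := by
  rw [pathSimplex_apply γ _ 1 (by simp), γ.target]

/-- The path given by a singular `1`-simplex. -/
def simplexPath (σ : SingularSimplex 1 X) :
    Path (σ (stdSimplex.vertex 0)) (σ (stdSimplex.vertex 1)) where
  toFun t := σ (stdSimplexHomeomorphUnitInterval.symm t)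
  continuous_toFun := σ.continuous.comp stdSimplexHomeomorphUnitInterval.symm.continuous
  source' := by
    congr 1
    rw [Homeomorph.symm_apply_eq]
    exact Subtype.ext (by simp [stdSimplexHomeomorphUnitInterval, stdSimplexEquivIcc])
  target' := by
    congr 1
    rw [Homeomorph.symm_apply_eq]
    exact Subtype.ext (by simp [stdSimplexHomeomorphUnitInterval, stdSimplexEquivIcc])

theorem pathSimplex_simplexPath (σ : SingularSimplex 1 X) : pathSimplex (simplexPath σ) = σ := by
  ext x
  change σ (stdSimplexHomeomorphUnitInterval.symm (stdSimplexHomeomorphUnitInterval x)) = σ x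
  rw [Homeomorph.symm_apply_apply]

theorem Simplex.map_zero_one (x : Simplex 1) :
    (stdSimplex.map ![0, 1] x : Simplex 2).1 1 = x.1 1 ∧
      (stdSimplex.map ![0, 1] x : Simplex 2).1 2 = 0 :=
  ⟨Simplex.map_apply (g := ![0, 1]) (by decide) x 1, Simplex.map_apply_of_notMem x (by decide)⟩

theorem Simplex.map_zero_two (x : Simplex 1) :
    (stdSimplex.map ![0, 2] x : Simplex 2).1 1 = 0 ∧
      (stdSimplex.map ![0, 2] x : Simplex 2).1 2 = x.1 1 :=
  ⟨Simplex.map_apply_of_notMem x (by decide), Simplex.map_apply (g := ![0, 2]) (by decide) x 1⟩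

theorem Simplex.map_one_two (x : Simplex 1) :
    (stdSimplex.map ![1, 2] x : Simplex 2).1 1 = x.1 0 ∧
      (stdSimplex.map ![1, 2] x : Simplex 2).1 2 = x.1 1 :=
  ⟨Simplex.map_apply (g := ![1, 2]) (by decide) x 0,
    Simplex.map_apply (g := ![1, 2]) (by decide) x 1⟩

theorem Simplex.add_one (x : Simplex 1) : x.1 0 + x.1 1 = 1 := by
  have := x.2.2
  rwa [Fin.sum_univ_two] at this

/-- The singular triangle x ↦ (γ·δ)(x₁/2 + x₂) has edges γ, δ and γ·δ. -/
theorem OneCocycle.trans (c : OneCocycle X) {p q r : X} (γ : Path p q) (δ : Path q r) :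
    c.1 (pathSimplex (γ.trans δ)) = c.1 (pathSimplex γ) + c.1 (pathSimplex δ) := by
  have hmem : ∀ x : Simplex 2, x.1 1 / 2 + x.1 2 ∈ unitInterval := by
    intro x
    have h := x.2.2
    rw [Fin.sum_univ_three] at h
    have h0 := x.2.1 0
    have h1 := x.2.1 1
    have h2 := x.2.1 2
    constructor <;> linarith
  let σ : SingularSimplex 2 X :=
    ⟨fun x => γ.trans δ ⟨x.1 1 / 2 + x.1 2, hmem x⟩, by
      have h1 : Continuous fun x : Simplex 2 => x.1 1 :=
        (continuous_apply 1).comp continuous_subtype_val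
      have h2 : Continuous fun x : Simplex 2 => x.1 2 :=
        (continuous_apply 2).comp continuous_subtype_val
      exact (γ.trans δ).continuous.comp (Continuous.subtype_mk ((h1.div_const 2).add h2) _)⟩
  have e01 : σ.face ![0, 1] = pathSimplex γ := by
    ext x
    change γ.trans δ ⟨(stdSimplex.map ![0, 1] x : Simplex 2).1 1 / 2 +
      (stdSimplex.map ![0, 1] x : Simplex 2).1 2, _⟩ = _
    obtain ⟨h1, h2⟩ := Simplex.map_zero_one x
    have hx := Simplex.add_one x
    have h0' := x.2.1 0
    rw [Path.trans_apply, dif_pos (by simp only [h1, h2]; linarith)]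
    refine (pathSimplex_apply γ x _ ?_).symm
    simp only [h1, h2]
    ring
  have e02 : σ.face ![0, 2] = pathSimplex (γ.trans δ) := by
    ext x
    change γ.trans δ ⟨(stdSimplex.map ![0, 2] x : Simplex 2).1 1 / 2 +
      (stdSimplex.map ![0, 2] x : Simplex 2).1 2, _⟩ = _
    obtain ⟨h1, h2⟩ := Simplex.map_zero_two x
    refine (pathSimplex_apply (γ.trans δ) x _ ?_).symm
    simp only [h1, h2]
    ring
  have e12 : σ.face ![1, 2] = pathSimplex δ := by
    ext x
    change γ.trans δ ⟨(stdSimplex.map ![1, 2] x : Simplex 2).1 1 / 2 +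
      (stdSimplex.map ![1, 2] x : Simplex 2).1 2, _⟩ = _
    obtain ⟨h1, h2⟩ := Simplex.map_one_two x
    have hx := Simplex.add_one x
    have h1' := x.2.1 1
    rw [Path.trans_apply]
    -- `Path.trans` assigns the parameter 1/2 to γ; on this edge it occurs only at the common point
    -- q.
    split_ifs with h
    · simp only [h1, h2] at h
      have hx1 : x.1 1 = 0 := by linarith
      rw [pathSimplex_apply δ x 0 (by simp [hx1]), δ.source]
      have : (⟨2 * ((stdSimplex.map ![1, 2] x : Simplex 2).1 1 / 2 +
        (stdSimplex.map ![1, 2] x : Simplex 2).1 2), by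
          simp only [h1, h2, hx1]; constructor <;> linarith⟩ : unitInterval) = 1 :=
        Subtype.ext (by simp only [h1, h2, hx1]; simp; linarith)
      rw [this, γ.target]
    · refine (pathSimplex_apply δ x _ ?_).symm
      simp only [h1, h2]
      linarith
  have h := OneCocycle.sum_face c σ
  rw [e01, e02, e12] at h
  have h' := eq_of_add_eq_zero h
  have : c.1 (pathSimplex (γ.trans δ)) = c.1 (pathSimplex δ) +
      (c.1 (pathSimplex δ) + c.1 (pathSimplex (γ.trans δ))) := by
    rw [← add_assoc, ZModModule.add_self, zero_add]
  rw [this, h', add_comm]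

/-- A cocycle that vanishes on loops is a coboundary. -/
theorem OneCocycle.mem_range_of_loops (c : OneCocycle X)
    (h : ∀ (p : X) (γ : Path p p), c.1 (pathSimplex γ) = 0) :
    c.1 ∈ LinearMap.range (coboundary 0 X) := by
  -- The loop α γ α'⁻¹ gives the formula. Equality of the starting points is a hypothesis, since the
  -- base points chosen below agree along a path only propositionally.
  have hindep : ∀ {a a' p q : X} (_ : a = a') (α : Path a p) (α' : Path a' q) (γ : Path p q),
      c.1 (pathSimplex γ) = c.1 (pathSimplex α') + c.1 (pathSimplex α) := by
    rintro a _ p q rfl α α' γ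
    have h1 := h _ ((α.trans γ).trans α'.symm)
    have h2 := h _ (α'.trans α'.symm)
    rw [OneCocycle.trans c] at h1 h2
    rw [OneCocycle.trans c] at h1
    have h3 := eq_of_add_eq_zero h2
    have h4 := eq_of_add_eq_zero h1
    rw [← h3] at h4
    rw [← h4, add_right_comm, ZModModule.add_self, zero_add]
  -- `Quotient.out` selects one base point in each path component.
  have hrep : ∀ p : X, ∃ a : X, Joined a p ∧ ∀ q, Joined p q →
      (Quotient.out (Quotient.mk (pathSetoid X) p)) = Quotient.out (Quotient.mk (pathSetoid X) q) ∧
      a = Quotient.out (Quotient.mk (pathSetoid X) p) := by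
    intro p
    refine ⟨Quotient.out (Quotient.mk (pathSetoid X) p), ?_, fun q hq => ⟨?_, rfl⟩⟩
    · exact Quotient.exact (Quotient.out_eq (Quotient.mk (pathSetoid X) p))
    · rw [Quotient.sound (a := p) (b := q) hq]
  choose a ha using hrep
  have haa : ∀ p q, Joined p q → a p = a q := by
    intro p q hpq
    rw [((ha p).2 q hpq).2, ((ha p).2 q hpq).1, ← ((ha q).2 p hpq.symm).2]
  refine ⟨pointCochain fun p => c.1 (pathSimplex (ha p).1.somePath), ?_⟩
  funext σ
  rw [coboundary_pointCochain]
  have := hindep (haa _ _ ⟨simplexPath σ⟩) (ha (σ (stdSimplex.vertex 0))).1.somePath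
    (ha (σ (stdSimplex.vertex 1))).1.somePath (simplexPath σ)
  rw [pathSimplex_simplexPath] at this
  exact this.symm

theorem H1.eval_mk (c : OneCocycle X) {p : X} (γ : Path p p) :
    H1.eval (Submodule.Quotient.mk c : H1 X) γ = c.1 (pathSimplex γ) := rfl

/-- A class in `H¹(X; ℤ/2)` is determined by its values on loops. -/
theorem H1.ext_eval {a b : H1 X} (h : ∀ (p : X) (γ : Path p p), a.eval γ = b.eval γ) : a = b := by
  obtain ⟨c, rfl⟩ := Submodule.Quotient.mk_surjective _ a
  obtain ⟨d, rfl⟩ := Submodule.Quotient.mk_surjective _ b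
  rw [Submodule.Quotient.eq]
  refine OneCocycle.mem_range_of_loops (c - d) fun p γ => ?_
  have := h p γ
  rw [H1.eval_mk, H1.eval_mk] at this
  exact sub_eq_zero.2 this

/-! ### Cap products -/

theorem cap_of (c : Cochain 1 X) (σ : SingularSimplex 3 X) :
    cap c (Chain.of σ) = c (σ.face ![0, 1]) • Chain.of (σ.face ![1, 2, 3]) := by
  rw [cap, Finsupp.linearCombination_single, one_smul]

/-- The cap product of a `4`-chain with a `1`-cochain. -/
def capFour (c : Cochain 1 X) : Chain 4 X →ₗ[ZMod 2] Chain 3 X :=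
  Finsupp.linearCombination (ZMod 2) fun σ : SingularSimplex 4 X =>
    c (σ.face ![0, 1]) • Chain.of (σ.face ![1, 2, 3, 4])

/-- The faces opposite to vertices 0 and 1 share the back face [2,3,4], and the cocycle condition on
[0,1,2] turns the sum of their coefficients into c[0,1]. The other faces match term by term. -/
theorem cap_boundary (c : OneCocycle X) (w : Chain 4 X) :
    cap c.1 (boundary 3 X w) = boundary 2 X (capFour c.1 w) := by
  have : (cap c.1).comp (boundary 3 X) = (boundary 2 X).comp (capFour c.1) := by
    refine Chain.hom_ext fun σ => ?_
    have hc := OneCocycle.sum_face c (σ.face ![0, 1, 2])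
    simp only [SingularSimplex.face_face] at hc
    rw [show (![0, 1, 2] ∘ ![1, 2] : Fin 2 → Fin 5) = ![1, 2] by decide,
      show (![0, 1, 2] ∘ ![0, 2] : Fin 2 → Fin 5) = ![0, 2] by decide,
      show (![0, 1, 2] ∘ ![0, 1] : Fin 2 → Fin 5) = ![0, 1] by decide] at hc
    simp only [LinearMap.comp_apply, boundary_of, map_sum, cap_of, capFour,
      Finsupp.linearCombination_single, one_smul, map_smul, SingularSimplex.face_face]
    rw [Fin.sum_univ_five, Fin.sum_univ_four]
    rw [show (Fin.succAbove 0 ∘ ![0, 1] : Fin 2 → Fin 5) = ![1, 2] by decide,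
      show (Fin.succAbove 1 ∘ ![0, 1] : Fin 2 → Fin 5) = ![0, 2] by decide,
      show (Fin.succAbove 2 ∘ ![0, 1] : Fin 2 → Fin 5) = ![0, 1] by decide,
      show (Fin.succAbove 3 ∘ ![0, 1] : Fin 2 → Fin 5) = ![0, 1] by decide,
      show (Fin.succAbove 4 ∘ ![0, 1] : Fin 2 → Fin 5) = ![0, 1] by decide,
      show (Fin.succAbove 0 ∘ ![1, 2, 3] : Fin 3 → Fin 5) = ![2, 3, 4] by decide,
      show (Fin.succAbove 1 ∘ ![1, 2, 3] : Fin 3 → Fin 5) = ![2, 3, 4] by decide,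
      show (Fin.succAbove 2 ∘ ![1, 2, 3] : Fin 3 → Fin 5) = ![1, 3, 4] by decide,
      show (Fin.succAbove 3 ∘ ![1, 2, 3] : Fin 3 → Fin 5) = ![1, 2, 4] by decide,
      show (Fin.succAbove 4 ∘ ![1, 2, 3] : Fin 3 → Fin 5) = ![1, 2, 3] by decide,
      show (![1, 2, 3, 4] ∘ Fin.succAbove 0 : Fin 3 → Fin 5) = ![2, 3, 4] by decide,
      show (![1, 2, 3, 4] ∘ Fin.succAbove 1 : Fin 3 → Fin 5) = ![1, 3, 4] by decide,
      show (![1, 2, 3, 4] ∘ Fin.succAbove 2 : Fin 3 → Fin 5) = ![1, 2, 4] by decide,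
      show (![1, 2, 3, 4] ∘ Fin.succAbove 3 : Fin 3 → Fin 5) = ![1, 2, 3] by decide]
    simp only [smul_add]
    rw [← add_smul, eq_of_add_eq_zero hc]
  exact LinearMap.congr_fun this w

/-- The cap product of a chain with a `0`-cochain. -/
def capZero (n : ℕ) (β : X → ZMod 2) : Chain n X →ₗ[ZMod 2] Chain n X :=
  Finsupp.linearCombination (ZMod 2) fun σ : SingularSimplex n X =>
    β (σ (stdSimplex.vertex 0)) • Chain.of σ

theorem capZero_of {n : ℕ} (β : X → ZMod 2) (σ : SingularSimplex n X) :
    capZero n β (Chain.of σ) = β (σ (stdSimplex.vertex 0)) • Chain.of σ := by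
  rw [capZero, Finsupp.linearCombination_single, one_smul]

/-- Only the face opposite to vertex 0 has a different leading vertex, so everything else cancels.
On cycles, capping with a coboundary therefore gives a boundary. -/
theorem cap_coboundary (β : X → ZMod 2) (z : Chain 3 X) :
    cap (coboundary 0 X (pointCochain β)) z =
      boundary 2 X (capZero 3 β z) + capZero 2 β (boundary 2 X z) := by
  have : cap (coboundary 0 X (pointCochain β)) =
      (boundary 2 X).comp (capZero 3 β) + (capZero 2 β).comp (boundary 2 X) := by
    refine Chain.hom_ext fun σ => ?_
    simp only [LinearMap.add_apply, LinearMap.comp_apply, cap_of, coboundary_pointCochain,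
      capZero_of, map_smul, boundary_of, map_sum]
    have hv : ∀ {m : ℕ} (g : Fin (m + 1) → Fin 4) (i : Fin (m + 1)),
        σ.face g (stdSimplex.vertex i) = σ (stdSimplex.vertex (g i)) := by
      intro m g i
      change σ (stdSimplex.map g (stdSimplex.vertex i)) = _
      rw [stdSimplex.map_vertex]
    simp only [hv]
    rw [Fin.sum_univ_four, Fin.sum_univ_four]
    rw [show (Fin.succAbove 0 : Fin 3 → Fin 4) = ![1, 2, 3] by decide,
      show (Fin.succAbove 1 : Fin 3 → Fin 4) = ![0, 2, 3] by decide,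
      show (Fin.succAbove 2 : Fin 3 → Fin 4) = ![0, 1, 3] by decide,
      show (Fin.succAbove 3 : Fin 3 → Fin 4) = ![0, 1, 2] by decide]
    simp only [Matrix.cons_val_zero, Matrix.cons_val_one, smul_add, add_smul]
    set b₀ := β (σ (stdSimplex.vertex 0))
    set b₁ := β (σ (stdSimplex.vertex 1))
    have key : ∀ u v w x y : Chain 2 X, u + v = v + w + x + y + (u + w + x + y) := by
      intro u v w x y
      have : v + w + x + y + (u + w + x + y) = u + v + (w + w) + (x + x) + (y + y) := by abel
      rw [this, Chain.add_self, Chain.add_self, Chain.add_self, add_zero, add_zero, add_zero]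
    exact key _ _ _ _ _
  exact LinearMap.congr_fun this z

end Cohomology

/-! ### The obstruction to lifting through the double cover -/

/-- Contract A to a point, lift the reversed contraction starting from a constant, and restrict to
time one. -/
theorem exists_rho_lift {A : Type*} [TopologicalSpace A] [ContractibleSpace A] (f : C(A, SO3)) :
    ∃ F : C(A, Sphere3), ∀ a, rho (F a) = f a := by
  obtain ⟨a₀, ⟨H⟩⟩ := id_nullhomotopic A
  obtain ⟨q, hq⟩ := rho_surjective (f a₀)
  let K : C(unitInterval × A, SO3) := f.comp H.symm.toContinuousMap
  have hK : ∀ a, K (0, a) = rho (ContinuousMap.const A q a) := by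
    intro a
    change f (H.symm (0, a)) = rho q
    rw [H.symm.apply_zero, hq]
    rfl
  let F := isCoveringMap_rho.liftHomotopy K _ hK
  refine ⟨F.comp ⟨fun a => ((1 : unitInterval), a), by fun_prop⟩, fun a => ?_⟩
  have := congrFun (isCoveringMap_rho.liftHomotopy_lifts K _ hK) (1, a)
  refine this.trans ?_
  change f (H.symm (1, a)) = f a
  rw [H.symm.apply_one]
  rfl

theorem rho_lift_unique {A : Type*} [TopologicalSpace A] [PreconnectedSpace A]
    {F G : C(A, Sphere3)} (h : ∀ a, rho (F a) = rho (G a)) {a₀ : A} (h₀ : F a₀ = G a₀) : F = G :=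
  DFunLike.coe_injective (isCoveringMap_rho.eq_of_comp_eq F.continuous G.continuous (funext h) a₀ h₀)

/-- The action of `ℤ/2` on the sphere by the antipodal map. -/
def flip (a : ZMod 2) (q : Sphere3) : Sphere3 := if a = 0 then q else -q

theorem flip_zero (q : Sphere3) : flip 0 q = q := if_pos rfl

theorem flip_one (q : Sphere3) : flip 1 q = -q := if_neg (by decide)

theorem zmod_two_cases : ∀ a : ZMod 2, a = 0 ∨ a = 1 := by decide

theorem flip_flip (a b : ZMod 2) (q : Sphere3) : flip a (flip b q) = flip (a + b) q := by
  rcases zmod_two_cases a with rfl | rfl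
  · rw [flip_zero, zero_add]
  rcases zmod_two_cases b with rfl | rfl
  · rw [flip_zero, add_zero]
  · rw [flip_one, flip_one, neg_neg, show (1 : ZMod 2) + 1 = 0 by decide, flip_zero]

theorem neg_ne_self (q : Sphere3) : -q ≠ q := by
  intro h
  have h2 := congrArg Subtype.val h
  have h3 : q.1 = 0 := by
    have : (2 : ℝ) • q.1 = 0 := by
      rw [two_smul, ← neg_eq_iff_add_eq_zero]
      exact h2
    simpa using this
  have h4 := q.2
  rw [mem_sphere_zero_iff_norm, h3, norm_zero] at h4
  exact zero_ne_one h4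

theorem flip_left_injective {a b : ZMod 2} {q : Sphere3} (h : flip a q = flip b q) : a = b := by
  rcases zmod_two_cases a with rfl | rfl <;> rcases zmod_two_cases b with rfl | rfl
  · rfl
  · exact absurd (by rw [flip_zero, flip_one] at h; exact h.symm) (neg_ne_self q)
  · exact absurd (by rwa [flip_zero, flip_one] at h) (neg_ne_self q)
  · rfl

theorem rho_flip (a : ZMod 2) (q : Sphere3) : rho (flip a q) = rho q := by
  unfold flip
  split_ifs
  · rfl
  · exact rho_neg q

theorem exists_eq_flip {q r : Sphere3} (h : rho q = rho r) : ∃ a, q = flip a r := by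
  rcases rho_eq_iff.1 h with h | h
  · exact ⟨0, by rw [h, flip_zero]⟩
  · exact ⟨1, by rw [h, flip_one]⟩

theorem continuous_flip (a : ZMod 2) : Continuous (flip a) := by
  unfold flip
  split_ifs
  · exact continuous_id
  · exact continuous_neg

instance (n : ℕ) : ContractibleSpace (Simplex n) :=
  (convex_stdSimplex ℝ (Fin (n + 1))).contractibleSpace ⟨_, (stdSimplex.vertex 0).2⟩

section LiftCochain

variable {X : Type*} [TopologicalSpace X] (ψ : C(X, SO3)) (l : X → Sphere3)

open Classical in
/-- For a set-theoretic lift `l` of `ψ`, the cochain that compares the continuous lift of `ψ`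
along a path with the values of `l` at the end points. -/
def liftCochain : Cochain 1 X := fun σ =>
  if ∃ F : C(Simplex 1, Sphere3), (∀ x, rho (F x) = ψ (σ x)) ∧
    F (stdSimplex.vertex 0) = l (σ (stdSimplex.vertex 0)) ∧
    F (stdSimplex.vertex 1) = l (σ (stdSimplex.vertex 1)) then 0 else 1

variable {ψ l}

/-- Lifts along a path are unique up to a global sign, so any one of them computes the cochain from
its signs relative to `l` at the ends. -/
theorem liftCochain_eq {σ : SingularSimplex 1 X} (F : C(Simplex 1, Sphere3))
    (hF : ∀ x, rho (F x) = ψ (σ x)) {a b : ZMod 2}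
    (ha : F (stdSimplex.vertex 0) = flip a (l (σ (stdSimplex.vertex 0))))
    (hb : F (stdSimplex.vertex 1) = flip b (l (σ (stdSimplex.vertex 1)))) :
    liftCochain ψ l σ = a + b := by
  unfold liftCochain
  by_cases hab : a = b
  · subst hab
    rw [if_pos, CharTwo.add_self_eq_zero]
    refine ⟨⟨fun x => flip a (F x), (continuous_flip a).comp F.continuous⟩, fun x => ?_, ?_, ?_⟩
    · exact (rho_flip a _).trans (hF x)
    · change flip a (F _) = _
      rw [ha, flip_flip, CharTwo.add_self_eq_zero, flip_zero]
    · change flip a (F _) = _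
      rw [hb, flip_flip, CharTwo.add_self_eq_zero, flip_zero]
  · rw [if_neg]
    · have h2 : ∀ u v : ZMod 2, u ≠ v → 1 = u + v := by decide
      exact h2 a b hab
    · rintro ⟨G, hG, h0, h1⟩
      have hGF : G = ⟨fun x => flip a (F x), (continuous_flip a).comp F.continuous⟩ := by
        refine rho_lift_unique (a₀ := stdSimplex.vertex 0) (fun x => ?_) ?_
        · exact (hG x).trans ((hF x).symm.trans (rho_flip a _).symm)
        · change _ = flip a (F _)
          rw [h0, ha, flip_flip, CharTwo.add_self_eq_zero a, flip_zero]
      have h2 : flip a (F (stdSimplex.vertex 1)) = l (σ (stdSimplex.vertex 1)) := by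
        rw [← h1, hGF]
        rfl
      rw [hb, flip_flip] at h2
      have h3 := flip_left_injective (h2.trans (flip_zero _).symm)
      exact hab (eq_of_add_eq_zero h3)

/-- The sign-corrected `l` is itself a continuous lift along the path. It is applied with χ = 0 off
the sphere and with χ = `upper e` in the tube. -/
theorem liftCochain_eq_of_continuousOn {A : Set X} {χ : X → ZMod 2} (hl : ∀ x, rho (l x) = ψ x)
    (hc : ContinuousOn (fun x => flip (χ x) (l x)) A) {σ : SingularSimplex 1 X}
    (hσ : Set.range σ ⊆ A) :
    liftCochain ψ l σ = χ (σ (stdSimplex.vertex 0)) + χ (σ (stdSimplex.vertex 1)) := by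
  refine liftCochain_eq ⟨fun x => flip (χ (σ x)) (l (σ x)), ?_⟩ (fun x => ?_) rfl rfl
  · exact hc.comp_continuous σ.continuous fun x => hσ ⟨x, rfl⟩
  · exact (rho_flip _ _).trans (hl _)

/-- A single lift over the contractible triangle has a sign at each vertex; each sign enters two
edges. -/
theorem liftCochain_mem (hl : ∀ x, rho (l x) = ψ x) : liftCochain ψ l ∈ OneCocycle X := by
  rw [LinearMap.mem_ker]
  funext σ
  obtain ⟨F, hF⟩ := exists_rho_lift (ψ.comp σ)
  have hv : ∀ i, ∃ a, F (stdSimplex.vertex i) = flip a (l (σ (stdSimplex.vertex i))) := fun i =>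
    exists_eq_flip ((hF _).trans (hl _).symm)
  choose a ha using hv
  have hface : ∀ g : Fin 2 → Fin 3, liftCochain ψ l (σ.face g) = a (g 0) + a (g 1) := by
    intro g
    refine liftCochain_eq (ψ := ψ) (σ := σ.face g)
      (F.comp ⟨stdSimplex.map g, stdSimplex.continuous_map g⟩) (fun x => hF _) ?_ ?_
    · change F (stdSimplex.map g _) = flip _ (l (σ (stdSimplex.map g _)))
      rw [stdSimplex.map_vertex, ha]
    · change F (stdSimplex.map g _) = flip _ (l (σ (stdSimplex.map g _)))
      rw [stdSimplex.map_vertex, ha]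
  rw [coboundary_apply, Fin.sum_univ_three, hface, hface, hface]
  change a 1 + a 2 + (a 0 + a 2) + (a 0 + a 1) = 0
  have : a 1 + a 2 + (a 0 + a 2) + (a 0 + a 1) = (a 0 + a 0) + (a 1 + a 1) + (a 2 + a 2) := by ring
  rw [this]
  simp only [CharTwo.add_self_eq_zero]

/-- On a loop `l` has the same value at both ends, so the cochain vanishes exactly when the lift
closes up. -/
theorem liftCochain_pathSimplex {φ : C(X, GL(3, ℝ)⁺)} (hl : ∀ x, rho (l x) = orthoMap (φ x))
    {p : X} (γ : Path p p) :
    liftCochain (orthoMap.comp φ) l (pathSimplex γ) = loopParity (γ.map φ.continuous) := by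
  have hiff : liftCochain (orthoMap.comp φ) l (pathSimplex γ) = 0 ↔
      loopParity (γ.map φ.continuous) = 0 := by
    rw [loopParity_eq_zero_iff]
    constructor
    · intro h
      obtain ⟨F, hF⟩ := exists_rho_lift ((orthoMap.comp φ).comp (pathSimplex γ))
      obtain ⟨a, ha⟩ := exists_eq_flip ((hF (stdSimplex.vertex 0)).trans (hl _).symm)
      obtain ⟨b, hb⟩ := exists_eq_flip ((hF (stdSimplex.vertex 1)).trans (hl _).symm)
      rw [liftCochain_eq F hF ha hb] at h
      refine ⟨F.comp ⟨stdSimplexHomeomorphUnitInterval.symm,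
        stdSimplexHomeomorphUnitInterval.symm.continuous⟩, fun t => ?_, ?_⟩
      · refine (hF _).trans ?_
        change orthoMap (φ (γ (stdSimplexHomeomorphUnitInterval
          (stdSimplexHomeomorphUnitInterval.symm t)))) = _
        rw [Homeomorph.apply_symm_apply]
      · have h0 : stdSimplexHomeomorphUnitInterval.symm 0 = (stdSimplex.vertex 0 : Simplex 1) := by
          rw [Homeomorph.symm_apply_eq]
          exact Subtype.ext (by simp [stdSimplexHomeomorphUnitInterval, stdSimplexEquivIcc])
        have h1 : stdSimplexHomeomorphUnitInterval.symm 1 = (stdSimplex.vertex 1 : Simplex 1) := by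
          rw [Homeomorph.symm_apply_eq]
          exact Subtype.ext (by simp [stdSimplexHomeomorphUnitInterval, stdSimplexEquivIcc])
        change F (stdSimplexHomeomorphUnitInterval.symm 0) =
          F (stdSimplexHomeomorphUnitInterval.symm 1)
        rw [h0, h1, ha, hb, pathSimplex_vertex_zero, pathSimplex_vertex_one, eq_of_add_eq_zero h]
    · rintro ⟨Γ, hΓ, h01⟩
      obtain ⟨a, ha⟩ := exists_eq_flip ((hΓ 0).trans (hl _).symm)
      rw [γ.source] at ha
      have h0 : stdSimplexHomeomorphUnitInterval (stdSimplex.vertex 0 : Simplex 1) = 0 :=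
        Subtype.ext (by simp [stdSimplexHomeomorphUnitInterval, stdSimplexEquivIcc])
      have h1 : stdSimplexHomeomorphUnitInterval (stdSimplex.vertex 1 : Simplex 1) = 1 :=
        Subtype.ext (by simp [stdSimplexHomeomorphUnitInterval, stdSimplexEquivIcc])
      rw [liftCochain_eq (a := a) (b := a) (Γ.comp ⟨stdSimplexHomeomorphUnitInterval,
        stdSimplexHomeomorphUnitInterval.continuous⟩) (fun x => hΓ _) ?_ ?_,
        CharTwo.add_self_eq_zero]
      · change Γ (stdSimplexHomeomorphUnitInterval _) = _
        rw [h0, pathSimplex_vertex_zero, ha]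
      · change Γ (stdSimplexHomeomorphUnitInterval _) = _
        rw [h1, pathSimplex_vertex_one, ← h01, ha]
  have h2 : ∀ u v : ZMod 2, (u = 0 ↔ v = 0) → u = v := by decide
  exact h2 _ _ hiff

end LiftCochain

/-! ### Lifts over a tubular neighbourhood of a sphere -/

instance : PreconnectedSpace Sphere2 :=
  Subtype.preconnectedSpace (isPreconnected_sphere
    (by rw [rank_eq_card_basis (EuclideanSpace.basisFun (Fin 3) ℝ).toBasis]; simp) 0 1)

section TubularLift

variable {X : Type*} {e : Sphere2 × ℝ → X}

open Classical in
/-- The indicator function of the upper half `t > 1/2` of a tubular neighbourhood. -/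
def upper (e : Sphere2 × ℝ → X) (p : X) : ZMod 2 :=
  if ∃ x : Sphere2 × ℝ, 1 / 2 < x.2 ∧ e x = p then 1 else 0

theorem upper_apply (he : Function.Injective e) (x : Sphere2 × ℝ) :
    upper e (e x) = if 1 / 2 < x.2 then 1 else 0 := by
  unfold upper
  congr 1
  refine propext ⟨?_, fun h => ⟨x, h, rfl⟩⟩
  rintro ⟨y, hy, hxy⟩
  rwa [← he hxy]

theorem upper_of_notMem {p : X} (hp : p ∉ Set.range e) : upper e p = 0 :=
  if_neg fun ⟨x, _, hx⟩ => hp ⟨x, hx⟩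

/-- Lift over S² × [0,1] from the constant q₀. At the far end the lift takes values ±q₀, hence is
constant on the connected S²; the loop over N does not lift to a closed one, so the constant is -q₀.
A change of sign above level 1/2 restores q₀ at that end and leaves the jump on the core. -/
theorem exists_tubular_lift [TopologicalSpace X] [T2Space X] (he : Topology.IsOpenEmbedding e) {ψ : C(X, SO3)}
    {q₀ : Sphere3} (hψ : ∀ p ∉ e '' (Set.univ ×ˢ Set.Icc 0 1), ψ p = rho q₀) (N : Sphere2)
    (hN : ¬ ∃ Γ : C(unitInterval, Sphere3),
      (∀ t : unitInterval, rho (Γ t) = ψ (e (N, t))) ∧ Γ 0 = Γ 1) :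
    ∃ l : X → Sphere3, (∀ p, rho (l p) = ψ p) ∧
      ContinuousOn l (e '' (Set.univ ×ˢ {1 / 2}))ᶜ ∧
      ContinuousOn (fun p => flip (upper e p) (l p)) (Set.range e) := by
  -- The hypothesis covers only the complement of the closed slab; continuity extends it to the
  -- slices t = 0 and t = 1, where the lift begins and ends.
  have hout : ∀ (s : Sphere2) (t : ℝ), t ∉ Set.Ioo (0 : ℝ) 1 → ψ (e (s, t)) = rho q₀ := by
    intro s t ht
    have hcl : IsClosed {t : ℝ | ψ (e (s, t)) = rho q₀} := by
      refine isClosed_eq ?_ continuous_const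
      exact ψ.continuous.comp (he.continuous.comp (by fun_prop))
    have hmem : ∀ t : ℝ, t ∉ Set.Icc (0 : ℝ) 1 → ψ (e (s, t)) = rho q₀ := by
      intro t ht
      refine hψ _ ?_
      rintro ⟨x, hx, hxe⟩
      rw [he.injective hxe] at hx
      exact ht hx.2
    have h0 : Set.Iic (0 : ℝ) ⊆ {t : ℝ | ψ (e (s, t)) = rho q₀} := by
      rw [← closure_Iio]
      exact hcl.closure_subset_iff.2 fun t ht => hmem t fun h => absurd h.1 (not_le.2 ht)
    have h1 : Set.Ici (1 : ℝ) ⊆ {t : ℝ | ψ (e (s, t)) = rho q₀} := by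
      rw [← closure_Ioi]
      exact hcl.closure_subset_iff.2 fun t ht => hmem t fun h => absurd h.2 (not_le.2 ht)
    rcases le_or_gt t 0 with h | h
    · exact h0 h
    · exact h1 (not_lt.1 fun h' => ht ⟨h, h'⟩)
  let H : C(unitInterval × Sphere2, SO3) :=
    ⟨fun x => ψ (e (x.2, x.1)), ψ.continuous.comp (he.continuous.comp (by fun_prop))⟩
  have hH : ∀ s, H (0, s) = rho (ContinuousMap.const Sphere2 q₀ s) := fun s =>
    hout s 0 (by simp)
  obtain ⟨L, hL, hL0⟩ : ∃ L : C(unitInterval × Sphere2, Sphere3),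
      (∀ t s, rho (L (t, s)) = ψ (e (s, t))) ∧ ∀ s, L (0, s) = q₀ :=
    ⟨isCoveringMap_rho.liftHomotopy H _ hH,
      fun t s => congrFun (isCoveringMap_rho.liftHomotopy_lifts H _ hH) (t, s),
      fun s => isCoveringMap_rho.liftHomotopy_zero H _ hH s⟩
  have hL1 : ∀ s, L (1, s) = -q₀ := by
    have h1 : ∀ s, rho (L (1, s)) = rho q₀ := fun s => (hL 1 s).trans (hout s _ (by simp))
    have hN1 : L (1, N) = -q₀ := by
      rcases rho_eq_iff.1 (h1 N) with h | h
      · refine absurd ⟨L.comp ⟨fun t => (t, N), by fun_prop⟩, fun t => hL t N, ?_⟩ hN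
        change L (0, N) = L (1, N)
        rw [h, hL0]
      · exact h
    have := rho_lift_unique (F := L.comp ⟨fun s : Sphere2 => ((1 : unitInterval), s), by fun_prop⟩)
      (G := ContinuousMap.const _ (-q₀)) (fun s => (h1 s).trans (rho_neg q₀).symm) (a₀ := N) hN1
    intro s
    exact DFunLike.congr_fun this s
  -- Clamping t to [0,1] continues the lift over the whole tube, by q₀ below and -q₀ above, whereas
  -- the value off the tube is q₀.
  let m : X → Sphere3 := Function.extend e
    (fun x => L (Set.projIcc 0 1 zero_le_one x.2, x.1)) (fun _ => q₀)
  have hme : ∀ x, m (e x) = L (Set.projIcc 0 1 zero_le_one x.2, x.1) := fun x =>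
    he.injective.extend_apply _ _ x
  have hm' : ∀ p ∉ Set.range e, m p = q₀ := fun p hp => Function.extend_apply' _ _ _ hp
  have hcm : ∀ x, ContinuousAt m (e x) := by
    intro x
    rw [← he.continuousAt_iff]
    have : m ∘ e = fun x => L (Set.projIcc 0 1 zero_le_one x.2, x.1) := funext hme
    rw [this]
    exact (L.continuous.comp ((continuous_projIcc.comp continuous_snd).prodMk
      continuous_fst)).continuousAt
  -- This flip removes the disagreement at the upper end of the tube.
  let l : X → Sphere3 := fun p => flip (upper e p) (m p)
  have hl0 : ∀ p ∉ e '' (Set.univ ×ˢ Set.Icc 0 1), l p = q₀ := by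
    intro p hp
    by_cases hpe : p ∈ Set.range e
    · obtain ⟨x, rfl⟩ := hpe
      simp only [l, hme, upper_apply he.injective]
      rcases lt_or_ge x.2 0 with hx | hx
      · rw [Set.projIcc_of_le_left _ hx.le, if_neg (by linarith), flip_zero]
        exact hL0 _
      · have hx1 : 1 < x.2 := by
          by_contra! h
          exact hp ⟨x, ⟨trivial, hx, h⟩, rfl⟩
        rw [Set.projIcc_of_right_le _ hx1.le, if_pos (by linarith), flip_one]
        exact (congrArg _ (hL1 x.1)).trans (neg_neg _)
    · simp only [l, hm' p hpe, upper_of_notMem hpe, flip_zero]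
  have hK : IsClosed (e '' (Set.univ ×ˢ Set.Icc (0 : ℝ) 1)) :=
    ((isCompact_univ.prod isCompact_Icc).image he.continuous).isClosed
  refine ⟨l, fun p => ?_, ?_, ?_⟩
  · by_cases hp : p ∈ e '' (Set.univ ×ˢ Set.Icc 0 1)
    · obtain ⟨x, hx, rfl⟩ := hp
      simp only [l, rho_flip, hme, hL, Set.projIcc_of_mem _ hx.2]
    · rw [hl0 p hp, hψ p hp]
  · intro p hp
    refine ContinuousAt.continuousWithinAt ?_
    by_cases hpe : p ∈ Set.range e
    · obtain ⟨x, rfl⟩ := hpe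
      rcases lt_trichotomy x.2 (1 / 2) with hx | hx | hx
      · rw [← he.continuousAt_iff]
        refine (he.continuousAt_iff.2 (hcm x)).congr ?_
        filter_upwards [continuous_snd.continuousAt.eventually (gt_mem_nhds hx)] with y hy
        simp only [l, Function.comp_apply, upper_apply he.injective, if_neg (not_lt.2 hy.le),
          flip_zero]
      · exact absurd ⟨x, ⟨trivial, hx⟩, rfl⟩ hp
      · rw [← he.continuousAt_iff]
        refine ((continuous_flip 1).continuousAt.comp (he.continuousAt_iff.2 (hcm x))).congr ?_
        filter_upwards [continuous_snd.continuousAt.eventually (lt_mem_nhds hx)] with y hy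
        simp only [l, Function.comp_apply, upper_apply he.injective, if_pos hy]
    · have hpK : p ∉ e '' (Set.univ ×ˢ Set.Icc 0 1) := fun ⟨x, _, hx⟩ => hpe ⟨x, hx⟩
      refine (continuousAt_const (y := q₀)).congr ?_
      filter_upwards [hK.isOpen_compl.mem_nhds hpK] with y hy
      exact (hl0 y hy).symm
  · rintro _ ⟨x, rfl⟩
    refine ((hcm x).congr (Filter.Eventually.of_forall fun p => ?_)).continuousWithinAt
    simp only [l, flip_flip, CharTwo.add_self_eq_zero, flip_zero]

end TubularLift

/-! ### The derivative in the frame, and the twist near its axis -/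

section Derivative
variable {M : Type*} [TopologicalSpace M] [ChartedSpace E3 M] [IsManifold (𝓡 3) ∞ M]
  {o : TangentOrientation M} (σ : OrientedTrivialization o)

theorem glMat_derivHom_mulVec (f : DiffPlus o) (p : M) (v : Fin 3 → ℝ) :
    (glMat (derivHom σ f p)).mulVec v =
      (σ.frame (f.1 p)).symm (mfderiv (𝓡 3) (𝓡 3) f.1 p (σ.frame p v)) :=
  LinearMap.toMatrix'_mulVec (frameDeriv σ f p : (Fin 3 → ℝ) →ₗ[ℝ] (Fin 3 → ℝ)) v

/-- A coordinate change between equal base points. -/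
theorem frame_symm_apply {p q : M} (h : q = p) (v : E3) :
    (σ.frame q).symm v = (σ.frame p).symm v := by
  subst h
  rfl

theorem derivHom_eq_one {f : DiffPlus o} {p : M} (h : ∀ᶠ q in 𝓝 p, f.1 q = q) :
    derivHom σ f p = 1 := by
  have hm : (mfderiv (𝓡 3) (𝓡 3) f.1 p : E3 →L[ℝ] E3) = ContinuousLinearMap.id ℝ E3 := by
    have h1 : f.1 =ᶠ[𝓝 p] id := h
    exact (h1.mfderiv_eq (I := 𝓡 3) (I' := 𝓡 3)).trans (mfderiv_id (I := 𝓡 3))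
  refine glMat_injective ?_
  change _ = (1 : Mat3)
  refine Matrix.ext_of_mulVec_single fun j => ?_
  rw [glMat_derivHom_mulVec, Matrix.one_mulVec]
  refine (frame_symm_apply σ h.self_of_nhds _).trans ?_
  refine Eq.trans ?_ ((σ.frame p).symm_apply_apply _)
  exact congrArg (σ.frame p).symm (DFunLike.congr_fun hm _)

theorem rotate_zero (s : Sphere2) : rotate 0 s = s := by
  refine Subtype.ext ?_
  ext i
  fin_cases i <;> simp [rotate]

theorem rotate_two_pi (s : Sphere2) : rotate (2 * Real.pi) s = s := by
  refine Subtype.ext ?_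
  ext i
  fin_cases i <;> simp [rotate]

/-! ### Coordinates along the axis of rotation -/

theorem contMDiff_coe_sphere2 : ContMDiff (𝓡 2) 𝓘(ℝ, E3) ∞ ((↑) : Sphere2 → E3) :=
  have := Fact.mk (finrank_euclideanSpace_fin (𝕜 := ℝ) (n := 2 + 1))
  contMDiff_coe_sphere (E := E3) (n := 2)

theorem contMDiff_codRestrict_sphere2 {f : E3 → E3} (hf : ContMDiff (𝓡 3) 𝓘(ℝ, E3) ∞ f)
    (hf' : ∀ x, f x ∈ Metric.sphere (0 : E3) 1) :
    ContMDiff (𝓡 3) (𝓡 2) ∞ (Set.codRestrict _ _ hf' : E3 → Sphere2) :=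
  have := Fact.mk (finrank_euclideanSpace_fin (𝕜 := ℝ) (n := 2 + 1))
  ContMDiff.codRestrict_sphere (E := E3) (n := 2) hf hf'

theorem planePoint_ne_zero (v : E3) : (!₂[v 0, v 1, 1] : E3) ≠ 0 := fun h => by
  have := congrArg (fun w : E3 => w 2) h
  simp at this

/-- The central projection of the plane `x₂ = 1` to the sphere. -/
def polePoint (v : E3) : Sphere2 :=
  Set.codRestrict (fun v : E3 => ‖(!₂[v 0, v 1, 1] : E3)‖⁻¹ • (!₂[v 0, v 1, 1] : E3))
    (Metric.sphere (0 : E3) 1) (fun v => by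
      rw [mem_sphere_zero_iff_norm, norm_smul, norm_inv, norm_norm,
        inv_mul_cancel₀ (norm_ne_zero_iff.2 (planePoint_ne_zero v))]) v

theorem contDiff_planePoint : ContDiff ℝ ∞ fun v : E3 => (!₂[v 0, v 1, 1] : E3) := by
  rw [contDiff_euclidean]
  intro i
  fin_cases i <;> simp <;> fun_prop

theorem contMDiff_polePoint : ContMDiff (𝓡 3) (𝓡 2) ∞ polePoint := by
  have h : ContDiff ℝ ∞ fun v : E3 => ‖(!₂[v 0, v 1, 1] : E3)‖⁻¹ • (!₂[v 0, v 1, 1] : E3) :=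
    ((contDiff_planePoint.norm ℝ planePoint_ne_zero).inv
      fun v => norm_ne_zero_iff.2 (planePoint_ne_zero v)).smul contDiff_planePoint
  exact contMDiff_codRestrict_sphere2 h.contMDiff _

/-- The coordinates on a tubular neighbourhood near the axis of rotation. -/
def axisChart (v : E3) : Sphere2 × ℝ := (polePoint v, v 2)

theorem contMDiff_axisChart : ContMDiff (𝓡 3) ((𝓡 2).prod 𝓘(ℝ, ℝ)) ∞ axisChart := by
  refine contMDiff_polePoint.prodMk (ContDiff.contMDiff ?_)
  fun_prop

/-- The inverse of `axisChart`. -/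
def axisCoord (x : Sphere2 × ℝ) : E3 := !₂[x.1.1 0 / x.1.1 2, x.1.1 1 / x.1.1 2, x.2]

theorem axisCoord_axisChart (v : E3) : axisCoord (axisChart v) = v := by
  have h := norm_ne_zero_iff.2 (planePoint_ne_zero v)
  ext i
  fin_cases i <;> simp [axisCoord, axisChart, polePoint, Set.codRestrict] <;> field_simp

theorem mdifferentiableAt_axisCoord {x : Sphere2 × ℝ} (hx : x.1.1 2 ≠ 0) :
    MDifferentiableAt ((𝓡 2).prod 𝓘(ℝ, ℝ)) (𝓡 3) axisCoord x := by
  let g : E3 × ℝ → E3 := fun y => !₂[y.1 0 / y.1 2, y.1 1 / y.1 2, y.2]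
  have hg : DifferentiableAt ℝ g (x.1.1, x.2) := by
    rw [differentiableAt_euclidean]
    intro i
    fin_cases i <;> simp [g] <;> fun_prop (disch := exact hx)
  have hc : MDifferentiableAt ((𝓡 2).prod 𝓘(ℝ, ℝ)) 𝓘(ℝ, E3 × ℝ)
      (fun x : Sphere2 × ℝ => ((x.1 : E3), x.2)) x := by
    have h1 : ContMDiff ((𝓡 2).prod 𝓘(ℝ, ℝ)) 𝓘(ℝ, E3) ∞ (fun x : Sphere2 × ℝ => (x.1 : E3)) :=
      contMDiff_coe_sphere2.comp contMDiff_fst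
    exact (h1.prodMk_space contMDiff_snd).mdifferentiableAt (by simp)
  exact MDifferentiableAt.comp x (g := g) hg.mdifferentiableAt hc

/-- The chart has the left inverse `axisCoord`, which is differentiable where the third coordinate
on the sphere is nonzero. -/
theorem injective_mfderiv_axisChart (v : E3) :
    Function.Injective (mfderiv (𝓡 3) ((𝓡 2).prod 𝓘(ℝ, ℝ)) axisChart v) := by
  have h2 : (axisChart v).1.1 2 ≠ 0 := by
    have h := norm_ne_zero_iff.2 (planePoint_ne_zero v)
    simp [axisChart, polePoint, Set.codRestrict]
  have hd := mdifferentiableAt_axisCoord h2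
  have hc := mfderiv_comp v hd (contMDiff_axisChart.mdifferentiableAt (by simp))
  have hid : axisCoord ∘ axisChart = id := funext axisCoord_axisChart
  rw [hid, mfderiv_id] at hc
  intro a b hab
  exact (DFunLike.congr_fun hc a).trans
    ((congrArg (mfderiv ((𝓡 2).prod 𝓘(ℝ, ℝ)) (𝓡 3) axisCoord (axisChart v)) hab).trans
      (DFunLike.congr_fun hc b).symm)

/-- The rotation about the third axis by the angle `θ x₂`. -/
def axisTwist (θ : ℝ → ℝ) (v : E3) : E3 :=
  !₂[Real.cos (θ (v 2)) * v 0 - Real.sin (θ (v 2)) * v 1,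
    Real.sin (θ (v 2)) * v 0 + Real.cos (θ (v 2)) * v 1, v 2]

/-- Rotation about the third axis preserves the plane x₂ = 1 and the norm, hence commutes with
central projection. -/
theorem rotate_polePoint (θ : ℝ → ℝ) (v : E3) :
    rotate (θ (v 2)) (polePoint v) = polePoint (axisTwist θ v) := by
  have hn : ‖(!₂[axisTwist θ v 0, axisTwist θ v 1, 1] : E3)‖ = ‖(!₂[v 0, v 1, 1] : E3)‖ := by
    rw [EuclideanSpace.norm_eq, EuclideanSpace.norm_eq]
    congr 1
    simp [Fin.sum_univ_three, axisTwist]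
    linear_combination (v 0 ^ 2 + v 1 ^ 2) * Real.sin_sq_add_cos_sq (θ (v 2))
  refine Subtype.ext ?_
  simp only [polePoint, Set.val_codRestrict_apply, rotate, hn]
  ext i
  fin_cases i <;> simp [axisTwist] <;> ring

/-- The matrix of the rotation about the third axis. -/
def rotMatrix (θ : ℝ) : Mat3 :=
  !![Real.cos θ, -Real.sin θ, 0; Real.sin θ, Real.cos θ, 0; 0, 0, 1]

/-- The points of the third axis. -/
def axisPoint (t : ℝ) : E3 := !₂[0, 0, t]

theorem axisTwist_axisPoint (θ : ℝ → ℝ) (t : ℝ) : axisTwist θ (axisPoint t) = axisPoint t := by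
  ext i
  fin_cases i <;> simp [axisTwist, axisPoint]

/-- The terms containing the derivative of θ carry a factor v 0 or v 1, which vanishes on the axis;
only the rotation remains. -/
theorem hasFDerivAt_axisTwist {θ : ℝ → ℝ} (hθ : Differentiable ℝ θ) (t : ℝ) :
    HasFDerivAt (axisTwist θ) ((Matrix.toEuclideanLin (rotMatrix (θ t))).toContinuousLinearMap)
      (axisPoint t) := by
  have hp : ∀ i, HasFDerivAt (fun v : E3 => v i) (EuclideanSpace.proj i : E3 →L[ℝ] ℝ)
    (axisPoint t) := fun i => (EuclideanSpace.proj i : E3 →L[ℝ] ℝ).hasFDerivAt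
  have hθ' : HasFDerivAt (fun v : E3 => θ (v 2)) (fderiv ℝ (fun v : E3 => θ (v 2)) (axisPoint t))
    (axisPoint t) := DifferentiableAt.hasFDerivAt (by fun_prop)
  rw [← hasFDerivWithinAt_univ, hasFDerivWithinAt_euclidean]
  intro i
  rw [hasFDerivWithinAt_univ]
  fin_cases i
  · refine ((hθ'.cos.mul (hp 0)).sub (hθ'.sin.mul (hp 1))).congr_fderiv ?_
    ext v
    simp [axisPoint, rotMatrix, Matrix.toEuclideanLin, Fin.sum_univ_three, Matrix.mulVec, dotProduct]
    try ring
  · refine ((hθ'.sin.mul (hp 0)).add (hθ'.cos.mul (hp 1))).congr_fderiv ?_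
    ext v
    simp [axisPoint, rotMatrix, Matrix.toEuclideanLin, Fin.sum_univ_three, Matrix.mulVec, dotProduct]
    try ring
  · refine (hp 2).congr_fderiv ?_
    ext v
    simp [rotMatrix, Matrix.toEuclideanLin, Fin.sum_univ_three, Matrix.mulVec, dotProduct]

end Derivative

/-! ### A full turn along a path of frames -/

section AxisLoop

theorem continuous_inv_of_det_ne_zero {Y : Type*} [TopologicalSpace Y] {B : Y → Mat3}
    (hB : Continuous B) (hdet : ∀ y, (B y).det ≠ 0) : Continuous fun y => (B y)⁻¹ := by
  have : (fun y => (B y)⁻¹) = fun y => ((B y).det)⁻¹ • (B y).adjugate := by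
    funext y
    rw [Matrix.inv_def, Ring.inverse_eq_inv']
  rw [this]
  exact (hB.matrix_det.inv₀ hdet).smul hB.matrix_adjugate

theorem det_rotMatrix (θ : ℝ) : (rotMatrix θ).det = 1 := by
  rw [Matrix.det_fin_three]
  simp [rotMatrix]
  linear_combination Real.sin_sq_add_cos_sq θ

theorem continuous_rotMatrix : Continuous rotMatrix := by
  refine continuous_matrix fun i j => ?_
  fin_cases i <;> fin_cases j <;> simp [rotMatrix] <;> fun_prop

theorem rotMatrix_zero : rotMatrix 0 = 1 := by
  ext i j
  fin_cases i <;> fin_cases j <;> simp [rotMatrix]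

theorem rotMatrix_two_pi : rotMatrix (2 * Real.pi) = 1 := by
  ext i j
  fin_cases i <;> fin_cases j <;> simp [rotMatrix]

theorem det_conj_pos {B R : Mat3} (hB : B.det ≠ 0) (hR : 0 < R.det) : 0 < (B * R * B⁻¹).det := by
  have h : B.det * (B⁻¹).det = 1 := by
    rw [← Matrix.det_mul, Matrix.mul_nonsing_inv _ (isUnit_iff_ne_zero.2 hB), Matrix.det_one]
  rw [Matrix.det_mul, Matrix.det_mul, mul_right_comm, h, one_mul]
  exact hR

/-- Conjugation by an invertible matrix of any sign. -/
def conjGL (B : Mat3) (hB : B.det ≠ 0) : C(GL(3, ℝ)⁺, GL(3, ℝ)⁺) where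
  toFun A := glMk (B * glMat A * B⁻¹) (det_conj_pos hB (glMat_det_pos A))
  continuous_toFun := by
    apply continuous_glPos
    exact (continuous_const.mul continuous_glMat).mul continuous_const

/-- The adjugate of a rotation is its transpose, so the cross product of the first two columns is
the third one and all normalizing lengths are one. -/
theorem orthoMap_glMk_of_mem {R : Mat3} (h : R.transpose * R = 1 ∧ R.det = 1) :
    (orthoMap (glMk R (by rw [h.2]; exact one_pos))).1 = R := by
  have hc := SO3.cofactor ⟨R, h⟩
  have hcol : vecLen (fun i => R i 0) = 1 := by
    have := congrFun (congrFun h.1 0) 0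
    rw [vecLen, Real.sqrt_eq_one]
    simp [Matrix.mul_apply, Fin.sum_univ_three] at this
    linarith
  have hcr : ∀ i, colCross R i = R i 2 := by
    intro i
    have := congrFun (congrFun hc 2) i
    rw [Matrix.adjugate_fin_three] at this
    fin_cases i <;> simp [colCross] at this ⊢ <;> linarith
  have hcl : vecLen (colCross R) = 1 := by
    have := congrFun (congrFun h.1 2) 2
    rw [vecLen, Real.sqrt_eq_one, hcr, hcr, hcr]
    simp [Matrix.mul_apply, Fin.sum_univ_three] at this
    linarith
  have hmid : ∀ i, R i 1 = R.adjugate 1 i := fun i => by rw [hc]; rfl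
  change orthoMatrix R = R
  unfold orthoMatrix
  rw [hcol, hcl]
  simp only [hcr, div_one]
  have m0 := hmid 0
  have m1 := hmid 1
  have m2 := hmid 2
  rw [Matrix.adjugate_fin_three] at m0 m1 m2
  ext i j
  fin_cases i <;> fin_cases j <;> simp [orthoFrame] at m0 m1 m2 ⊢ <;> linarith

theorem rotMatrix_mem (θ : ℝ) :
    (rotMatrix θ).transpose * rotMatrix θ = 1 ∧ (rotMatrix θ).det = 1 := by
  refine ⟨?_, det_rotMatrix θ⟩
  have h := Real.sin_sq_add_cos_sq θ
  ext i j
  fin_cases i <;> fin_cases j <;> simp [rotMatrix, Matrix.mul_apply, Fin.sum_univ_three] <;>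
    linarith

/-- The quaternion of the rotation about the third axis. -/
def rotQuat (θ : ℝ) : Sphere3 :=
  ⟨!₂[Real.cos (θ / 2), 0, 0, Real.sin (θ / 2)], by
    rw [mem_sphere_zero_iff_norm, EuclideanSpace.norm_eq, Real.sqrt_eq_one]
    simp [Fin.sum_univ_four]⟩

theorem continuous_rotQuat : Continuous rotQuat := by
  refine Continuous.subtype_mk ?_ _
  refine (PiLp.continuous_toLp 2 _).comp (continuous_pi fun i => ?_)
  fin_cases i <;> simp <;> fun_prop

theorem rho_rotQuat (θ : ℝ) : (rho (rotQuat θ)).1 = rotMatrix θ := by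
  have hc : Real.cos θ = Real.cos (θ / 2) ^ 2 - Real.sin (θ / 2) ^ 2 := by
    rw [← Real.cos_two_mul']; ring_nf
  have hs : Real.sin θ = 2 * Real.sin (θ / 2) * Real.cos (θ / 2) := by
    rw [← Real.sin_two_mul]; ring_nf
  have h1 := Real.sin_sq_add_cos_sq (θ / 2)
  ext i j
  fin_cases i <;> fin_cases j <;>
    simp [rho, quatMatrix, rotQuat, rotMatrix, hc, hs] <;> linarith

/-- The half angle in the quaternion makes a full turn end at the antipode; this sign is the source
of the nontrivial twisting class. -/
theorem rotQuat_two_pi : rotQuat (2 * Real.pi) = -rotQuat 0 := by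
  refine Subtype.ext ?_
  ext i
  fin_cases i <;> simp [rotQuat]

/-- A full turn conjugated by a path of invertible matrices is not null-homotopic. -/
theorem not_lift_conj_rotMatrix {B : ℝ → Mat3} (hB : Continuous B) (hdet : ∀ t, (B t).det ≠ 0)
    {θ : ℝ → ℝ} (hθ : Continuous θ) (h0 : θ 0 = 0) (h1 : θ 1 = 2 * Real.pi)
    {Φ : unitInterval → GL(3, ℝ)⁺} (hΦ : ∀ t : unitInterval, glMat (Φ t) * B t = B t * rotMatrix (θ t)) :
    ¬ ∃ Γ : C(unitInterval, Sphere3), (∀ t, rho (Γ t) = orthoMap (Φ t)) ∧ Γ 0 = Γ 1 := by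
  have hinv : ∀ t, B t * (B t)⁻¹ = 1 := fun t =>
    Matrix.mul_nonsing_inv _ (isUnit_iff_ne_zero.2 (hdet t))
  have hinv' : ∀ t, (B t)⁻¹ * B t = 1 := fun t =>
    Matrix.nonsing_inv_mul _ (isUnit_iff_ne_zero.2 (hdet t))
  have hpos : ∀ s t, 0 < (B s * rotMatrix (θ t) * (B s)⁻¹).det := fun s t =>
    det_conj_pos (hdet s) (by rw [det_rotMatrix]; exact one_pos)
  -- The factor s in B(st) contracts the path of frames to B(0). The end points stay at 1 because
  -- the rotations by 0 and 2π are the identity.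
  let K : unitInterval × unitInterval → GL(3, ℝ)⁺ := fun x => glMk _ (hpos (x.1 * x.2) x.2)
  have hK : Continuous K := by
    apply continuous_glPos
    have hx : Continuous fun x : unitInterval × unitInterval => (x.1 : ℝ) * x.2 := by fun_prop
    have hy : Continuous fun x : unitInterval × unitInterval => (x.2 : ℝ) := by fun_prop
    exact ((hB.comp hx).mul (continuous_rotMatrix.comp (hθ.comp hy))).mul
      ((continuous_inv_of_det_ne_zero hB hdet).comp hx)
  have hK0 : ∀ s, K (s, 0) = 1 := fun s => glMat_injective (by
    change B _ * rotMatrix (θ ((0 : unitInterval) : ℝ)) * (B _)⁻¹ = 1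
    rw [show ((0 : unitInterval) : ℝ) = 0 from rfl, h0, rotMatrix_zero, mul_one, hinv])
  have hK1 : ∀ s, K (s, 1) = 1 := fun s => glMat_injective (by
    change B _ * rotMatrix (θ ((1 : unitInterval) : ℝ)) * (B _)⁻¹ = 1
    rw [show ((1 : unitInterval) : ℝ) = 1 from rfl, h1, rotMatrix_two_pi, mul_one, hinv])
  let δ : unitInterval → Path (1 : GL(3, ℝ)⁺) 1 := fun s =>
    ⟨⟨fun t => K (s, t), hK.comp (by fun_prop)⟩, hK0 s, hK1 s⟩
  have hδ : (δ 0).Homotopic (δ 1) :=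
    ⟨⟨⟨⟨K, hK⟩, fun t => rfl, fun t => rfl⟩, by
      rintro s t (rfl | rfl)
      · exact (hK0 s).trans (hK0 0).symm
      · exact (hK1 s).trans (hK1 0).symm⟩⟩
  have hδΦ : ∀ t, δ 1 t = Φ t := fun t => glMat_injective (by
    change B (((1 : unitInterval) : ℝ) * t) * rotMatrix (θ t) * (B (((1 : unitInterval) : ℝ) * t))⁻¹ = _
    rw [show ((1 : unitInterval) : ℝ) = 1 from rfl, one_mul, ← hΦ t, mul_assoc, hinv, mul_one])
  have hz : ∀ {A : GL(3, ℝ)⁺} (δ : Path A A), loopParity δ = 0 ↔ δ.Homotopic (Path.refl A) := by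
    intro A δ
    unfold loopParity
    split_ifs with h <;> simp [h]
  have hlp : ∀ {A : GL(3, ℝ)⁺} (δ : Path A A), δ.Homotopic (Path.refl A) ↔
      ∃ Γ : C(unitInterval, Sphere3), (∀ t, rho (Γ t) = orthoMap (δ t)) ∧ Γ 0 = Γ 1 := by
    intro A δ
    rw [← hz]
    exact loopParity_eq_zero_iff (ContinuousMap.id _) δ
  rintro ⟨Γ, hΓ, hΓ01⟩
  have hδ1 : (δ 1).Homotopic (Path.refl 1) :=
    (hlp (δ 1)).2 ⟨Γ, fun t => by rw [hΓ t, hδΦ], hΓ01⟩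
  -- B(0) may reverse orientation, so it is removed by conjugating within `GL₃⁺(ℝ)` rather than by a
  -- path to the identity.
  have hdet' : ((B 0)⁻¹).det ≠ 0 := by
    have := congrArg Matrix.det (hinv' 0)
    rw [Matrix.det_mul, Matrix.det_one] at this
    exact left_ne_zero_of_mul_eq_one this
  let κ := conjGL (B 0)⁻¹ hdet'
  have hκ : ((δ 0).map κ.continuous).Homotopic ((Path.refl 1).map κ.continuous) :=
    (hδ.trans hδ1).map κ
  obtain ⟨G, hG, hG01⟩ := (hlp ((δ 0).map κ.continuous)).1 hκ
  have hκδ : ∀ t, orthoMap ((δ 0).map κ.continuous t) = rho (rotQuat (θ t)) := by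
    intro t
    have h2 : (δ 0).map κ.continuous t = glMk (rotMatrix (θ t))
        (by rw [det_rotMatrix]; exact one_pos) := glMat_injective (by
      change (B 0)⁻¹ * (B (((0 : unitInterval) : ℝ) * t) * rotMatrix (θ t) *
        (B (((0 : unitInterval) : ℝ) * t))⁻¹) * ((B 0)⁻¹)⁻¹ = rotMatrix (θ t)
      rw [show ((0 : unitInterval) : ℝ) = 0 from rfl, zero_mul,
        Matrix.nonsing_inv_nonsing_inv _ (isUnit_iff_ne_zero.2 (hdet 0))]
      rw [← mul_assoc, ← mul_assoc, hinv', one_mul, mul_assoc, hinv', mul_one])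
    rw [h2]
    exact Subtype.ext ((orthoMap_glMk_of_mem (rotMatrix_mem _)).trans (rho_rotQuat _).symm)
  have hq : ∀ t, rho (G t) = rho (rotQuat (θ t)) := fun t => (hG t).trans (hκδ t)
  obtain ⟨a, ha⟩ := exists_eq_flip (hq 0)
  have hrq : Continuous fun t : unitInterval => flip a (rotQuat (θ t)) :=
    (continuous_flip a).comp (continuous_rotQuat.comp (hθ.comp continuous_subtype_val))
  have hGr : G = ⟨_, hrq⟩ :=
    rho_lift_unique (fun t => (hq t).trans (rho_flip a _).symm) (a₀ := 0) ha
  rw [hGr] at hG01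
  change flip a (rotQuat (θ ((0 : unitInterval) : ℝ))) =
    flip a (rotQuat (θ ((1 : unitInterval) : ℝ))) at hG01
  rw [show ((1 : unitInterval) : ℝ) = 1 from rfl, show ((0 : unitInterval) : ℝ) = 0 from rfl, h0,
    h1, rotQuat_two_pi, ← flip_one, flip_flip] at hG01
  have h2 : ∀ a : ZMod 2, a ≠ a + 1 := by decide
  exact h2 a (flip_left_injective hG01)

end AxisLoop

/-! ### The lift of the derivative of a sphere twist -/

section TwistDerivative

variable {M : Type*} [TopologicalSpace M] [ChartedSpace E3 M] [IsManifold (𝓡 3) ∞ M]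
  {o : TangentOrientation M} (σ : OrientedTrivialization o)

/-- The derivative of a map along the third axis, in the given frame. -/
def axisFrame (H : E3 → M) (t : ℝ) : Mat3 := LinearMap.toMatrix'
  ((σ.frame (H (axisPoint t))).symm.toLinearEquiv.toLinearMap ∘ₗ
    (mfderiv (𝓡 3) (𝓡 3) H (axisPoint t) : E3 →L[ℝ] E3).toLinearMap ∘ₗ
      (WithLp.linearEquiv 2 ℝ (Fin 3 → ℝ)).symm.toLinearMap)

theorem axisFrame_mulVec (H : E3 → M) (t : ℝ) (v : Fin 3 → ℝ) :
    (axisFrame σ H t).mulVec v =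
      (σ.frame (H (axisPoint t))).symm (mfderiv (𝓡 3) (𝓡 3) H (axisPoint t) (WithLp.toLp 2 v)) :=
  LinearMap.toMatrix'_mulVec _ v

theorem continuous_axisPoint : Continuous axisPoint := by
  refine (PiLp.continuous_toLp 2 _).comp (continuous_pi fun i => ?_)
  fin_cases i <;> simp <;> fun_prop

theorem continuous_axisFrame {H : E3 → M} (hH : ContMDiff (𝓡 3) (𝓡 3) ∞ H) :
    Continuous (axisFrame σ H) := by
  refine continuous_matrix fun i j => ?_
  have hw : Continuous fun t => (⟨H (axisPoint t), mfderiv (𝓡 3) (𝓡 3) H (axisPoint t)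
      (WithLp.toLp 2 (Pi.single j 1))⟩ : TangentBundle (𝓡 3) M) := by
    have h1 : Continuous fun t => (tangentBundleModelSpaceHomeomorph (𝓡 3)).symm
        (axisPoint t, (WithLp.toLp 2 (Pi.single j 1) : E3)) :=
      (Homeomorph.continuous _).comp (continuous_axisPoint.prodMk continuous_const)
    exact (hH.continuous_tangentMap (by simp)).comp h1
  exact (continuous_apply i).comp (σ.continuous_coord _ _ hw)

theorem det_axisFrame_ne_zero {H : E3 → M} (t : ℝ)
    (hH : Function.Injective (mfderiv (𝓡 3) (𝓡 3) H (axisPoint t))) :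
    (axisFrame σ H t).det ≠ 0 := by
  have hinj : Function.Injective (axisFrame σ H t).mulVec := by
    intro v w hvw
    rw [axisFrame_mulVec, axisFrame_mulVec] at hvw
    exact WithLp.toLp_injective 2 (hH ((σ.frame _).symm.injective hvw))
  exact ((Matrix.isUnit_iff_isUnit_det _).1 (Matrix.mulVec_injective_iff_isUnit.1 hinj)).ne_zero

/-- Apply the chain rule to f ∘ H = H ∘ `axisTwist θ` at a point of the axis, which the twist fixes.
-/
theorem derivHom_mul_axisFrame {f : DiffPlus o} {H : E3 → M} (hH : ContMDiff (𝓡 3) (𝓡 3) ∞ H)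
    {θ : ℝ → ℝ} (hθ : Differentiable ℝ θ) (hf : ∀ v, f.1 (H v) = H (axisTwist θ v)) (t : ℝ) :
    glMat (derivHom σ f (H (axisPoint t))) * axisFrame σ H t =
      axisFrame σ H t * rotMatrix (θ t) := by
  set c := axisPoint t with hc
  have hfix : axisTwist θ c = c := axisTwist_axisPoint θ t
  have hG : HasMFDerivAt (𝓡 3) (𝓡 3) (axisTwist θ) c _ :=
    (hasFDerivAt_axisTwist hθ t).hasMFDerivAt
  have hHd : ∀ v, MDifferentiableAt (𝓡 3) (𝓡 3) H v := fun v => hH.mdifferentiableAt (by simp)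
  have h1 := mfderiv_comp c (f.1.contMDiff.mdifferentiableAt (by simp) :
    MDifferentiableAt (𝓡 3) (𝓡 3) f.1 (H c)) (hHd c)
  have h2 := mfderiv_comp c (hHd (axisTwist θ c)) hG.mdifferentiableAt
  rw [hG.mfderiv] at h2
  have h3 : (f.1 ∘ H : E3 → M) = H ∘ axisTwist θ := funext hf
  have h4 : ∀ w : E3, (mfderiv (𝓡 3) (𝓡 3) f.1 (H c) (mfderiv (𝓡 3) (𝓡 3) H c w) : E3) =
      mfderiv (𝓡 3) (𝓡 3) H c (Matrix.toEuclideanLin (rotMatrix (θ t)) w) := by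
    intro w
    have e1 : (mfderiv (𝓡 3) (𝓡 3) (f.1 ∘ H) c w : E3) = mfderiv (𝓡 3) (𝓡 3) (H ∘ axisTwist θ) c w :=
      congrArg (fun F : E3 → M => (mfderiv (𝓡 3) (𝓡 3) F c w : E3)) h3
    have e2 : (mfderiv (𝓡 3) (𝓡 3) H (axisTwist θ c)
        (Matrix.toEuclideanLin (rotMatrix (θ t)) w) : E3) =
        mfderiv (𝓡 3) (𝓡 3) H c (Matrix.toEuclideanLin (rotMatrix (θ t)) w) :=
      congrArg (fun v : E3 => (mfderiv (𝓡 3) (𝓡 3) H v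
        (Matrix.toEuclideanLin (rotMatrix (θ t)) w) : E3)) hfix
    exact (DFunLike.congr_fun h1 w).symm.trans (e1.trans ((DFunLike.congr_fun h2 w).trans e2))
  refine Matrix.ext_of_mulVec_single fun j => ?_
  rw [← Matrix.mulVec_mulVec, ← Matrix.mulVec_mulVec, axisFrame_mulVec, axisFrame_mulVec,
    glMat_derivHom_mulVec, ContinuousLinearEquiv.apply_symm_apply]
  refine (frame_symm_apply σ ((hf c).trans (congrArg H hfix)) _).trans ?_
  exact congrArg (σ.frame (H c)).symm (h4 _)

/-- The set-theoretic lift of the derivative of a sphere twist, which is continuous off the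
sphere. -/
theorem exists_twist_lift [T2Space M] {f : DiffPlus o} {e : Sphere2 × ℝ → M} {θ : ℝ → ℝ}
    (he : IsLocalDiffeomorph ((𝓡 2).prod 𝓘(ℝ, ℝ)) (𝓡 3) ∞ e) (hinj : Function.Injective e)
    (hθ : ContDiff ℝ ∞ θ) (h0 : ∀ t ≤ 0, θ t = 0) (h1 : ∀ t ≥ 1, θ t = 2 * Real.pi)
    (hf : ∀ s t, f.1 (e (s, t)) = e (rotate (θ t) s, t)) (hf' : ∀ p ∉ Set.range e, f.1 p = p) :
    ∃ l : M → Sphere3, (∀ p, rho (l p) = orthoMap (derivHom σ f p)) ∧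
      ContinuousOn l (e '' (Set.univ ×ˢ {1 / 2}))ᶜ ∧
      ContinuousOn (fun p => flip (upper e p) (l p)) (Set.range e) := by
  have hoe : Topology.IsOpenEmbedding e :=
    .of_continuous_injective_isOpenMap he.contMDiff.continuous hinj he.isOpenMap
  obtain ⟨q₀, hq₀⟩ := rho_surjective (orthoMap 1)
  have hK : IsClosed (e '' (Set.univ ×ˢ Set.Icc (0 : ℝ) 1)) :=
    ((isCompact_univ.prod isCompact_Icc).image hoe.continuous).isClosed
  -- The test segment lies over the pole of the rotation, where the derivative is a conjugated full
  -- turn.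
  refine exists_tubular_lift (ψ := orthoMap.comp (derivHom σ f)) hoe (q₀ := q₀) (fun p hp => ?_)
    (polePoint (axisPoint 0)) ?_
  · rw [hq₀]
    refine congrArg orthoMap (derivHom_eq_one σ ?_)
    filter_upwards [hK.isOpen_compl.mem_nhds hp] with q hq
    by_cases hqe : q ∈ Set.range e
    · obtain ⟨⟨s, t⟩, rfl⟩ := hqe
      rw [hf]
      rcases lt_or_ge t 0 with ht | ht
      · rw [h0 t ht.le, rotate_zero]
      · have ht1 : 1 < t := by
          by_contra! h
          exact hq ⟨(s, t), ⟨trivial, ht, h⟩, rfl⟩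
        rw [h1 t ht1.le, rotate_two_pi]
    · exact hf' q hqe
  · have hH : ContMDiff (𝓡 3) (𝓡 3) ∞ (e ∘ axisChart) := he.contMDiff.comp contMDiff_axisChart
    refine not_lift_conj_rotMatrix (B := axisFrame σ (e ∘ axisChart)) (continuous_axisFrame σ hH)
      (fun t => det_axisFrame_ne_zero σ t ?_) hθ.continuous (h0 0 le_rfl) (h1 1 le_rfl)
      (Φ := fun t => derivHom σ f (e (polePoint (axisPoint 0), t))) fun t => ?_
    · have hd := mfderiv_comp (axisPoint t) ((he _).mdifferentiableAt (by simp))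
        (contMDiff_axisChart.mdifferentiableAt (by simp) (x := axisPoint t))
      intro v w hvw
      rw [hd] at hvw
      refine injective_mfderiv_axisChart _
        (((he (axisChart (axisPoint t))).mfderivToContinuousLinearEquiv (by simp)).injective ?_)
      exact hvw
    · refine derivHom_mul_axisFrame σ (f := f) hH (hθ.differentiable (by simp)) (fun v => ?_) t
      change f.1 (e (polePoint v, v 2)) = e (polePoint (axisTwist θ v), v 2)
      rw [hf, rotate_polePoint]

end TwistDerivative

/-! ### The cylinder over the sphere -/

/-- The homeomorphism `S² × ℝ ≅ ℝ³ ∖ {0}`. -/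
def cylinderHomeo : Sphere2 × ℝ ≃ₜ ({0}ᶜ : Set E3) :=
  ((Homeomorph.refl Sphere2).prodCongr Real.expOrderIso.toHomeomorph).trans
    (homeomorphUnitSphereProd E3).symm

/-- The embedding of `S² × ℝ` in `ℝ³` with image `ℝ³ ∖ {0}`. -/
def cylinderMap : C(Sphere2 × ℝ, E3) :=
  ⟨fun x => (cylinderHomeo x).1, continuous_subtype_val.comp cylinderHomeo.continuous⟩

theorem isEmbedding_cylinderMap : Topology.IsEmbedding cylinderMap :=
  Topology.IsEmbedding.subtypeVal.comp cylinderHomeo.isEmbedding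

theorem cylinderMap_mem (x : Sphere2 × ℝ) : cylinderMap x ∈ ({0}ᶜ : Set E3) := (cylinderHomeo x).2

theorem range_cylinderMap : Set.range cylinderMap = ({0}ᶜ : Set E3) := by
  ext y
  refine ⟨?_, fun hy => ⟨cylinderHomeo.symm ⟨y, hy⟩, ?_⟩⟩
  · rintro ⟨x, rfl⟩
    exact cylinderMap_mem x
  · change (cylinderHomeo (cylinderHomeo.symm ⟨y, hy⟩)).1 = y
    rw [Homeomorph.apply_symm_apply]

theorem exists_boundary_of_boundsIn {c : Chain 2 (Sphere2 × ℝ)}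
    (h : BoundsIn 2 ({0}ᶜ : Set E3) (pushforward 2 cylinderMap c)) :
    ∃ w, boundary 2 (Sphere2 × ℝ) w = c := by
  obtain ⟨w, hw, hwc⟩ := h
  rw [← range_cylinderMap] at hw
  obtain ⟨w', rfl⟩ := exists_pushforward_eq isEmbedding_cylinderMap hw
  rw [boundary_pushforward] at hwc
  exact ⟨w', pushforward_injective isEmbedding_cylinderMap.injective hwc⟩

/-- The second homology of `S² × ℝ` has at most one nonzero class. -/
theorem exists_boundary_cylinder {c₁ c₂ : Chain 2 (Sphere2 × ℝ)}
    (h₁ : boundary 1 (Sphere2 × ℝ) c₁ = 0) (h₂ : boundary 1 (Sphere2 × ℝ) c₂ = 0) :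
    (∃ w, boundary 2 (Sphere2 × ℝ) w = c₁) ∨ (∃ w, boundary 2 (Sphere2 × ℝ) w = c₂) ∨
      ∃ w, boundary 2 (Sphere2 × ℝ) w = c₁ + c₂ := by
  have h := boundsIn_punctured (pushforward_mem_chainsIn_range cylinderMap_mem c₁)
    (pushforward_mem_chainsIn_range cylinderMap_mem c₂)
    (by rw [boundary_pushforward, h₁, map_zero]) (by rw [boundary_pushforward, h₂, map_zero])
  rw [← map_add] at h
  exact h.imp exists_boundary_of_boundsIn
    (Or.imp exists_boundary_of_boundsIn exists_boundary_of_boundsIn)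

/-- The third homology of `S² × ℝ` relative to the complement of a point receives nothing from the
absolute one. -/
theorem exists_eq_boundary_add_cylinder {z : Chain 3 (Sphere2 × ℝ)}
    (h : boundary 2 (Sphere2 × ℝ) z = 0) (x : Sphere2 × ℝ) :
    ∃ w, ∃ d ∈ chainsIn 3 ({x}ᶜ : Set (Sphere2 × ℝ)), z = boundary 3 (Sphere2 × ℝ) w + d := by
  obtain ⟨w, hw, d, hd, hz⟩ := exists_eq_boundary_add_punctured
    (pushforward_mem_chainsIn_range cylinderMap_mem z)
    (by rw [boundary_pushforward, h, map_zero]) (cylinderMap_mem x)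
  have hd' := chainsIn_mono (Set.inter_subset_left) hd
  rw [← range_cylinderMap] at hw hd'
  obtain ⟨w, rfl⟩ := exists_pushforward_eq isEmbedding_cylinderMap hw
  obtain ⟨d, rfl⟩ := exists_pushforward_eq isEmbedding_cylinderMap hd'
  refine ⟨w, d, ?_, ?_⟩
  · refine chainsIn_mono ?_ (mem_chainsIn_of_pushforward isEmbedding_cylinderMap.injective hd)
    rintro y hy rfl
    exact hy.2 rfl
  · rw [boundary_pushforward, ← map_add] at hz
    exact pushforward_injective isEmbedding_cylinderMap.injective hz

/-! ### Duality -/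

section Duality

variable {X : Type*} [TopologicalSpace X]

theorem chainsIn_empty {n : ℕ} {c : Chain n X} (h : c ∈ chainsIn n (∅ : Set X)) : c = 0 :=
  eq_on_chainsIn LinearMap.id 0
    (fun _ hσ => absurd (hσ ⟨stdSimplex.vertex 0, rfl⟩) (Set.notMem_empty _)) h

theorem IsFundamentalCycle.ne_boundary {n : ℕ} {z : Chain (n + 1) X} (h : IsFundamentalCycle n z)
    (x : X) (w : Chain (n + 2) X) : boundary (n + 1) X w ≠ z := by
  rintro rfl
  exact h.2 x (Submodule.mem_sup_left ⟨w, rfl⟩)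

theorem capZero_eq_smul {n : ℕ} {β : X → ZMod 2} {A : Set X} {r : ZMod 2} (h : ∀ x ∈ A, β x = r)
    {c : Chain n X} (hc : c ∈ chainsIn n A) : capZero n β c = r • c :=
  eq_on_chainsIn (capZero n β) (r • LinearMap.id) (fun σ hσ => by
    rw [capZero_of, h _ (hσ ⟨_, rfl⟩)]
    rfl) hc

/-- A fundamental cycle decomposed along a tubular neighbourhood: the part of the boundary of the
inner piece above the sphere represents the class of the sphere. -/
theorem exists_boundary_eq_add_sphere (e : C(Sphere2 × ℝ, X)) (he : Function.Injective e)
    {z : Chain 3 X} (hz : IsFundamentalCycle 2 z) {w : Chain 4 X}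
    {a' : Chain 3 (Sphere2 × ℝ)} {b : Chain 3 X} (hzab : z = boundary 3 X w + pushforward 3 e a' + b)
    (hb : b ∈ chainsIn 3 (e '' (Set.univ ×ˢ {1 / 2}))ᶜ) {y₁ y₀ : Chain 2 (Sphere2 × ℝ)}
    (hy₁ : y₁ ∈ chainsIn 2 {x : Sphere2 × ℝ | 2 / 3 < x.2})
    (hy₀ : y₀ ∈ chainsIn 2 {x : Sphere2 × ℝ | x.2 < 1 / 3})
    (hay : boundary 2 (Sphere2 × ℝ) a' = y₁ + y₀) {s : Chain 2 Sphere2}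
    (hs : IsFundamentalCycle 1 s) :
    ∃ t, boundary 2 (Sphere2 × ℝ) t = y₁ + pushforward 2 ⟨fun s => (s, 1 / 2), by fun_prop⟩ s := by
  -- The boundary of y₁ equals that of y₀, so it lies both above 2/3 and below 1/3.
  have hcyc : boundary 1 (Sphere2 × ℝ) y₁ = 0 := by
    have h1 : boundary 1 (Sphere2 × ℝ) y₁ = boundary 1 (Sphere2 × ℝ) y₀ := by
      apply eq_of_add_eq_zero
      rw [← map_add, ← hay, boundary_boundary]
    refine chainsIn_empty (chainsIn_mono ?_ (mem_chainsIn_inter (boundary_mem_chainsIn hy₁)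
      (h1 ▸ boundary_mem_chainsIn hy₀)))
    rintro x ⟨h2, h3⟩
    simp only [Set.mem_ofPred_eq] at h2 h3
    linarith
  let N : Sphere2 := ⟨EuclideanSpace.single 0 1, by simp⟩
  rcases exists_boundary_cylinder hcyc (c₂ := pushforward 2 ⟨fun s => (s, 1 / 2), by fun_prop⟩ s)
    (by rw [boundary_pushforward, hs.1, map_zero]) with ⟨u, hu⟩ | ⟨u, hu⟩ | h
  -- Suppose y₁ bounds u. Clamping u above 2/3 and u + a' below 1/3 gives fillings of y₁ and y₀ that
  -- miss the core. They close a' to a cycle, which is trivial relative to the complement of a core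
  -- point. Then z is trivial relative to the complement of the image of that point.
  · exfalso
    let rp : C(Sphere2 × ℝ, Sphere2 × ℝ) := ⟨fun x => (x.1, max x.2 (2 / 3)), by fun_prop⟩
    let rm : C(Sphere2 × ℝ, Sphere2 × ℝ) := ⟨fun x => (x.1, min x.2 (1 / 3)), by fun_prop⟩
    have hp : boundary 2 _ (pushforward 3 rp u) = y₁ := by
      rw [boundary_pushforward, hu]
      refine pushforward_eq_self (fun x hx => Prod.ext rfl ?_) hy₁
      exact max_eq_left (le_of_lt hx)
    have hm : boundary 2 _ (pushforward 3 rm (u + a')) = y₀ := by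
      rw [boundary_pushforward, map_add, hu, hay, ← add_assoc, Chain.add_self, zero_add]
      refine pushforward_eq_self (fun x hx => Prod.ext rfl ?_) hy₀
      exact min_eq_left (le_of_lt hx)
    set up := pushforward 3 rp u
    set um := pushforward 3 rm (u + a')
    have hup : up ∈ chainsIn 3 ({(N, 1 / 2)}ᶜ : Set (Sphere2 × ℝ)) :=
      pushforward_mem_chainsIn_range (fun x hx => by
        have h1 : max x.2 (2 / 3) = 1 / 2 := congrArg Prod.snd hx
        have := le_max_right x.2 (2 / 3)
        linarith) u
    have hum : um ∈ chainsIn 3 ({(N, 1 / 2)}ᶜ : Set (Sphere2 × ℝ)) :=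
      pushforward_mem_chainsIn_range (fun x hx => by
        have h1 : min x.2 (1 / 3) = 1 / 2 := congrArg Prod.snd hx
        have := min_le_right x.2 (1 / 3)
        linarith) (u + a')
    obtain ⟨w', d, hd, hwd⟩ := exists_eq_boundary_add_cylinder (z := a' + (up + um))
      (by rw [map_add, map_add, hp, hm, hay, Chain.add_self]) (N, 1 / 2)
    have ha' : a' = boundary 3 _ w' + (d + (up + um)) := by
      rw [← add_assoc, ← hwd, add_assoc, Chain.add_self, add_zero]
    refine hz.2 (e (N, 1 / 2)) ?_
    have hz' : z = boundary 3 X (w + pushforward 4 e w') +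
        (pushforward 3 e (d + (up + um)) + b) := by
      rw [hzab, ha', map_add (pushforward 3 e), map_add (boundary 3 X), boundary_pushforward]
      abel
    rw [hz']
    refine Submodule.add_mem_sup ⟨_, rfl⟩ (Submodule.add_mem _ ?_ ?_)
    · refine pushforward_mem_chainsIn ?_ (Submodule.add_mem _ hd (Submodule.add_mem _ hup hum))
      exact fun x hx hxe => hx (he hxe)
    · refine chainsIn_mono ?_ hb
      rintro x hx rfl
      exact hx ⟨(N, 1 / 2), ⟨trivial, rfl⟩, rfl⟩
  -- A filling of the core would project to a filling of s in S².
  · exfalso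
    refine hs.ne_boundary N (pushforward 3 ⟨Prod.fst, continuous_fst⟩ u) ?_
    rw [boundary_pushforward, hu, pushforward_pushforward]
    exact pushforward_id s
  · exact h

theorem eq_pointCochain (b : Cochain 0 X) :
    b = pointCochain fun p => b (ContinuousMap.const _ p) := by
  funext σ
  change b σ = b (ContinuousMap.const _ (σ (stdSimplex.vertex 0)))
  congr 1
  ext x
  exact congrArg σ (Subsingleton.elim x (stdSimplex.vertex 0))

theorem cap_congr_on {A : Set X} {c d : Cochain 1 X}
    (h : ∀ σ : SingularSimplex 1 X, Set.range σ ⊆ A → c σ = d σ) {z : Chain 3 X}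
    (hz : z ∈ chainsIn 3 A) : cap c z = cap d z :=
  eq_on_chainsIn (cap c) (cap d) (fun σ hσ => by
    rw [cap_of, cap_of, h _ ((σ.range_face_subset _).trans hσ)]) hz

/-- A class given by intersection with a two-sided sphere is Poincaré dual to the sphere. -/
theorem isPoincareDual_of_tubular [T2Space X] (e : C(Sphere2 × ℝ, X))
    (he : Topology.IsOpenEmbedding e) (c : OneCocycle X)
    (hc₀ : ∀ σ : SingularSimplex 1 X, Set.range σ ⊆ (e '' (Set.univ ×ˢ {1 / 2}))ᶜ → c.1 σ = 0)
    (hc₁ : ∀ σ : SingularSimplex 1 X, Set.range σ ⊆ Set.range e →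
      c.1 σ = upper e (σ (stdSimplex.vertex 0)) + upper e (σ (stdSimplex.vertex 1)))
    {s : Chain 2 Sphere2} (hs : IsFundamentalCycle 1 s) :
    IsPoincareDual (Submodule.Quotient.mk c : H1 X)
      (pushforward 2 (e.comp ⟨fun s => (s, 1 / 2), by fun_prop⟩) s) := by
  intro c' z hc' hz
  rw [Submodule.Quotient.eq] at hc'
  obtain ⟨b₀, hb₀⟩ := hc'
  have hc'eq : c'.1 = c.1 + coboundary 0 X b₀ := by
    rw [hb₀]
    exact (add_sub_cancel c.1 c'.1).symm
  have hcap' : cap c'.1 z = cap c.1 z + cap (coboundary 0 X b₀) z := by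
    rw [hc'eq]
    have : cap (c.1 + coboundary 0 X b₀) = cap c.1 + cap (coboundary 0 X b₀) :=
      Chain.hom_ext fun σ => by
        rw [LinearMap.add_apply, cap_of, cap_of, cap_of, ← add_smul]
        rfl
    rw [this, LinearMap.add_apply]
  -- Another representative of the class changes the cap product with the cycle z by a boundary.
  rw [eq_pointCochain b₀, cap_coboundary, hz.1, map_zero, add_zero] at hcap'
  have hK : IsClosed (e '' (Set.univ ×ˢ Set.Icc (1 / 3 : ℝ) (2 / 3))) :=
    ((isCompact_univ.prod isCompact_Icc).image he.continuous).isClosed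
  -- The two open sets overlap in the tube minus the slab [1/3, 2/3], so ∂a falls apart into a piece
  -- above the core and one below.
  obtain ⟨m, a, ha, b, hb, hab⟩ := exists_sdOp_eq_add he.isOpen_range hK.isOpen_compl
    (c := z) (chainsIn_mono (fun x _ => by
      by_cases hx : x ∈ Set.range e
      · exact Or.inl hx
      · exact Or.inr fun ⟨y, _, hy⟩ => hx ⟨y, hy⟩) (mem_chainsIn_univ z))
  have hw := boundary_sdHom (m := m) z
  rw [hz.1, map_zero, add_zero, hab] at hw
  set w := sdHom 3 m X z
  have hzab : z = boundary 3 X w + a + b := by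
    rw [hw, add_assoc, add_assoc, Chain.add_self, add_zero]
  have hbS : b ∈ chainsIn 3 (e '' (Set.univ ×ˢ {1 / 2}))ᶜ := by
    refine chainsIn_mono ?_ hb
    rintro x hx ⟨y, hy, rfl⟩
    refine hx ⟨y, ⟨trivial, ?_, ?_⟩, rfl⟩ <;> rw [hy.2] <;> norm_num
  have hdab : boundary 2 X a = boundary 2 X b := by
    apply eq_of_add_eq_zero
    rw [← map_add, ← hab, boundary_sdOp, hz.1, map_zero]
  obtain ⟨a', rfl⟩ := exists_pushforward_eq he.isEmbedding ha
  have hda : boundary 2 _ a' ∈ chainsIn 2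
      ({x : Sphere2 × ℝ | 2 / 3 < x.2} ∪ {x : Sphere2 × ℝ | x.2 < 1 / 3}) := by
    have h1 := boundary_mem_chainsIn hb
    rw [← hdab, boundary_pushforward] at h1
    refine chainsIn_mono ?_ (mem_chainsIn_of_pushforward he.injective h1)
    intro x hx
    by_contra h2
    simp only [Set.mem_union, Set.mem_ofPred_eq, not_or, not_lt] at h2
    exact hx ⟨x, ⟨trivial, h2.2, h2.1⟩, rfl⟩
  obtain ⟨y₁, hy₁, y₀, hy₀, hy⟩ := exists_add_of_mem_chainsIn_union
    (isOpen_lt continuous_const continuous_snd) (isOpen_lt continuous_snd continuous_const)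
    (Set.disjoint_left.2 fun x h1 h2 => by
      simp only [Set.mem_ofPred_eq] at h1 h2
      linarith) hda
  obtain ⟨t, ht⟩ := exists_boundary_eq_add_sphere e he.injective hz hzab hbS hy₁ hy₀ hy hs
  have hcapb : cap c.1 b = 0 := by
    rw [cap_congr_on (d := 0) hc₀ hbS]
    have : cap (0 : Cochain 1 X) = 0 := Chain.hom_ext fun σ => by
      rw [cap_of]
      simp
    rw [this, LinearMap.zero_apply]
  -- In the tube c is the coboundary of `upper e`, which is 1 on the upper piece of ∂a and 0 on the
  -- lower one.
  have hcapa : cap c.1 (pushforward 3 e a') =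
      boundary 2 X (capZero 3 (upper e) (pushforward 3 e a')) + pushforward 2 e y₁ := by
    rw [cap_congr_on (d := coboundary 0 X (pointCochain (upper e)))
      (fun σ hσ => by rw [coboundary_pointCochain, hc₁ σ hσ, add_comm]) ha, cap_coboundary]
    congr 1
    rw [boundary_pushforward, hy, map_add, map_add]
    rw [capZero_eq_smul (A := e '' {x : Sphere2 × ℝ | 2 / 3 < x.2}) (r := 1) ?_
      (pushforward_mem_chainsIn (Set.mapsTo_image _ _) hy₁),
      capZero_eq_smul (A := e '' {x : Sphere2 × ℝ | x.2 < 1 / 3}) (r := 0) ?_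
      (pushforward_mem_chainsIn (Set.mapsTo_image _ _) hy₀), one_smul, zero_smul, add_zero]
    · rintro _ ⟨x, hx, rfl⟩
      rw [upper_apply he.injective, if_neg]
      simp only [Set.mem_ofPred_eq] at hx
      linarith
    · rintro _ ⟨x, hx, rfl⟩
      rw [upper_apply he.injective, if_pos]
      simp only [Set.mem_ofPred_eq] at hx
      linarith
  rw [hcap', hzab, map_add, map_add, hcapb, cap_boundary, hcapa, add_zero, ← pushforward_pushforward,
    ZModModule.sub_eq_add]
  -- The summands account in turn for the cap product with ∂w, the exact part of the cap product
  -- with a, the homology from y₁ to the core, and the change of representative.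
  refine ⟨capFour c.1 w + capZero 3 (upper e) (pushforward 3 e a') + pushforward 3 e t +
    capZero 3 (fun p => b₀ (ContinuousMap.const _ p)) z, ?_⟩
  rw [map_add, map_add, map_add, boundary_pushforward, ht, map_add, ← hzab]
  abel

end Duality

/-! ### Intersection numbers -/

section Crossing

variable {X : Type*} [TopologicalSpace X]

/-- The segment of a curve between two parameters. -/
def segment (γ : C(ℝ, X)) (a b : ℝ) : SingularSimplex 1 X :=
  γ.comp ⟨fun x => x.1 0 * a + x.1 1 * b, by
    have h0 : Continuous fun x : Simplex 1 => x.1 0 :=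
      (continuous_apply 0).comp continuous_subtype_val
    have h1 : Continuous fun x : Simplex 1 => x.1 1 :=
      (continuous_apply 1).comp continuous_subtype_val
    exact (h0.mul continuous_const).add (h1.mul continuous_const)⟩

theorem segment_vertex_zero (γ : C(ℝ, X)) (a b : ℝ) :
    segment γ a b (stdSimplex.vertex 0) = γ a := by
  simp [segment]

theorem segment_vertex_one (γ : C(ℝ, X)) (a b : ℝ) :
    segment γ a b (stdSimplex.vertex 1) = γ b := by
  simp [segment]

theorem range_segment_subset (γ : C(ℝ, X)) {a b : ℝ} {A : Set X} (hab : a ≤ b)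
    (h : ∀ t ∈ Set.Icc a b, γ t ∈ A) : Set.range (segment γ a b) ⊆ A := by
  rintro _ ⟨x, rfl⟩
  refine h _ ?_
  have h0 := x.2.1 0
  have h1 := x.2.1 1
  have hx := Simplex.add_one x
  have e0 : x.1 0 = 1 - x.1 1 := by linarith
  change x.1 0 * a + x.1 1 * b ∈ _
  rw [e0] at h0 ⊢
  constructor <;> nlinarith

/-- The affine triangle in ℝ with vertices a, b, d has these segments as edges, whatever the order
of the three numbers. -/
theorem OneCocycle.segment_trans (c : OneCocycle X) (γ : C(ℝ, X)) (a b d : ℝ) :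
    c.1 (segment γ a d) = c.1 (segment γ a b) + c.1 (segment γ b d) := by
  let σ : SingularSimplex 2 X := γ.comp ⟨fun x => x.1 0 * a + x.1 1 * b + x.1 2 * d, by
    have hi : ∀ i, Continuous fun x : Simplex 2 => x.1 i := fun i =>
      (continuous_apply i).comp continuous_subtype_val
    exact (((hi 0).mul continuous_const).add ((hi 1).mul continuous_const)).add
      ((hi 2).mul continuous_const)⟩
  have h0 : ∀ (g : Fin 2 → Fin 3) (x : Simplex 1),
      σ.face g x = γ ((stdSimplex.map g x : Simplex 2).1 0 * a +
        (stdSimplex.map g x : Simplex 2).1 1 * b + (stdSimplex.map g x : Simplex 2).1 2 * d) :=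
    fun _ _ => rfl
  have e01 : σ.face ![0, 1] = segment γ a b := by
    ext x
    obtain ⟨h1, h2⟩ := Simplex.map_zero_one x
    have h3 : (stdSimplex.map ![0, 1] x : Simplex 2).1 0 = x.1 0 :=
      Simplex.map_apply (g := ![0, 1]) (by decide) x 0
    rw [h0, h1, h2, h3, zero_mul, add_zero]
    rfl
  have e02 : σ.face ![0, 2] = segment γ a d := by
    ext x
    obtain ⟨h1, h2⟩ := Simplex.map_zero_two x
    have h3 : (stdSimplex.map ![0, 2] x : Simplex 2).1 0 = x.1 0 :=
      Simplex.map_apply (g := ![0, 2]) (by decide) x 0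
    rw [h0, h1, h2, h3, zero_mul, add_zero]
    rfl
  have e12 : σ.face ![1, 2] = segment γ b d := by
    ext x
    obtain ⟨h1, h2⟩ := Simplex.map_one_two x
    have h3 : (stdSimplex.map ![1, 2] x : Simplex 2).1 0 = 0 :=
      Simplex.map_apply_of_notMem x (by decide)
    rw [h0, h1, h2, h3, zero_mul, zero_add]
    rfl
  have h := OneCocycle.sum_face c σ
  rw [e01, e02, e12] at h
  have h2 : ∀ u v w : ZMod 2, u + v + w = 0 → v = w + u := by decide
  exact h2 _ _ _ h

/-- The curve `γ` crosses `S` at the parameter `t`, where `χ` has the value `α` just before `t` and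
the other value just after `t`. -/
def CrossesAt (γ : C(ℝ, X)) (S U : Set X) (χ : X → ZMod 2) (t : ℝ) (α : ZMod 2) : Prop :=
  ∃ ε > 0, (∀ u, |u - t| < ε → γ u ∈ U) ∧ (∀ u ∈ Set.Ioo (t - ε) t, γ u ∉ S ∧ χ (γ u) = α) ∧
    ∀ u ∈ Set.Ioo t (t + ε), γ u ∉ S ∧ χ (γ u) = α + 1

/-- Points are counted on half-open parameter intervals, so an arc with an end on S needs a
correction term. The corrected identity holds for short arcs, is additive, and over a full period
the corrections cancel. -/
theorem segment_eq_ncard_of_crossesAt (c : OneCocycle X) (γ : C(ℝ, X)) {S U : Set X}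
    (hS : IsClosed S) {χ : X → ZMod 2} (hχ : ∀ x ∈ S, χ x = 0)
    (hc₀ : ∀ σ : SingularSimplex 1 X, Set.range σ ⊆ Sᶜ → c.1 σ = 0)
    (hc₁ : ∀ σ : SingularSimplex 1 X, Set.range σ ⊆ U →
      c.1 σ = χ (σ (stdSimplex.vertex 0)) + χ (σ (stdSimplex.vertex 1)))
    (hcr : ∀ t, γ t ∈ S → ∃ α, CrossesAt γ S U χ t α) (hper : Function.Periodic γ 1) :
    {t : ℝ | t ∈ Set.Ico 0 1 ∧ γ t ∈ S}.Finite ∧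
      c.1 (segment γ 0 1) = ({t : ℝ | t ∈ Set.Ico 0 1 ∧ γ t ∈ S}.ncard : ZMod 2) := by
  classical
  choose! α hα using hcr
  -- As χ = 0 on S, a short arc from off S ending on S at t has value α t and no counted point; one
  -- starting on S at t and ending off S has value α t + 1 and one counted point. The correction α t
  -- balances both.
  let κ : ℝ → ZMod 2 := fun t => if γ t ∈ S then α t else 0
  have hκ : ∀ t, γ t ∉ S → κ t = 0 := fun t ht => if_neg ht
  have hκ' : ∀ t, γ t ∈ S → κ t = α t := fun t ht => if_pos ht
  let Z : ℝ → ℝ → Set ℝ := fun a b => {t : ℝ | t ∈ Set.Ico a b ∧ γ t ∈ S}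
  let P : ℝ → ℝ → Prop := fun a b =>
    (Z a b).Finite ∧ c.1 (segment γ a b) + ((Z a b).ncard : ZMod 2) = κ a + κ b
  have hZ0 : ∀ a b, (∀ t ∈ Set.Ico a b, γ t ∉ S) → Z a b = ∅ := fun a b h =>
    Set.eq_empty_of_forall_notMem fun t ht => h t ht.1 ht.2
  have hZ1 : ∀ a b t, t ∈ Set.Ico a b → γ t ∈ S → (∀ u ∈ Set.Ico a b, u ≠ t → γ u ∉ S) →
      Z a b = {t} := by
    intro a b t ht htS h
    ext u
    refine ⟨fun hu => ?_, fun hu => ?_⟩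
    · by_contra hut
      exact h u hu.1 hut hu.2
    · rw [Set.mem_singleton_iff] at hu
      subst hu
      exact ⟨ht, htS⟩
  have hoff : ∀ a b, a ≤ b → (∀ t ∈ Set.Icc a b, γ t ∉ S) → P a b := by
    intro a b hab h
    have hZ := hZ0 a b fun t ht => h t ⟨ht.1, ht.2.le⟩
    refine ⟨by rw [hZ]; exact Set.finite_empty, ?_⟩
    rw [hZ, hc₀ _ (range_segment_subset γ hab h), hκ a (h a ⟨le_rfl, hab⟩),
      hκ b (h b ⟨hab, le_rfl⟩)]
    simp
  have htrans : ∀ a b d, a ≤ b → b ≤ d → P a b → P b d → P a d := by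
    rintro a b d hab hbd ⟨hf1, h1⟩ ⟨hf2, h2⟩
    have hU : Z a d = Z a b ∪ Z b d := by
      ext t
      simp only [Z, Set.mem_ofPred_eq, Set.mem_union, ← or_and_right, Set.mem_Ico]
      refine and_congr_left fun _ => ⟨fun h => ?_, fun h => ?_⟩
      · rcases lt_or_ge t b with h' | h'
        · exact Or.inl ⟨h.1, h'⟩
        · exact Or.inr ⟨h', h.2⟩
      · rcases h with h | h
        · exact ⟨h.1, h.2.trans_le hbd⟩
        · exact ⟨hab.trans h.1, h.2⟩
    have hdisj : Disjoint (Z a b) (Z b d) :=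
      Set.disjoint_left.2 fun t h h' => absurd h.1.2 (not_lt.2 h'.1.1)
    refine ⟨by rw [hU]; exact hf1.union hf2, ?_⟩
    rw [hU, Set.ncard_union_eq hdisj hf1 hf2, OneCocycle.segment_trans c γ a b d]
    push_cast
    have h3 : ∀ s t m n x y z : ZMod 2, s + m = x + y → t + n = y + z →
        s + t + (m + n) = x + z := by decide
    exact h3 _ _ _ _ _ _ _ h1 h2
  have hloc : ∀ t : ℝ, ∃ ε > 0, ∀ a b, a ≤ b → |a - t| < ε → |b - t| < ε → P a b := by
    intro t
    by_cases ht : γ t ∈ S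
    · obtain ⟨ε, hε, hU, hl, hr⟩ := hα t ht
      refine ⟨ε, hε, fun a b hab ha hb => ?_⟩
      rw [abs_lt] at ha hb
      have hne : ∀ u ∈ Set.Icc a b, u ≠ t → γ u ∉ S := by
        intro u hu hut
        rcases lt_or_gt_of_ne hut with h | h
        · exact (hl u ⟨by linarith [hu.1], h⟩).1
        · exact (hr u ⟨h, by linarith [hu.2]⟩).1
      have hseg : c.1 (segment γ a b) = χ (γ a) + χ (γ b) := by
        rw [hc₁ _ (range_segment_subset γ hab fun u hu => hU u
          (abs_lt.2 ⟨by linarith [hu.1], by linarith [hu.2]⟩)), segment_vertex_zero,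
          segment_vertex_one]
      rcases lt_trichotomy b t with hbt | rfl | hbt
      · exact hoff a b hab fun u hu => hne u hu (hu.2.trans_lt hbt).ne
      · rcases hab.eq_or_lt with rfl | hab'
        · have hZ := hZ0 a a (by simp)
          refine ⟨by rw [hZ]; exact Set.finite_empty, ?_⟩
          rw [hZ, hseg, Set.ncard_empty, CharTwo.add_self_eq_zero, CharTwo.add_self_eq_zero]
          simp
        · have hZ := hZ0 a b fun u hu => hne u ⟨hu.1, hu.2.le⟩ hu.2.ne
          refine ⟨by rw [hZ]; exact Set.finite_empty, ?_⟩
          rw [hZ, hseg, hχ _ ht, (hl a ⟨by linarith, hab'⟩).2, hκ' _ ht,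
            hκ _ (hl a ⟨by linarith, hab'⟩).1, Set.ncard_empty]
          simp
      · rcases lt_trichotomy a t with hat | rfl | hat
        · have hZ := hZ1 a b t ⟨hat.le, hbt⟩ ht fun u hu => hne u ⟨hu.1, hu.2.le⟩
          refine ⟨by rw [hZ]; exact Set.finite_singleton t, ?_⟩
          rw [hZ, hseg, (hl a ⟨by linarith, hat⟩).2, (hr b ⟨hbt, by linarith⟩).2,
            hκ _ (hl a ⟨by linarith, hat⟩).1, hκ _ (hr b ⟨hbt, by linarith⟩).1,
            Set.ncard_singleton]
          generalize α t = x
          revert x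
          decide
        · have hZ := hZ1 a b a ⟨le_rfl, hbt⟩ ht fun u hu => hne u ⟨hu.1, hu.2.le⟩
          refine ⟨by rw [hZ]; exact Set.finite_singleton a, ?_⟩
          rw [hZ, hseg, hχ _ ht, (hr b ⟨hbt, by linarith⟩).2, hκ' _ ht,
            hκ _ (hr b ⟨hbt, by linarith⟩).1, Set.ncard_singleton]
          generalize α a = x
          revert x
          decide
        · exact hoff a b hab fun u hu => hne u hu (hat.trans_le hu.1).ne'
    · have : γ ⁻¹' Sᶜ ∈ 𝓝 t := γ.continuous.continuousAt (hS.isOpen_compl.mem_nhds ht)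
      obtain ⟨ε, hε, h⟩ := Metric.mem_nhds_iff.1 this
      refine ⟨ε, hε, fun a b hab ha hb => hoff a b hab fun u hu => ?_⟩
      rw [abs_lt] at ha hb
      exact h (by rw [Metric.mem_ball, Real.dist_eq, abs_lt]
                  exact ⟨by linarith [hu.1], by linarith [hu.2]⟩)
  choose ε hε hP using hloc
  -- By compactness finitely many short arcs make up [0,1].
  obtain ⟨τ, hτ0, hτm, ⟨n, hn⟩, hτ⟩ := exists_monotone_Icc_subset_open_cover_Icc
    (zero_le_one (α := ℝ)) (c := fun t : ℝ => {u : Set.Icc (0 : ℝ) 1 | |u.1 - t| < ε t})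
    (fun t => isOpen_lt (by fun_prop) continuous_const)
    (fun u _ => Set.mem_iUnion.2 ⟨u.1, by simpa using hε u.1⟩)
  have hind : ∀ k, P 0 (τ k) := by
    intro k
    induction k with
    | zero =>
      rw [hτ0]
      exact hP 0 0 0 le_rfl (by simpa using hε 0) (by simpa using hε 0)
    | succ k ih =>
      obtain ⟨t, ht⟩ := hτ k
      refine htrans 0 (τ k) (τ (k + 1)) (τ k).2.1 (hτm k.le_succ) ih
        (hP t _ _ (hτm k.le_succ) (ht ⟨le_rfl, hτm k.le_succ⟩) (ht ⟨hτm k.le_succ, le_rfl⟩))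
  have hfin := hind n
  rw [hn n le_rfl] at hfin
  refine ⟨hfin.1, ?_⟩
  -- The value before a crossing is read at a parameter slightly to the left, and periodicity
  -- carries it from 0 to 1.
  have h01 : κ 0 = κ 1 := by
    have hγ : γ 1 = γ 0 := by simpa using hper 0
    by_cases h : γ 0 ∈ S
    · have h' : γ 1 ∈ S := by rwa [hγ]
      rw [hκ' _ h, hκ' _ h']
      obtain ⟨ε₀, hε₀, -, h₀, -⟩ := hα 0 h
      obtain ⟨ε₁, hε₁, -, h₁, -⟩ := hα 1 h'
      have hpos : 0 < min ε₀ ε₁ := lt_min hε₀ hε₁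
      have hl0 := min_le_left ε₀ ε₁
      have hl1 := min_le_right ε₀ ε₁
      rw [← (h₀ (-(min ε₀ ε₁ / 2)) ⟨by linarith, by linarith⟩).2,
        ← (h₁ (-(min ε₀ ε₁ / 2) + 1) ⟨by linarith, by linarith⟩).2, hper]
    · have h' : γ 1 ∉ S := by rwa [hγ]
      rw [hκ _ h, hκ _ h']
  have h2 := hfin.2
  rw [h01, CharTwo.add_self_eq_zero] at h2
  exact eq_of_add_eq_zero h2

end Crossing

/-! ### Transverse curves cross the core of a tube -/

section Transverse

theorem tangentVector_ext {M : Type*} [TopologicalSpace M] [ChartedSpace E3 M]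
    {p q : M} (h : p = q) {v w : E3} (hvw : v = w) :
    (⟨p, v⟩ : TangentBundle (𝓡 3) M) = ⟨q, w⟩ := by
  subst h hvw
  rfl

variable {M : Type*} [TopologicalSpace M] [ChartedSpace E3 M]

/-- In a tubular neighbourhood, a curve transverse to the core sphere has nonzero velocity in the
normal direction. -/
theorem exists_normal_coordinate {e : Sphere2 × ℝ → M}
    (he : IsLocalDiffeomorph ((𝓡 2).prod 𝓘(ℝ, ℝ)) (𝓡 3) ∞ e) {ι : Sphere2 → M}
    (hι : ∀ s, e (s, 1 / 2) = ι s) {γ : ℝ → M} (hγ : ContMDiff 𝓘(ℝ, ℝ) (𝓡 3) ∞ γ)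
    (htr : TransverseTo γ ι) {t₀ : ℝ} {s₀ : Sphere2} (ht₀ : γ t₀ = ι s₀) :
    ∃ (p : ℝ → Sphere2 × ℝ) (d : ℝ), (∀ᶠ t in 𝓝 t₀, γ t = e (p t)) ∧ p t₀ = (s₀, 1 / 2) ∧
      HasDerivAt (fun t => (p t).2) d t₀ ∧ d ≠ 0 := by
  have hx := he (s₀, 1 / 2)
  have hex : γ t₀ = e (s₀, 1 / 2) := by rw [hι, ht₀]
  let p : ℝ → Sphere2 × ℝ := fun t => hx.localInverse (γ t)
  have hp0 : p t₀ = (s₀, 1 / 2) := by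
    change hx.localInverse (γ t₀) = _
    rw [hex]
    exact hx.localInverse_left_inv hx.localInverse_mem_target
  have hev : ∀ᶠ t in 𝓝 t₀, γ t = e (p t) := by
    have h1 := hx.localInverse_eventuallyEq_right
    rw [← hex] at h1
    filter_upwards [hγ.continuous.continuousAt.eventually h1] with t ht
    exact ht.symm
  have hinv : MDifferentiableAt (𝓡 3) ((𝓡 2).prod 𝓘(ℝ, ℝ)) hx.localInverse (γ t₀) := by
    rw [hex]
    exact hx.localInverse_mdifferentiableAt (by simp)
  have hpd : MDifferentiableAt 𝓘(ℝ, ℝ) ((𝓡 2).prod 𝓘(ℝ, ℝ)) p t₀ :=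
    MDifferentiableAt.comp t₀ hinv (hγ.mdifferentiableAt (by simp))
  have hsnd : HasMFDerivAt 𝓘(ℝ, ℝ) 𝓘(ℝ, ℝ) (fun t => (p t).2) t₀ _ :=
    (hasMFDerivAt_snd (I := 𝓡 2) (I' := 𝓘(ℝ, ℝ)) (p t₀)).comp t₀ hpd.hasMFDerivAt
  have hfd : HasFDerivAt (fun t => (p t).2)
      ((ContinuousLinearMap.snd ℝ (EuclideanSpace ℝ (Fin 2)) ℝ).comp
        (mfderiv 𝓘(ℝ, ℝ) ((𝓡 2).prod 𝓘(ℝ, ℝ)) p t₀ : ℝ →L[ℝ] EuclideanSpace ℝ (Fin 2) × ℝ)) t₀ :=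
    hsnd.hasFDerivAt
  refine ⟨p, _, hev, hp0, hfd.hasDerivAt, ?_⟩
  -- Were the normal component zero, the velocity would be the image of a vector tangent to the
  -- level 1/2, hence tangent to the embedded sphere.
  intro hd
  have hd' : (mfderiv 𝓘(ℝ, ℝ) ((𝓡 2).prod 𝓘(ℝ, ℝ)) p t₀ (1 : ℝ) :
    EuclideanSpace ℝ (Fin 2) × ℝ).2 = 0 := hd
  set u : EuclideanSpace ℝ (Fin 2) × ℝ := mfderiv 𝓘(ℝ, ℝ) ((𝓡 2).prod 𝓘(ℝ, ℝ)) p t₀ (1 : ℝ) with hu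
  refine htr t₀ ⟨s₀, u.1⟩ ?_
  have hed : ∀ x, MDifferentiableAt ((𝓡 2).prod 𝓘(ℝ, ℝ)) (𝓡 3) e x := fun x =>
    (he x).mdifferentiableAt (by simp)
  have hιe : ι = e ∘ fun s => (s, 1 / 2) := funext fun s => (hι s).symm
  have hj : MDifferentiableAt (𝓡 2) ((𝓡 2).prod 𝓘(ℝ, ℝ)) (fun s : Sphere2 => (s, (1 / 2 : ℝ))) s₀ :=
    mdifferentiableAt_id.prodMk mdifferentiableAt_const
  have h1 : tangentMap (𝓡 2) (𝓡 3) ι ⟨s₀, u.1⟩ =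
      tangentMap ((𝓡 2).prod 𝓘(ℝ, ℝ)) (𝓡 3) e ⟨(s₀, 1 / 2), (u.1, (0 : ℝ))⟩ := by
    rw [hιe, tangentMap_comp_at _ (hed _) hj, tangentMap_prod_left]
  have h2 : (mfderiv 𝓘(ℝ, ℝ) (𝓡 3) γ t₀ (1 : ℝ) : E3) =
      mfderiv ((𝓡 2).prod 𝓘(ℝ, ℝ)) (𝓡 3) e (p t₀) u := by
    have h3 : γ =ᶠ[𝓝 t₀] e ∘ p := hev
    have h4 := h3.mfderiv_eq (I := 𝓘(ℝ, ℝ)) (I' := 𝓡 3)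
    exact (DFunLike.congr_fun h4 (1 : ℝ)).trans
      (DFunLike.congr_fun (mfderiv_comp t₀ (hed _) hpd) (1 : ℝ))
  rw [h1]
  refine tangentVector_ext hex (h2.trans ?_)
  have h5 : u = (u.1, (0 : ℝ)) := Prod.ext rfl hd'
  rw [h5]
  exact congrArg (fun x : Sphere2 × ℝ => (mfderiv ((𝓡 2).prod 𝓘(ℝ, ℝ)) (𝓡 3) e x
    (u.1, (0 : ℝ)) : E3)) hp0

/-- The normal coordinate minus 1/2 vanishes at t₀ with nonzero derivative d, so it changes sign
there and is nonzero nearby. -/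
theorem crossesAt_of_transverseTo {e : Sphere2 × ℝ → M}
    (he : IsLocalDiffeomorph ((𝓡 2).prod 𝓘(ℝ, ℝ)) (𝓡 3) ∞ e) (hinj : Function.Injective e)
    {ι : Sphere2 → M} (hι : ∀ s, e (s, 1 / 2) = ι s) {γ : ℝ → M}
    (hγ : ContMDiff 𝓘(ℝ, ℝ) (𝓡 3) ∞ γ) (htr : TransverseTo γ ι) {t₀ : ℝ}
    (ht₀ : γ t₀ ∈ Set.range ι) :
    ∃ α, CrossesAt ⟨γ, hγ.continuous⟩ (Set.range ι) (Set.range e) (upper e) t₀ α := by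
  obtain ⟨s₀, hs₀⟩ := ht₀
  obtain ⟨p, d, hev, hp0, hd, hd0⟩ := exists_normal_coordinate he hι hγ htr hs₀.symm
  have hS : ∀ x : Sphere2 × ℝ, x.2 ≠ 1 / 2 → e x ∉ Set.range ι := by
    rintro x hx ⟨s, hs⟩
    rw [← hι] at hs
    rw [← hinj hs] at hx
    exact hx rfl
  have hslope := hasDerivAt_iff_tendsto_slope.1 hd
  have hsl : ∀ᶠ t in 𝓝[≠] t₀, 0 < d * slope (fun t => (p t).2) t₀ t :=
    (hslope.const_mul d).eventually (lt_mem_nhds (mul_self_pos.2 hd0))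
  rw [eventually_nhdsWithin_iff] at hsl
  obtain ⟨ε, hε, hball⟩ := Metric.eventually_nhds_iff.1 (hev.and hsl)
  -- Multiplying the slope by (t - t₀)² clears its denominator, and the factor d treats both
  -- directions of crossing at once.
  have hkey : ∀ t, |t - t₀| < ε → t ≠ t₀ →
      0 < d * ((p t).2 - 1 / 2) * (t - t₀) := by
    intro t ht hne
    have h1 := (hball (y := t) (by rwa [Real.dist_eq])).2 hne
    rw [slope_def_field, hp0] at h1
    have h2 : 0 < (t - t₀) ^ 2 := by
      have := sub_ne_zero.2 hne
      positivity
    have h3 := mul_pos h1 h2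
    have h4 : t - t₀ ≠ 0 := sub_ne_zero.2 hne
    have h5 : d * (((p t).2 - 1 / 2) / (t - t₀)) * (t - t₀) ^ 2 =
        d * ((p t).2 - 1 / 2) * (t - t₀) := by field_simp
    rwa [h5] at h3
  have hep : ∀ t, |t - t₀| < ε → γ t = e (p t) := fun t ht =>
    (hball (y := t) (by rwa [Real.dist_eq])).1
  have hside : ∀ t, |t - t₀| < ε → t ≠ t₀ → γ t ∉ Set.range ι := by
    intro t ht hne
    rw [hep t ht]
    refine hS _ fun h => ?_
    have := hkey t ht hne
    rw [h] at this
    simp at this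
  have hup : ∀ t, |t - t₀| < ε → t ≠ t₀ →
      upper e (γ t) = if 0 < d * (t - t₀) then 1 else 0 := by
    intro t ht hne
    rw [hep t ht, upper_apply hinj]
    have h1 := hkey t ht hne
    have h2 : 0 < (d * (t - t₀)) * ((p t).2 - 1 / 2) := by linarith [h1]
    congr 1
    refine propext ⟨fun h => ?_, fun h => ?_⟩
    · exact (pos_iff_pos_of_mul_pos h2).2 (by linarith)
    · linarith [(pos_iff_pos_of_mul_pos h2).1 h]
  refine ⟨if 0 < d then 0 else 1, ε, hε, fun t ht => ⟨p t, (hep t ht).symm⟩, fun t ht => ?_,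
    fun t ht => ?_⟩
  · have h1 : |t - t₀| < ε := abs_lt.2 ⟨by linarith [ht.1], by linarith [ht.2]⟩
    refine ⟨hside t h1 ht.2.ne, (hup t h1 ht.2.ne).trans ?_⟩
    have h2 : t - t₀ < 0 := by linarith [ht.2]
    rcases lt_or_gt_of_ne hd0 with h | h
    · rw [if_pos (mul_pos_of_neg_of_neg h h2), if_neg (not_lt.2 h.le)]
    · rw [if_neg (not_lt.2 (mul_neg_of_pos_of_neg h h2).le), if_pos h]
  · have h1 : |t - t₀| < ε := abs_lt.2 ⟨by linarith [ht.1], by linarith [ht.2]⟩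
    refine ⟨hside t h1 ht.1.ne', (hup t h1 ht.1.ne').trans ?_⟩
    have h2 : 0 < t - t₀ := by linarith [ht.1]
    rcases lt_or_gt_of_ne hd0 with h | h
    · rw [if_neg (not_lt.2 (mul_neg_of_neg_of_pos h h2).le), if_neg (not_lt.2 h.le)]
      decide
    · rw [if_pos (mul_pos h h2), if_pos h, zero_add]

end Transverse

/-! ### Classes prescribed on loops -/

section TwistClass

/-- A cocycle whose class is prescribed on loops represents `H1.ofLoops`. -/
theorem H1.mk_eq_ofLoops {X : Type*} [TopologicalSpace X] {w : ∀ p : X, Path p p → ZMod 2}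
    (c : OneCocycle X) (hc : ∀ (p : X) (γ : Path p p), c.1 (pathSimplex γ) = w p γ) :
    H1.ofLoops w = Submodule.Quotient.mk c := by
  have hspec : ∀ (p : X) (γ : Path p p), (H1.ofLoops w).eval γ = w p γ :=
    Classical.epsilon_spec (p := fun a : H1 X => ∀ (p : X) (γ : Path p p), a.eval γ = w p γ)
      ⟨Submodule.Quotient.mk c, hc⟩
  exact H1.ext_eval fun p γ => (hspec p γ).trans (hc p γ).symm

theorem pathSimplex_periodicLoop {M : Type*} [TopologicalSpace M] (γ : ℝ → M) (hγ : Continuous γ) (hper : Function.Periodic γ 1) :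
    pathSimplex (periodicLoop γ hγ hper) = segment ⟨γ, hγ⟩ 0 1 := by
  ext x
  change γ (x.1 1) = γ (x.1 0 * 0 + x.1 1 * 1)
  rw [mul_zero, zero_add, mul_one]

end TwistClass

end SphereTwist
end
-- The twisting class of a sphere twist
open SphereTwist in
theorem lemma4p1 {M : Type*} [TopologicalSpace M] [ChartedSpace E3 M] [IsManifold (𝓡 3) ∞ M]
    [T2Space M] [CompactSpace M] (o : TangentOrientation M) (σ₀ : OrientedTrivialization o)
    (ι : Sphere2 → M) (hι : Manifold.IsSmoothEmbedding (𝓡 2) (𝓡 3) ∞ ι)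
    (T : MCG o) (hT : IsSphereTwist ι T) :
    -- `twisting σ₀ T` is the unique class whose values on loops are given by the `π₁`-functor
    (∀ a : H1 M, (∀ (p : M) (γ : Path p p), a.eval γ = (derivClass σ₀ T).onLoops p γ) ↔
      a = twisting σ₀ T) ∧
    -- it is Poincaré dual to the image of the fundamental class of the sphere
    (∀ s : Chain 2 Sphere2, IsFundamentalCycle 1 s →
      IsPoincareDual (twisting σ₀ T)
        (pushforward 2 ⟨ι, hι.contMDiff.continuous⟩ s)) ∧
    -- it computes mod-`2` intersection numbers of loops with the sphere
    (∀ (γ : ℝ → M) (hγ : ContMDiff 𝓘(ℝ, ℝ) (𝓡 3) ∞ γ) (hper : Function.Periodic γ 1),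
      TransverseTo γ ι →
      {t : ℝ | t ∈ Set.Ico 0 1 ∧ γ t ∈ Set.range ι}.Finite ∧
      (twisting σ₀ T).eval (periodicLoop γ hγ.continuous hper) =
        ({t : ℝ | t ∈ Set.Ico 0 1 ∧ γ t ∈ Set.range ι}.ncard : ZMod 2)) := by
  obtain ⟨f, ⟨e, θ, he, hinj, heι, hθ, h0, h1, hf, hf'⟩, rfl⟩ := hT
  obtain ⟨l, hl, hlS, hlU⟩ := exists_twist_lift σ₀ he hinj hθ h0 h1 hf hf'
  have hoe : Topology.IsOpenEmbedding e :=
    .of_continuous_injective_isOpenMap he.contMDiff.continuous hinj he.isOpenMap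
  have hS : e '' (Set.univ ×ˢ {1 / 2}) = Set.range ι := by
    ext p
    constructor
    · rintro ⟨⟨s, t⟩, ⟨-, rfl⟩, rfl⟩
      exact ⟨s, (heι s).symm⟩
    · rintro ⟨s, rfl⟩
      exact ⟨(s, 1 / 2), ⟨trivial, rfl⟩, heι s⟩
  -- This cocycle represents the twisting class; its vanishing off the sphere and its form in the
  -- tube give both duality and the count.
  let c : OneCocycle M := ⟨liftCochain (orthoMap.comp (derivHom σ₀ f)) l, liftCochain_mem hl⟩
  have hloops : ∀ (p : M) (γ : Path p p),
      c.1 (pathSimplex γ) = (derivClass σ₀ (MCG.mk f)).onLoops p γ :=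
    fun p γ => liftCochain_pathSimplex hl γ
  have hc₀ : ∀ σ : SingularSimplex 1 M, Set.range σ ⊆ (e '' (Set.univ ×ˢ {1 / 2}))ᶜ →
      c.1 σ = 0 := by
    intro σ hσ
    refine (liftCochain_eq_of_continuousOn (χ := 0) hl ?_ hσ).trans (add_zero 0)
    exact hlS.congr fun p _ => flip_zero _
  have hc₁ : ∀ σ : SingularSimplex 1 M, Set.range σ ⊆ Set.range e →
      c.1 σ = upper e (σ (stdSimplex.vertex 0)) + upper e (σ (stdSimplex.vertex 1)) :=
    fun σ hσ => liftCochain_eq_of_continuousOn hl hlU hσ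
  have htw : twisting σ₀ (MCG.mk f) = Submodule.Quotient.mk c := H1.mk_eq_ofLoops c hloops
  rw [htw]
  refine ⟨fun a => ⟨fun ha => H1.ext_eval fun p γ => (ha p γ).trans (hloops p γ).symm, ?_⟩,
    fun s hs => ?_, fun γ hγ hper htr => ?_⟩
  · rintro rfl
    exact hloops
  · have hιe : (⟨ι, hι.contMDiff.continuous⟩ : C(Sphere2, M)) =
        (⟨e, hoe.continuous⟩ : C(Sphere2 × ℝ, M)).comp ⟨fun s => (s, 1 / 2), by fun_prop⟩ := by
      ext s
      exact (heι s).symm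
    rw [hιe]
    exact isPoincareDual_of_tubular ⟨e, hoe.continuous⟩ hoe c hc₀ hc₁ hs
  · rw [H1.eval_mk, pathSimplex_periodicLoop]
    refine segment_eq_ncard_of_crossesAt c ⟨γ, hγ.continuous⟩ (U := Set.range e) (χ := upper e)
      (isCompact_range hι.contMDiff.continuous).isClosed ?_ (by rwa [hS] at hc₀) hc₁
      (fun t ht => crossesAt_of_transverseTo he hinj heι hγ htr ht) hper
    rintro _ ⟨s, rfl⟩
    -- The core belongs to the lower half, since `upper` requires the strict inequality 1/2 < t.
    rw [← heι, upper_apply hinj, if_neg (lt_irrefl _)]
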